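/- **Proposition.** Let $k$ be a perfect field of characteristic $p>0$, let $K=W(k)[\tfrac1p]$ with valuation $v$ normalised by $v(p)=1$, and let $\sigma$ be the automorphism of $K$ that lifts the Frobenius of $k$. Let $n\ge 1$, $m\ge 0$, $f\ge 1$ be integers, put $q=p^f$, and let $r<1$ be a real number. Put $$\mathcal A=K\langle T_1^{\pm},\dots,T_n^{\pm},T_{n+1},\dots,T_{n+m}\rangle ,$$ extend $v$ to the valuation of the Gauss norm, and extend $\sigma$ to $\mathcal A$ by $\sigma(T_i)=T_i^p$. For $1\le i\le n$ and $x\in\mathcal A$ with $T_i$-adic expansion $x=\sum_{d\in\mathbb Z}a_dT_i^d$ put $w^{(i)}_j(x)=\min\{d: v(a_d)\le j\}$ (with $\min\emptyset=+\infty$), and let $\mathcal A^r\subseteq\mathcal A$ be the subring of all $x$ for which there is $c>0$ such that $w^{(i)}_j(x)\ge -c\,p^{rj}$ for $i=1,\dots,n$ and all sufficiently large integers $j$. For $R=\mathcal A^r$ or $R=K\langle T_1,\dots,T_{n+m}\rangle$ let $\Omega_R=\bigoplus_i R\,dT_i$ be the module of continuous differentials. A $(\sigma^f,\nabla)$-module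 over $R$ is a locally free $R$-module $M$ of finite rank with a $\sigma^f$-semilinear map $\varphi:M\to M$ whose linearization $R\otimes_{\sigma^f,R}M\to M$ is an isomorphism, and a connection $\nabla:M\to M\otimes_R\Omega_R$ such that $\nabla\circ\varphi=(\varphi\otimes\sigma^f)\circ\nabla$, where $\sigma^f(dT_i)=qT_i^{q-1}dT_i$ on differentials. Let $M$ be a $(\sigma^f,\nabla)$-module of rank one over $\mathcal A^r$. Then there are an integer $\tau\ge 1$ and a $(\sigma^f,\nabla)$-module $N$ over the Tate algebra $K\langle T_1,\dots,T_{n+m}\rangle$ together with an isomorphism $$\mathcal A^r\otimes_{K\langle T_1,\dots,T_{n+m}\rangle}N\;\cong\;M^{\otimes\tau}$$ of $\mathcal A^r$-modules that is compatible with the Frobenius maps and with the connections. -/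

import Mathlib

open Filter Topology TensorProduct
open scoped NNReal

universe u v

namespace LogDecay

noncomputable section

section WittField

variable (p : ℕ) [Fact p.Prime] (k : Type*) [Field k] [CharP k p] [PerfectRing k p]

/-- The field `K = W(k)[1/p]`, i.e. the fraction field of the ring of `p`-typical Witt vectors. -/
def WittField (p : ℕ) [Fact p.Prime] (k : Type*) [Field k] [CharP k p] [PerfectRing k p] :
    Type _ :=
  FractionRing (WittVector p k)

instance : Field (WittField p k) :=
  inferInstanceAs (Field (FractionRing (WittVector p k)))

instance : Algebra (WittVector p k) (WittField p k) :=
  inferInstanceAs (Algebra (WittVector p k) (FractionRing (WittVector p k)))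

instance : IsFractionRing (WittVector p k) (WittField p k) :=
  inferInstanceAs (IsFractionRing (WittVector p k) (FractionRing (WittVector p k)))

/-- The `p`-adic absolute value on `K`, normalised by `|p| = 1/p`. -/
def WittField.abv : AbsoluteValue (WittField p k) ℝ :=
  (IsDiscreteValuationRing.maximalIdeal (WittVector p k)).adicAbv (b := (p : ℝ≥0))
    (by exact_mod_cast (Fact.out : p.Prime).one_lt)

instance : NormedField (WittField p k) := (WittField.abv p k).toNormedField

theorem WittField.norm_def (x : WittField p k) : ‖x‖ = WittField.abv p k x := rfl

instance : IsUltrametricDist (WittField p k) :=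
  IsUltrametricDist.isUltrametricDist_of_isNonarchimedean_norm
    (IsDedekindDomain.HeightOneSpectrum.isNonarchimedean_adicAbv _ _)

theorem WittField.norm_algebraMap_le_one (w : WittVector p k) :
    ‖algebraMap (WittVector p k) (WittField p k) w‖ ≤ 1 :=
  IsDedekindDomain.HeightOneSpectrum.adicAbv_coe_le_one _ _ _

theorem WittField.norm_unit (u : (WittVector p k)ˣ) :
    ‖algebraMap (WittVector p k) (WittField p k) u‖ = 1 := by
  rw [WittField.norm_def]
  refine (IsDedekindDomain.HeightOneSpectrum.adicAbv_coe_eq_one_iff _ _ _).2 ?_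
  intro h
  exact (IsLocalRing.maximalIdeal.isMaximal (WittVector p k)).ne_top
    (Ideal.eq_top_of_isUnit_mem _ h u.isUnit)

theorem WittField.norm_p : ‖(p : WittField p k)‖ = (p : ℝ)⁻¹ := by
  have h0 : (p : WittVector p k) ≠ 0 := (WittVector.irreducible p).ne_zero
  have h1 := IsDedekindDomain.HeightOneSpectrum.intValuation_singleton
    (v := IsDiscreteValuationRing.maximalIdeal (WittVector p k)) h0
    ((IsDiscreteValuationRing.irreducible_iff_uniformizer _).1 (WittVector.irreducible p))
  have h2 : (p : WittField p k) = algebraMap (WittVector p k) (WittField p k) p := by simp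
  rw [h2, WittField.norm_def, WittField.abv,
    IsDedekindDomain.HeightOneSpectrum.adicAbv_of_algebraMap]
  have hb : (1 : ℝ≥0) < (p : ℝ≥0) := by exact_mod_cast (Fact.out : p.Prime).one_lt
  change ((WithZeroMulInt.toNNReal (ne_zero_of_lt hb) (IsDedekindDomain.HeightOneSpectrum.intValuation _ _) : ℝ≥0)
    : ℝ) = _
  rw [h1, WithZeroMulInt.toNNReal_neg_apply _ WithZero.exp_ne_zero]
  change (((p : ℝ≥0) ^ (-1 : ℤ) : ℝ≥0) : ℝ) = _
  simp

theorem WittField.exists_lift {x : WittField p k} (hx : ‖x‖ ≤ 1) :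
    ∃ w : WittVector p k, algebraMap (WittVector p k) (WittField p k) w = x := by
  refine IsDiscreteValuationRing.exists_lift_of_le_one ?_
  have hb : (1 : ℝ≥0) < (p : ℝ≥0) := by exact_mod_cast (Fact.out : p.Prime).one_lt
  refine (WithZeroMulInt.toNNReal_le_one_iff hb).1 ?_
  exact_mod_cast hx

theorem WittField.p_ne_zero : (p : WittField p k) ≠ 0 := by
  intro h
  have h1 := WittField.norm_p p k
  rw [h, norm_zero] at h1
  have hp : (0 : ℝ) < p := by exact_mod_cast (Fact.out : p.Prime).pos
  exact (inv_pos.2 hp).ne h1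

theorem WittField.norm_algebraMap_le_pow_iff (w : WittVector p k) (N : ℕ) :
    ‖algebraMap (WittVector p k) (WittField p k) w‖ ≤ ((p : ℝ)⁻¹) ^ N ↔
      w ∈ Ideal.span {(p : WittVector p k)} ^ N := by
  have hp := WittField.p_ne_zero p k
  have hp' : (0 : ℝ) < (p : ℝ)⁻¹ := by
    rw [← WittField.norm_p p k]; exact norm_pos_iff.2 hp
  rw [Ideal.span_singleton_pow, Ideal.mem_span_singleton]
  constructor
  · intro h
    have h1 : ‖algebraMap (WittVector p k) (WittField p k) w / (p : WittField p k) ^ N‖ ≤ 1 := by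
      rw [norm_div, norm_pow, WittField.norm_p]
      exact (div_le_one (pow_pos hp' N)).2 h
    obtain ⟨v, hv⟩ := WittField.exists_lift p k h1
    refine ⟨v, IsFractionRing.injective (WittVector p k) (WittField p k) ?_⟩
    rw [map_mul, hv, map_pow, map_natCast]
    field_simp
  · rintro ⟨v, rfl⟩
    rw [map_mul, norm_mul, map_pow, map_natCast, norm_pow, WittField.norm_p]
    exact mul_le_of_le_one_right (pow_pos hp' N).le (WittField.norm_algebraMap_le_one p k v)

instance : CompleteSpace (WittField p k) := by
  have hp1 : ((p : ℝ)⁻¹) < 1 :=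
    inv_lt_one_of_one_lt₀ (by exact_mod_cast (Fact.out : p.Prime).one_lt)
  have hp' : (0 : ℝ) < (p : ℝ)⁻¹ := by
    rw [← WittField.norm_p p k]; exact norm_pos_iff.2 (WittField.p_ne_zero p k)
  refine Metric.complete_of_convergent_controlled_sequences (fun n => ((p : ℝ)⁻¹) ^ n)
    (fun n => pow_pos hp' n) ?_
  intro u hu
  have h0 : ∀ n, ∃ w : WittVector p k,
      algebraMap (WittVector p k) (WittField p k) w = u n - u 0 := by
    intro n
    refine WittField.exists_lift p k ?_
    have := hu 0 n 0 (Nat.zero_le _) le_rfl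
    rw [dist_eq_norm, pow_zero] at this
    exact this.le
  choose w hw using h0
  have hmod : ∀ {a b : WittVector p k} {N : ℕ},
      (a ≡ b [SMOD (Ideal.span {(p : WittVector p k)} ^ N • ⊤ :
        Submodule (WittVector p k) (WittVector p k))]) ↔
      ‖algebraMap (WittVector p k) (WittField p k) (a - b)‖ ≤ ((p : ℝ)⁻¹) ^ N := by
    intro a b N
    rw [WittField.norm_algebraMap_le_pow_iff, SModEq.sub_mem, smul_eq_mul, Ideal.mul_top]
  obtain ⟨L, hL⟩ := IsPrecomplete.prec
    (IsAdicComplete.toIsPrecomplete (I := Ideal.span {(p : WittVector p k)})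
      (M := WittVector p k)) (f := w) (by
      intro m n hmn
      rw [hmod, map_sub, hw, hw]
      have := hu m m n le_rfl hmn
      rw [dist_eq_norm] at this
      simpa using this.le)
  refine ⟨algebraMap (WittVector p k) (WittField p k) L + u 0, ?_⟩
  rw [tendsto_iff_norm_sub_tendsto_zero]
  refine squeeze_zero (fun _ => norm_nonneg _) (fun n => ?_)
    (tendsto_pow_atTop_nhds_zero_of_lt_one hp'.le hp1)
  have := hmod.1 (hL n)
  rw [map_sub, hw] at this
  rwa [sub_sub, add_comm (u 0)] at this

/-- The automorphism `σ` of `K` induced by the Frobenius `x ↦ x ^ p` of `k`. -/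
def WittField.frobenius : WittField p k →+* WittField p k :=
  WittVector.FractionRing.frobeniusRingHom p k

theorem WittField.frobenius_algebraMap (w : WittVector p k) :
    WittField.frobenius p k (algebraMap (WittVector p k) (WittField p k) w) =
      algebraMap (WittVector p k) (WittField p k) (WittVector.frobenius w) :=
  IsFractionRing.ringEquivOfRingEquiv_algebraMap (K := FractionRing (WittVector p k))
    (L := FractionRing (WittVector p k)) (WittVector.frobeniusEquiv p k) w

theorem WittField.norm_frobenius (x : WittField p k) : ‖WittField.frobenius p k x‖ = ‖x‖ := by
  have key : ∀ w : WittVector p k,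
      ‖WittField.frobenius p k (algebraMap (WittVector p k) (WittField p k) w)‖ =
        ‖algebraMap (WittVector p k) (WittField p k) w‖ := by
    intro w
    by_cases h0 : w = 0
    · simp [h0]
    obtain ⟨m, b, rfl⟩ := WittVector.exists_eq_pow_p_mul' w h0
    have hb : (WittVector.frobenius (b : WittVector p k)) =
        ((Units.map (WittVector.frobenius : WittVector p k →+* WittVector p k).toMonoidHom b :
          (WittVector p k)ˣ) : WittVector p k) := rfl
    rw [WittField.frobenius_algebraMap, map_mul, map_mul, map_mul, norm_mul, norm_mul, hb,
      WittField.norm_unit, WittField.norm_unit, map_pow, map_natCast]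
  obtain ⟨a, b, -, rfl⟩ := IsFractionRing.div_surjective (WittVector p k) x
  rw [map_div₀, norm_div, norm_div, key, key]

end WittField

section Series

set_option linter.unusedSectionVars false

/-- The families `(x_u)_{u ∈ G}` of elements of `K` tending to `0` along the cofinite filter,
i.e. such that for each `ε > 0` only finitely many `x_u` have absolute value `≥ ε`. -/
def nullFamilies (K : Type*) [NormedField K] (G : Type*) : AddSubgroup (G → K) where
  carrier := {x | Tendsto x cofinite (𝓝 0)}
  zero_mem' := tendsto_const_nhds
  add_mem' {x y} hx hy := by
    have h := Tendsto.add hx hy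
    rw [add_zero] at h
    exact h
  neg_mem' {x} hx := by
    have h := Tendsto.neg hx
    rw [neg_zero] at h
    exact h

/-- The ring of series `∑_{u ∈ G} x_u T^u` with `x_u ∈ K` and `x_u → 0`, with
`T^u T^v = T^(u + v)`. For `G = ℤ^d` this is `K⟨T_1^±, …, T_d^±⟩`. -/
def RestrictedSeries (K : Type*) [NormedField K] (G : Type*) : Type _ :=
  ↥(nullFamilies K G)

namespace RestrictedSeries

variable {K : Type*} [NormedField K] {G : Type*}

instance : AddCommGroup (RestrictedSeries K G) :=
  inferInstanceAs (AddCommGroup ↥(nullFamilies K G))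

/-- The coefficient of `T^u`. -/
def coeff (x : RestrictedSeries K G) (u : G) : K := x.1 u

theorem tendsto_coeff (x : RestrictedSeries K G) : Tendsto x.coeff cofinite (𝓝 0) := x.2

/-- The series with given coefficients. -/
def mk (x : G → K) (hx : Tendsto x cofinite (𝓝 0)) : RestrictedSeries K G := ⟨x, hx⟩

@[simp] theorem coeff_mk (x : G → K) (hx : Tendsto x cofinite (𝓝 0)) (u : G) :
    (mk x hx).coeff u = x u := rfl

@[ext] theorem ext {x y : RestrictedSeries K G} (h : ∀ u, x.coeff u = y.coeff u) : x = y :=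
  Subtype.ext (funext h)

@[simp] theorem coeff_zero (u : G) : (0 : RestrictedSeries K G).coeff u = 0 := rfl
@[simp] theorem coeff_add (x y : RestrictedSeries K G) (u : G) :
    (x + y).coeff u = x.coeff u + y.coeff u := rfl
@[simp] theorem coeff_neg (x : RestrictedSeries K G) (u : G) : (-x).coeff u = -x.coeff u := rfl

theorem finite_le_norm (x : RestrictedSeries K G) {ε : ℝ} (hε : 0 < ε) :
    {u | ε ≤ ‖x.coeff u‖}.Finite := by
  have h := (tendsto_zero_iff_norm_tendsto_zero.1 x.tendsto_coeff).eventually_lt_const hε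
  rw [Filter.eventually_cofinite] at h
  simpa using h

theorem tendsto_of_finite {x : G → K} (h : ∀ ε : ℝ, 0 < ε → {u | ε ≤ ‖x u‖}.Finite) :
    Tendsto x cofinite (𝓝 0) := by
  rw [NormedAddGroup.tendsto_nhds_zero]
  intro ε hε
  rw [Filter.eventually_cofinite]
  simpa using h ε hε

theorem exists_bound (x : RestrictedSeries K G) : ∃ C : ℝ, 0 < C ∧ ∀ u, ‖x.coeff u‖ ≤ C := by
  have hf := x.finite_le_norm one_pos
  obtain ⟨C, hC⟩ := (hf.image fun u => ‖x.coeff u‖).bddAbove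
  refine ⟨max C 1, by positivity, fun u => ?_⟩
  by_cases h : 1 ≤ ‖x.coeff u‖
  · exact (hC ⟨u, h, rfl⟩).trans (le_max_left _ _)
  · exact (not_le.1 h).le.trans (le_max_right _ _)

/-- The constant or monomial series `a T^v`. -/
def monomial (v : G) (a : K) : RestrictedSeries K G := by
  classical
  exact mk (fun u => if u = v then a else 0) (by
    refine tendsto_of_finite fun ε hε => (Set.finite_singleton v).subset fun u hu => ?_
    by_contra h
    have h' : u ≠ v := h
    simp [h'] at hu
    linarith)

open Classical in
theorem coeff_monomial (v u : G) (a : K) :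
    (monomial v a).coeff u = if u = v then a else 0 := rfl

variable [AddCommGroup G]

/-- The products of the coefficients of two series form a null family on `G × G`. -/
theorem tendsto_prod (x y : RestrictedSeries K G) :
    Tendsto (fun q : G × G => x.coeff q.1 * y.coeff q.2) cofinite (𝓝 0) := by
  refine tendsto_of_finite fun ε hε => ?_
  obtain ⟨C, hC, hx⟩ := x.exists_bound
  obtain ⟨D, hD, hy⟩ := y.exists_bound
  refine ((x.finite_le_norm (div_pos hε hD)).prod (y.finite_le_norm (div_pos hε hC))).subset ?_
  rintro ⟨u, v⟩ huv
  simp only [Set.mem_ofPred_eq, norm_mul] at huv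
  simp only [Set.mem_prod, Set.mem_ofPred_eq]
  constructor
  · rw [div_le_iff₀ hD]
    exact huv.trans (mul_le_mul_of_nonneg_left (hy v) (norm_nonneg _))
  · rw [div_le_iff₀ hC, mul_comm]
    exact huv.trans (mul_le_mul_of_nonneg_right (hx u) (norm_nonneg _))

theorem tendsto_conv (x y : RestrictedSeries K G) (u : G) :
    Tendsto (fun v => x.coeff v * y.coeff (u - v)) cofinite (𝓝 0) := by
  have hi : Function.Injective (fun v : G => (v, u - v)) := fun a b h => (Prod.ext_iff.1 h).1
  exact (tendsto_prod x y).comp hi.tendsto_cofinite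

/-- If the coefficients of the terms of a sum are small then so is its value. -/
theorem exists_le_norm_of_tsum [IsUltrametricDist K] {α : Type*} {f : α → K} {ε : ℝ} (hε : 0 < ε)
    (h : ε ≤ ‖∑' a, f a‖) (hf : Tendsto f cofinite (𝓝 0)) : ∃ a, ε ≤ ‖f a‖ := by
  by_contra hcon
  push Not at hcon
  have hfin : {a | ε / 2 ≤ ‖f a‖}.Finite := by
    have h := (tendsto_zero_iff_norm_tendsto_zero.1 hf).eventually_lt_const (half_pos hε)
    rw [Filter.eventually_cofinite] at h
    simpa using h
  have : ∃ δ, δ < ε ∧ 0 ≤ δ ∧ ∀ a, ‖f a‖ ≤ δ := by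
    rcases hfin.toFinset.eq_empty_or_nonempty with h0 | h0
    · refine ⟨ε / 2, half_lt_self hε, (half_pos hε).le, fun a => ?_⟩
      by_contra hlt
      have : a ∈ hfin.toFinset := by simpa using (not_le.1 hlt).le
      simp [h0] at this
    · obtain ⟨b, hb, hmax⟩ := hfin.toFinset.exists_max_image (fun a => ‖f a‖) h0
      refine ⟨max (‖f b‖) (ε / 2), max_lt (hcon b) (half_lt_self hε),
        le_max_of_le_left (norm_nonneg _), fun a => ?_⟩
      by_cases ha : ε / 2 ≤ ‖f a‖
      · exact (hmax a (by simpa using ha)).trans (le_max_left _ _)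
      · exact (not_le.1 ha).le.trans (le_max_right _ _)
  obtain ⟨δ, hδ, h0, hle⟩ := this
  exact absurd (h.trans (IsUltrametricDist.norm_tsum_le_of_forall_le_of_nonneg h0 hle))
    (not_le.2 hδ)

variable [IsUltrametricDist K]

/-- Multiplication of series: the coefficient of `T^u` in `x y` is `∑_v x_v y_{u - v}`. -/
instance : Mul (RestrictedSeries K G) where
  mul x y := mk (fun u => ∑' v, x.coeff v * y.coeff (u - v)) (by
    refine tendsto_of_finite fun ε hε => ?_
    have hfin : {q : G × G | ε ≤ ‖x.coeff q.1 * y.coeff q.2‖}.Finite := by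
      have h := (tendsto_zero_iff_norm_tendsto_zero.1 (tendsto_prod x y)).eventually_lt_const hε
      rw [Filter.eventually_cofinite] at h
      simpa using h
    refine (hfin.image fun q => q.1 + q.2).subset fun u hu => ?_
    obtain ⟨v, hv⟩ := exists_le_norm_of_tsum hε hu (tendsto_conv x y u)
    exact ⟨(v, u - v), hv, by simp⟩)

theorem coeff_mul (x y : RestrictedSeries K G) (u : G) :
    (x * y).coeff u = ∑' v, x.coeff v * y.coeff (u - v) := rfl

instance : One (RestrictedSeries K G) := ⟨monomial 0 1⟩

theorem coeff_one [DecidableEq G] (u : G) :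
    (1 : RestrictedSeries K G).coeff u = if u = 0 then 1 else 0 := by
  rw [show (1 : RestrictedSeries K G) = monomial 0 1 from rfl, coeff_monomial]
  congr

theorem coeff_monomial_mul (v : G) (a : K) (x : RestrictedSeries K G) (u : G) :
    (monomial v a * x).coeff u = a * x.coeff (u - v) := by
  classical
  rw [coeff_mul, tsum_eq_single v]
  · simp [coeff_monomial]
  · intro b hb
    simp [coeff_monomial, hb]

variable [CompleteSpace K]

theorem summable_of_tendsto {α : Type*} {f : α → K} (hf : Tendsto f cofinite (𝓝 0)) :
    Summable f :=
  NonarchimedeanAddGroup.summable_of_tendsto_cofinite_zero hf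

theorem mul_comm' (x y : RestrictedSeries K G) : x * y = y * x := by
  ext u
  rw [coeff_mul, coeff_mul, ← (Equiv.subLeft u).tsum_eq]
  simp [mul_comm]

theorem mul_assoc' (x y z : RestrictedSeries K G) : x * y * z = x * (y * z) := by
  ext u
  have hs : Summable (Function.uncurry fun v w : G =>
      x.coeff w * y.coeff (v - w) * z.coeff (u - v)) := by
    refine summable_of_tendsto ?_
    obtain ⟨C, hC, hz⟩ := z.exists_bound
    have hi : Function.Injective (fun q : G × G => (q.2, q.1 - q.2)) := by
      rintro ⟨a, b⟩ ⟨c, d⟩ h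
      simp only [Prod.mk.injEq] at h
      obtain ⟨rfl, h⟩ := h
      simpa using h
    have h := ((tendsto_zero_iff_norm_tendsto_zero.1
      ((tendsto_prod x y).comp hi.tendsto_cofinite)).mul_const C)
    rw [zero_mul] at h
    refine squeeze_zero_norm (fun q => ?_) h
    simp only [Function.uncurry, norm_mul, Function.comp]
    exact mul_le_mul_of_nonneg_left (hz _) (by positivity)
  calc (x * y * z).coeff u
      = ∑' v, ∑' w, x.coeff w * y.coeff (v - w) * z.coeff (u - v) := by
        rw [coeff_mul]
        refine tsum_congr fun v => ?_
        rw [coeff_mul, tsum_mul_right]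
    _ = ∑' w, ∑' v, x.coeff w * y.coeff (v - w) * z.coeff (u - v) := hs.tsum_comm.symm
    _ = (x * (y * z)).coeff u := by
        rw [coeff_mul]
        refine tsum_congr fun w => ?_
        rw [coeff_mul, ← tsum_mul_left, ← (Equiv.addRight w).tsum_eq]
        refine tsum_congr fun v => ?_
        simp [mul_assoc, sub_sub, add_comm]

theorem add_mul' (x y z : RestrictedSeries K G) : (x + y) * z = x * z + y * z := by
  ext u
  simp only [coeff_add, coeff_mul, add_mul]
  exact (summable_of_tendsto (tendsto_conv x z u)).tsum_add
    (summable_of_tendsto (tendsto_conv y z u))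

theorem one_mul' (x : RestrictedSeries K G) : 1 * x = x := by
  ext u
  rw [show (1 : RestrictedSeries K G) = monomial 0 1 from rfl, coeff_monomial_mul]
  simp

instance : CommRing (RestrictedSeries K G) where
  __ := (inferInstance : AddCommGroup (RestrictedSeries K G))
  mul := (· * ·)
  one := 1
  mul_assoc := mul_assoc'
  mul_comm := mul_comm'
  one_mul := one_mul'
  mul_one x := by rw [mul_comm', one_mul']
  left_distrib x y z := by rw [mul_comm', add_mul', mul_comm' y, mul_comm' z]
  right_distrib := add_mul'
  zero_mul x := by ext u; simp [coeff_mul]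
  mul_zero x := by ext u; simp [coeff_mul]

section Frobenius

variable (s : K →+* K) (hs : ∀ a, ‖s a‖ = ‖a‖)
variable (φ : G →+ G) (hφ : Function.Injective φ)

/-- For an isometric endomorphism `s` of `K` and an injective endomorphism `φ` of `G`, the ring
endomorphism `∑ x_u T^u ↦ ∑ s(x_u) T^(φ u)`. -/
def mapExp (s : K →+* K) (hs : ∀ a, ‖s a‖ = ‖a‖) (φ : G →+ G) (hφ : Function.Injective φ) :
    RestrictedSeries K G →+* RestrictedSeries K G where
  toFun x := mk (Function.extend φ (fun u => s (x.coeff u)) 0) (by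
    refine tendsto_of_finite fun ε hε => ((x.finite_le_norm hε).image φ).subset fun u hu => ?_
    by_cases h : ∃ v, φ v = u
    · obtain ⟨v, rfl⟩ := h
      simp only [Set.mem_ofPred_eq, hφ.extend_apply, hs] at hu
      exact ⟨v, hu, rfl⟩
    · simp only [Set.mem_ofPred_eq, Function.extend_apply' _ _ _ h, Pi.zero_apply,
        norm_zero] at hu
      exact absurd hu (not_le.2 hε))
  map_zero' := by
    ext u
    by_cases h : ∃ v, φ v = u
    · obtain ⟨v, rfl⟩ := h
      simp [hφ.extend_apply]
    · simp [Function.extend_apply' _ _ _ h]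
  map_add' x y := by
    ext u
    by_cases h : ∃ v, φ v = u
    · obtain ⟨v, rfl⟩ := h
      simp [hφ.extend_apply]
    · simp [Function.extend_apply' _ _ _ h]
  map_one' := by
    classical
    ext u
    by_cases h : ∃ v, φ v = u
    · obtain ⟨v, rfl⟩ := h
      rw [coeff_mk, hφ.extend_apply]
      by_cases hv : v = 0
      · simp [coeff_one, hv]
      · have : φ v ≠ 0 := fun h0 => hv (hφ (h0.trans (map_zero φ).symm))
        simp [coeff_one, hv, this]
    · have : u ≠ 0 := fun h0 => h ⟨0, by simp [h0]⟩
      simp [Function.extend_apply' _ _ _ h, coeff_one, this]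
  map_mul' x y := by
    have hcont : Continuous s :=
      (AddMonoidHomClass.isometry_of_norm s hs).continuous
    ext u
    rw [coeff_mk, coeff_mul]
    have hsupp : Function.support (fun w => Function.extend φ (fun u => s (x.coeff u)) 0 w *
        Function.extend φ (fun u => s (y.coeff u)) 0 (u - w)) ⊆ Set.range φ := by
      intro w hw
      by_contra h
      apply hw
      simp only [Function.extend_apply' _ _ _ h, Pi.zero_apply, zero_mul]
    simp only [coeff_mk]
    rw [← hφ.tsum_eq hsupp]
    by_cases h : ∃ v, φ v = u
    · obtain ⟨v, rfl⟩ := h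
      rw [hφ.extend_apply, coeff_mul,
        (summable_of_tendsto (tendsto_conv x y v)).map_tsum s hcont]
      refine tsum_congr fun w => ?_
      rw [hφ.extend_apply, ← map_sub, hφ.extend_apply, map_mul]
    · rw [Function.extend_apply' _ _ _ h, Pi.zero_apply]
      symm
      convert tsum_zero with w
      have : ¬ ∃ v, φ v = u - φ w := by
        rintro ⟨v, hv⟩
        exact h ⟨v + w, by rw [map_add, hv]; simp⟩
      rw [Function.extend_apply' _ _ _ this, Pi.zero_apply, mul_zero]

theorem coeff_mapExp_apply (x : RestrictedSeries K G) (u : G) :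
    (mapExp s hs φ hφ x).coeff (φ u) = s (x.coeff u) := by
  change Function.extend φ (fun u => s (x.coeff u)) 0 (φ u) = _
  rw [hφ.extend_apply]

theorem coeff_mapExp_of_notMem (x : RestrictedSeries K G) (u : G)
    (hu : ∀ v, φ v ≠ u) :
    (mapExp s hs φ hφ x).coeff u = 0 := by
  change Function.extend φ (fun u => s (x.coeff u)) 0 u = _
  rw [Function.extend_apply' _ _ _ (by rintro ⟨v, hv⟩; exact hu v hv), Pi.zero_apply]

end Frobenius

section Derivation

variable {d : ℕ}

/-- The additive map underlying `∂/∂T_i`. -/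
def pderivHom (i : Fin d) :
    RestrictedSeries K (Fin d → ℤ) →+ RestrictedSeries K (Fin d → ℤ) where
  toFun x := mk (fun u => ((u i + 1 : ℤ) : K) * x.coeff (u + Pi.single i 1)) (by
    have h := tendsto_zero_iff_norm_tendsto_zero.1
      (x.tendsto_coeff.comp (add_left_injective (Pi.single i (1 : ℤ))).tendsto_cofinite)
    refine squeeze_zero_norm (fun u => ?_) h
    rw [norm_mul]
    exact mul_le_of_le_one_left (norm_nonneg _) (IsUltrametricDist.norm_intCast_le_one K _))
  map_zero' := by ext u; simp
  map_add' x y := by ext u; simp [mul_add]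

/-- The partial derivative `∂/∂T_i` on `K⟨T_1^±, …, T_d^±⟩`: the coefficient of `T^u` in
`∂x/∂T_i` is `(u_i + 1) x_{u + e_i}`. -/
def pderiv (i : Fin d) :
    Derivation ℤ (RestrictedSeries K (Fin d → ℤ)) (RestrictedSeries K (Fin d → ℤ)) :=
  Derivation.mk' (pderivHom i).toIntLinearMap (by
    intro x y
    ext u
    change ((u i + 1 : ℤ) : K) * (x * y).coeff (u + Pi.single i 1) =
      (x * pderivHom i y).coeff u + (y * pderivHom i x).coeff u
    have h1 := summable_of_tendsto (tendsto_conv x (pderivHom i y) u)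
    have h2 := summable_of_tendsto (tendsto_conv (pderivHom i x) y u)
    have h2' := ((Equiv.subRight (Pi.single i (1 : ℤ))).summable_iff).2 h2
    rw [mul_comm y, coeff_mul, coeff_mul, coeff_mul, ← tsum_mul_left,
      ← (Equiv.subRight (Pi.single i (1 : ℤ))).tsum_eq
        (fun v => (pderivHom i x).coeff v * y.coeff (u - v))]
    refine Eq.trans (tsum_congr fun v => ?_) (h1.tsum_add h2')
    have e1 : (pderivHom i y).coeff (u - v) =
        (((u - v) i + 1 : ℤ) : K) * y.coeff (u - v + Pi.single i 1) := rfl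
    have e2 : (pderivHom i x).coeff (v - Pi.single i 1) =
        (((v - Pi.single i 1 : Fin d → ℤ) i + 1 : ℤ) : K) *
          x.coeff (v - Pi.single i 1 + Pi.single i 1) := rfl
    have e3 : u - v + Pi.single i 1 = u + Pi.single i 1 - v := by abel
    have e4 : u - (v - Pi.single i 1) = u + Pi.single i 1 - v := by abel
    simp only [Equiv.subRight_apply, e1, e2, e3, e4, sub_add_cancel]
    push_cast [Pi.sub_apply, Pi.single_eq_same]
    ring)

theorem coeff_pderiv (i : Fin d) (x : RestrictedSeries K (Fin d → ℤ)) (u : Fin d → ℤ) :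
    (pderiv i x).coeff u = ((u i + 1 : ℤ) : K) * x.coeff (u + Pi.single i 1) := rfl

end Derivation

end RestrictedSeries

end Series

section Rings

variable (p : ℕ) [Fact p.Prime] (k : Type*) [Field k] [CharP k p] [PerfectRing k p]

/-- The ring `K⟨T_1^±, …, T_d^±⟩` over `K = W(k)[1/p]`. All the rings of functions used below are
subrings of it. -/
abbrev LaurentRing (p : ℕ) [Fact p.Prime] (k : Type*) [Field k] [CharP k p] [PerfectRing k p]
    (d : ℕ) : Type _ :=
  RestrictedSeries (WittField p k) (Fin d → ℤ)

theorem nsmul_injective_of_prime (p : ℕ) [Fact p.Prime] (d : ℕ) :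
    Function.Injective (nsmulAddMonoidHom (α := Fin d → ℤ) p) := by
  intro u v h
  have hp : p ≠ 0 := (Fact.out : p.Prime).ne_zero
  funext i
  have := congrFun h i
  simpa [hp] using this

/-- The lift of Frobenius on `K⟨T_1^±, …, T_d^±⟩` that is `σ` on `K` and sends each `T_i` to
`T_i ^ p`. -/
def LaurentRing.sigma (d : ℕ) : LaurentRing p k d →+* LaurentRing p k d :=
  RestrictedSeries.mapExp (WittField.frobenius p k) (WittField.norm_frobenius p k)
    (nsmulAddMonoidHom p) (nsmul_injective_of_prime p d)

/-- The variable `T_i`. -/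
def LaurentRing.T {d : ℕ} (i : Fin d) : LaurentRing p k d :=
  RestrictedSeries.monomial (Pi.single i 1) 1

/-- A subring of `K⟨T_1^±, …, T_d^±⟩` that contains the variables and is stable under `σ` and under
the partial derivatives. -/
structure FrobDiffSubring (p : ℕ) [Fact p.Prime] (k : Type*) [Field k] [CharP k p]
    [PerfectRing k p] (d : ℕ) extends Subring (LaurentRing p k d) where
  T_mem : ∀ i : Fin d, LaurentRing.T p k i ∈ carrier
  sigma_mem : ∀ x ∈ carrier, LaurentRing.sigma p k d x ∈ carrier
  pderiv_mem : ∀ (i : Fin d), ∀ x ∈ carrier, RestrictedSeries.pderiv i x ∈ carrier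

variable {p k}

/-- The ring underlying a `FrobDiffSubring`. -/
abbrev FrobDiffSubring.ring {d : ℕ} (S : FrobDiffSubring p k d) : Type _ := ↥S.toSubring

/-- The endomorphism `σ` of the ring `S`. -/
def FrobDiffSubring.sigma {d : ℕ} (S : FrobDiffSubring p k d) : S.ring →+* S.ring :=
  (LaurentRing.sigma p k d).restrict S.toSubring S.toSubring S.sigma_mem

/-- The derivation `∂/∂T_i` of the ring `S`. -/
def FrobDiffSubring.pderiv {d : ℕ} (S : FrobDiffSubring p k d) (i : Fin d) :
    Derivation ℤ S.ring S.ring :=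
  Derivation.mk'
    (AddMonoidHom.toIntLinearMap
      { toFun := fun x => ⟨RestrictedSeries.pderiv i x.1, S.pderiv_mem i x.1 x.2⟩
        map_zero' := Subtype.ext (map_zero _)
        map_add' := fun x y => Subtype.ext (map_add (RestrictedSeries.pderiv i) x.1 y.1) })
    (fun x y => Subtype.ext ((RestrictedSeries.pderiv i).leibniz x.1 y.1))

/-- The variable `T_i` as an element of `S`. -/
def FrobDiffSubring.T {d : ℕ} (S : FrobDiffSubring p k d) (i : Fin d) : S.ring :=
  ⟨LaurentRing.T p k i, S.T_mem i⟩

theorem LaurentRing.coeff_T {d : ℕ} (i : Fin d) {u : Fin d → ℤ}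
    (h : (LaurentRing.T p k i).coeff u ≠ 0) : ∀ l, 0 ≤ u l := by
  classical
  rw [LaurentRing.T, RestrictedSeries.coeff_monomial] at h
  have hu : u = Pi.single i 1 := by
    by_contra hne
    exact h (if_neg hne)
  intro l
  rw [hu, Pi.single_apply]
  split_ifs <;> simp

theorem LaurentRing.exists_of_coeff_sigma {d : ℕ} {x : LaurentRing p k d} {u : Fin d → ℤ}
    (h : (LaurentRing.sigma p k d x).coeff u ≠ 0) :
    ∃ v : Fin d → ℤ, (∀ l, u l = p * v l) ∧
      ‖(LaurentRing.sigma p k d x).coeff u‖ = ‖x.coeff v‖ := by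
  by_cases hu : ∃ v, nsmulAddMonoidHom (α := Fin d → ℤ) p v = u
  · obtain ⟨v, rfl⟩ := hu
    refine ⟨v, fun l => by simp, ?_⟩
    rw [LaurentRing.sigma, RestrictedSeries.coeff_mapExp_apply, WittField.norm_frobenius]
  · refine absurd ?_ h
    exact RestrictedSeries.coeff_mapExp_of_notMem _ _ _ _ _ _ (fun v hv => hu ⟨v, hv⟩)

theorem LaurentRing.norm_coeff_pderiv_le {d : ℕ} (i : Fin d) (x : LaurentRing p k d)
    (u : Fin d → ℤ) :
    ‖(RestrictedSeries.pderiv i x).coeff u‖ ≤ ‖x.coeff (u + Pi.single i 1)‖ := by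
  rw [RestrictedSeries.coeff_pderiv, norm_mul]
  exact mul_le_of_le_one_left (norm_nonneg _) (IsUltrametricDist.norm_intCast_le_one _ _)

theorem LaurentRing.ne_of_coeff_pderiv {d : ℕ} {i : Fin d} {x : LaurentRing p k d}
    {u : Fin d → ℤ} (h : (RestrictedSeries.pderiv i x).coeff u ≠ 0) :
    (u + Pi.single i 1 : Fin d → ℤ) i ≠ 0 ∧ x.coeff (u + Pi.single i 1) ≠ 0 := by
  rw [RestrictedSeries.coeff_pderiv] at h
  refine ⟨fun h0 => h ?_, right_ne_zero_of_mul h⟩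
  have h1 : u i + 1 = 0 := by simpa using h0
  rw [h1]
  simp

variable (p k)

/-- The series in which every variable `T_i` with `i ∈ I` occurs with exponents `≥ 0` only. -/
def nonnegOn {d : ℕ} (I : Set (Fin d)) : FrobDiffSubring p k d where
  carrier := {x | ∀ u, x.coeff u ≠ 0 → ∀ i ∈ I, 0 ≤ u i}
  zero_mem' := fun u hu => absurd rfl hu
  one_mem' := by
    classical
    intro u hu i _
    rw [RestrictedSeries.coeff_one] at hu
    have : u = 0 := by
      by_contra hne
      exact hu (if_neg hne)
    simp [this]
  add_mem' {x y} hx hy u hu i hi := by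
    by_cases h : x.coeff u = 0
    · refine hy u (fun h' => hu ?_) i hi
      rw [RestrictedSeries.coeff_add, h, h', add_zero]
    · exact hx u h i hi
  neg_mem' {x} hx u hu i hi := by
    refine hx u (fun h => hu ?_) i hi
    rw [RestrictedSeries.coeff_neg, h, neg_zero]
  mul_mem' {x y} hx hy u hu i hi := by
    rw [RestrictedSeries.coeff_mul] at hu
    have : ∃ v, x.coeff v * y.coeff (u - v) ≠ 0 := by
      by_contra hcon
      push Not at hcon
      exact hu (by simp [hcon])
    obtain ⟨v, hv⟩ := this
    have h1 := hx v (left_ne_zero_of_mul hv) i hi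
    have h2 := hy (u - v) (right_ne_zero_of_mul hv) i hi
    rw [Pi.sub_apply] at h2
    linarith
  T_mem i u hu l _ := LaurentRing.coeff_T i hu l
  sigma_mem x hx u hu i hi := by
    obtain ⟨v, hv, hn⟩ := LaurentRing.exists_of_coeff_sigma hu
    have h0 : x.coeff v ≠ 0 := by
      rw [← norm_ne_zero_iff, ← hn]
      exact norm_ne_zero_iff.2 hu
    rw [hv i]
    exact mul_nonneg (by positivity) (hx v h0 i hi)
  pderiv_mem l x hx u hu i hi := by
    obtain ⟨h1, h2⟩ := LaurentRing.ne_of_coeff_pderiv hu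
    have h3 := hx _ h2 i hi
    by_cases hil : i = l
    · subst hil
      have : (u + Pi.single i 1 : Fin d → ℤ) i = u i + 1 := by simp
      omega
    · simpa [hil] using h3

/-- The Tate algebra `K⟨T_1, …, T_d⟩`. -/
def tateAlgebra (d : ℕ) : FrobDiffSubring p k d := nonnegOn p k Set.univ

/-- The ring `𝒜 = K⟨T_1^±, …, T_n^±, T_{n+1}, …, T_{n+m}⟩`. The first `n` variables have the
indices `i < n`. -/
def annulusRing (n m : ℕ) : FrobDiffSubring p k (n + m) :=
  nonnegOn p k {i | n ≤ (i : ℕ)}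

variable {p k}

/-- The partial valuation `w^{(i)}_j(x) = min {e : v(a_e) ≤ j}`, where `x = ∑_e a_e T_i^e` is the
`T_i`-adic expansion, `v` is the valuation of the Gauss norm, and the minimum of the empty set is
`+∞`. Since `v(a_e)` is the minimum of the valuations of the coefficients `x_u` with `u_i = e`, it
is the infimum of `u_i` over all `u` with `v(x_u) ≤ j`, i.e. with `|x_u| ≥ p^{-j}`. -/
def partialValuation {d : ℕ} (i : Fin d) (j : ℕ) (x : LaurentRing p k d) : EReal :=
  ⨅ u ∈ {u : Fin d → ℤ | ((p : ℝ)⁻¹) ^ j ≤ ‖x.coeff u‖}, (((u i : ℤ) : ℝ) : EReal)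

theorem le_partialValuation_iff {d : ℕ} {i : Fin d} {j : ℕ} {x : LaurentRing p k d} {b : ℝ} :
    (b : EReal) ≤ partialValuation i j x ↔
      ∀ u : Fin d → ℤ, ((p : ℝ)⁻¹) ^ j ≤ ‖x.coeff u‖ → b ≤ ((u i : ℤ) : ℝ) := by
  simp [partialValuation]

/-- The condition defining `r`-log-decay: there is `c > 0` such that for `i = 1, …, n` and all
sufficiently large `j` one has `w^{(i)}_j(x) ≥ -c p^{rj}`. -/
def HasLogDecay (n m : ℕ) (r : ℝ) (x : LaurentRing p k (n + m)) : Prop :=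
  ∃ c : ℝ, 0 < c ∧ ∀ i : Fin (n + m), (i : ℕ) < n → ∀ᶠ j : ℕ in atTop,
    ((-(c * (p : ℝ) ^ (r * (j : ℝ))) : ℝ) : EReal) ≤ partialValuation i j x

theorem p_inv_pow_pos (p : ℕ) [Fact p.Prime] (j : ℕ) : 0 < ((p : ℝ)⁻¹) ^ j :=
  pow_pos (inv_pos.2 (by exact_mod_cast (Fact.out : p.Prime).pos)) j

theorem p_rpow_pos (p : ℕ) [Fact p.Prime] (a : ℝ) : 0 < (p : ℝ) ^ a :=
  Real.rpow_pos_of_pos (by exact_mod_cast (Fact.out : p.Prime).pos) a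

theorem hasLogDecay_of_nonneg {n m : ℕ} {r : ℝ} {x : LaurentRing p k (n + m)}
    (hx : ∀ u, x.coeff u ≠ 0 → ∀ i, 0 ≤ u i) : HasLogDecay n m r x := by
  refine ⟨1, one_pos, fun i _ => Eventually.of_forall fun j => le_partialValuation_iff.2 ?_⟩
  intro u hu
  have h1 : 0 ≤ u i := hx u (norm_pos_iff.1 ((p_inv_pow_pos p j).trans_le hu)) i
  have h2 : (0 : ℝ) ≤ ((u i : ℤ) : ℝ) := by exact_mod_cast h1
  have := p_rpow_pos p (r * j)
  linarith

theorem HasLogDecay.add {n m : ℕ} {r : ℝ} {x y : LaurentRing p k (n + m)}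
    (hx : HasLogDecay n m r x) (hy : HasLogDecay n m r y) : HasLogDecay n m r (x + y) := by
  obtain ⟨c, hc, hx⟩ := hx
  obtain ⟨c', hc', hy⟩ := hy
  refine ⟨c + c', by positivity, fun i hi => ?_⟩
  filter_upwards [hx i hi, hy i hi] with j h1 h2
  rw [le_partialValuation_iff] at h1 h2 ⊢
  intro u hu
  have hpos := p_rpow_pos p (r * j)
  rw [RestrictedSeries.coeff_add] at hu
  rcases le_max_iff.1 (hu.trans (IsUltrametricDist.norm_add_le_max _ _)) with h | h
  · have := h1 u h
    nlinarith
  · have := h2 u h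
    nlinarith

theorem HasLogDecay.neg {n m : ℕ} {r : ℝ} {x : LaurentRing p k (n + m)}
    (hx : HasLogDecay n m r x) : HasLogDecay n m r (-x) := by
  obtain ⟨c, hc, hx⟩ := hx
  refine ⟨c, hc, fun i hi => ?_⟩
  filter_upwards [hx i hi] with j h1
  rw [le_partialValuation_iff] at h1 ⊢
  intro u hu
  exact h1 u (by simpa using hu)

theorem exists_bound_pow {d : ℕ} (x : LaurentRing p k d) :
    ∃ N : ℕ, ∀ u, ‖x.coeff u‖ ≤ (p : ℝ) ^ N := by
  obtain ⟨C, -, hC⟩ := x.exists_bound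
  obtain ⟨N, hN⟩ := pow_unbounded_of_one_lt C
    (by exact_mod_cast (Fact.out : p.Prime).one_lt : (1 : ℝ) < p)
  exact ⟨N, fun u => (hC u).trans hN.le⟩

theorem HasLogDecay.mul {n m : ℕ} {r : ℝ} {x y : LaurentRing p k (n + m)}
    (hx : HasLogDecay n m r x) (hy : HasLogDecay n m r y) : HasLogDecay n m r (x * y) := by
  obtain ⟨c, hc, hx⟩ := hx
  obtain ⟨c', hc', hy⟩ := hy
  obtain ⟨N, hN⟩ := exists_bound_pow x
  obtain ⟨N', hN'⟩ := exists_bound_pow y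
  have hp0 : (0 : ℝ) < p := by exact_mod_cast (Fact.out : p.Prime).pos
  have e1 := p_rpow_pos p (r * N')
  have e2 := p_rpow_pos p (r * N)
  refine ⟨c * (p : ℝ) ^ (r * (N' : ℝ)) + c' * (p : ℝ) ^ (r * (N : ℝ)), by positivity,
    fun i hi => ?_⟩
  filter_upwards [(tendsto_add_atTop_nat N').eventually (hx i hi),
    (tendsto_add_atTop_nat N).eventually (hy i hi)] with j h1 h2
  rw [le_partialValuation_iff] at h1 h2 ⊢
  intro u hu
  obtain ⟨v, hv⟩ := RestrictedSeries.exists_le_norm_of_tsum (p_inv_pow_pos p j) hu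
    (RestrictedSeries.tendsto_conv x y u)
  rw [norm_mul] at hv
  have key : ∀ (a b : ℝ) (M : ℕ), 0 ≤ a → b ≤ (p : ℝ) ^ M → ((p : ℝ)⁻¹) ^ j ≤ a * b →
      ((p : ℝ)⁻¹) ^ (j + M) ≤ a := by
    intro a b M ha hb hab
    have h := hab.trans (mul_le_mul_of_nonneg_left hb ha)
    rw [pow_add, inv_pow _ M, ← div_eq_mul_inv]
    exact (div_le_iff₀ (pow_pos hp0 M)).2 h
  have h3 := h1 v (key _ _ N' (norm_nonneg _) (hN' _) hv)
  have h4 := h2 (u - v) (key _ _ N (norm_nonneg _) (hN _) (by rwa [mul_comm] at hv))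
  rw [Pi.sub_apply] at h4
  push_cast at h3 h4
  rw [mul_add, Real.rpow_add hp0] at h3 h4
  linarith

theorem HasLogDecay.sigma {n m : ℕ} {r : ℝ} {x : LaurentRing p k (n + m)}
    (hx : HasLogDecay n m r x) : HasLogDecay n m r (LaurentRing.sigma p k (n + m) x) := by
  obtain ⟨c, hc, hx⟩ := hx
  have hp0 : (0 : ℝ) < p := by exact_mod_cast (Fact.out : p.Prime).pos
  refine ⟨p * c, by positivity, fun i hi => ?_⟩
  filter_upwards [hx i hi] with j h1
  rw [le_partialValuation_iff] at h1 ⊢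
  intro u hu
  obtain ⟨v, hv, hn⟩ := LaurentRing.exists_of_coeff_sigma
    (norm_pos_iff.1 ((p_inv_pow_pos p j).trans_le hu))
  have h2 := mul_le_mul_of_nonneg_left (h1 v (hn ▸ hu)) hp0.le
  rw [hv i]
  push_cast
  linarith

theorem HasLogDecay.pderiv {n m : ℕ} {r : ℝ} {x : LaurentRing p k (n + m)}
    (hx : HasLogDecay n m r x) (l : Fin (n + m)) :
    HasLogDecay n m r (RestrictedSeries.pderiv l x) := by
  obtain ⟨c, hc, hx⟩ := hx
  refine ⟨2 * c, by positivity, fun i hi => ?_⟩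
  filter_upwards [hx i hi] with j h1
  rw [le_partialValuation_iff] at h1 ⊢
  intro u hu
  obtain ⟨h2, -⟩ := LaurentRing.ne_of_coeff_pderiv
    (norm_pos_iff.1 ((p_inv_pow_pos p j).trans_le hu))
  have h3 := h1 _ (hu.trans (LaurentRing.norm_coeff_pderiv_le l x u))
  have hpos := mul_pos hc (p_rpow_pos p (r * j))
  by_cases hil : i = l
  · subst hil
    have h4 : (u + Pi.single i 1 : Fin (n + m) → ℤ) i = u i + 1 := by simp
    rw [h4] at h2 h3
    push_cast at h3
    rcases lt_or_gt_of_ne h2 with h | h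
    · have h5 : ((u i : ℤ) : ℝ) + 1 ≤ -1 := by exact_mod_cast (by omega : u i + 1 ≤ -1)
      linarith
    · have h5 : (0 : ℝ) ≤ ((u i : ℤ) : ℝ) := by exact_mod_cast (by omega : 0 ≤ u i)
      linarith
  · have h4 : (u + Pi.single l 1 : Fin (n + m) → ℤ) i = u i := by simp [hil]
    rw [h4] at h3
    linarith

variable (p k)

/-- The ring `𝒜^r ⊆ 𝒜` of functions with `r`-log-decay. -/
def logDecayRing (n m : ℕ) (r : ℝ) : FrobDiffSubring p k (n + m) where
  carrier := {x | x ∈ (annulusRing p k n m).toSubring ∧ HasLogDecay n m r x}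
  zero_mem' := ⟨zero_mem _, hasLogDecay_of_nonneg fun _ hu => absurd rfl hu⟩
  one_mem' := ⟨one_mem _, hasLogDecay_of_nonneg fun u hu i =>
    (one_mem (tateAlgebra p k (n + m)).toSubring :
      (1 : LaurentRing p k (n + m)) ∈ (tateAlgebra p k (n + m)).toSubring) u hu i trivial⟩
  add_mem' hx hy := ⟨add_mem hx.1 hy.1, hx.2.add hy.2⟩
  neg_mem' hx := ⟨neg_mem hx.1, hx.2.neg⟩
  mul_mem' hx hy := ⟨mul_mem hx.1 hy.1, hx.2.mul hy.2⟩
  T_mem i := ⟨(annulusRing p k n m).T_mem i,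
    hasLogDecay_of_nonneg fun _ hu => LaurentRing.coeff_T i hu⟩
  sigma_mem x hx := ⟨(annulusRing p k n m).sigma_mem x hx.1, hx.2.sigma⟩
  pderiv_mem l x hx := ⟨(annulusRing p k n m).pderiv_mem l x hx.1, hx.2.pderiv l⟩

theorem tateAlgebra_le_logDecayRing (n m : ℕ) (r : ℝ) :
    (tateAlgebra p k (n + m)).toSubring ≤ (logDecayRing p k n m r).toSubring := fun _ hx =>
  ⟨fun u hu i _ => hx u hu i trivial, hasLogDecay_of_nonneg fun u hu i => hx u hu i trivial⟩

end Rings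

section Modules

/-- For a ring homomorphism `σ : R → S`, an `R`-module `M` and an `S`-module `N`, a `σ`-semilinear
map `φ : M → N` has a linearization `S ⊗_{σ, R} M → N`, `s ⊗ m ↦ s φ(m)`. This is the assertion
that the linearization is an isomorphism. -/
def IsLinearizationIso {R S : Type*} [CommRing R] [CommRing S] {σ : R →+* S} {M N : Type*}
    [AddCommGroup M] [Module R M] [AddCommGroup N] [Module S N] (φ : M →ₛₗ[σ] N) : Prop :=
  letI : Algebra R S := σ.toAlgebra
  letI : Module R N := Module.compHom N σ
  haveI : IsScalarTower R S N := ⟨fun a b c => mul_smul (σ a) b c⟩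
  IsBaseChange S
    ({ toFun := φ, map_add' := map_add φ, map_smul' := fun a m => φ.map_smulₛₗ a m } : M →ₗ[R] N)

variable {p : ℕ} [Fact p.Prime] {k : Type u} [Field k] [CharP k p] [PerfectRing k p] {d : ℕ}

section TensorConn

variable {R : Type*} [CommRing R] {M N : Type*} [AddCommGroup M] [Module R M] [AddCommGroup N]
  [Module R N] (D : Derivation ℤ R R)
  (a : M →+ M) (ha : ∀ (c : R) (x : M), a (c • x) = D c • x + c • a x)
  (b : N →+ N) (hb : ∀ (c : R) (y : N), b (c • y) = D c • y + c • b y)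

/-- For additive maps `a` on `M` and `b` on `N` that satisfy the Leibniz rule for the derivation
`D`, the map `x ⊗ y ↦ a(x) ⊗ y + x ⊗ b(y)` on `M ⊗ N`. -/
def tensorConn : M ⊗[R] N →+ M ⊗[R] N :=
  TensorProduct.liftAddHom
    (AddMonoidHom.mk' (fun x => AddMonoidHom.mk' (fun y => a x ⊗ₜ[R] y + x ⊗ₜ[R] b y)
        (fun y y' => by
          simp only [map_add, TensorProduct.tmul_add]
          abel))
      (fun x x' => by
        ext y
        simp only [map_add, TensorProduct.add_tmul, AddMonoidHom.mk'_apply, AddMonoidHom.add_apply]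
        abel))
    (fun c x y => by
      simp only [AddMonoidHom.mk'_apply, ha, hb, TensorProduct.add_tmul,
        TensorProduct.tmul_add, TensorProduct.smul_tmul]
      abel)

theorem tensorConn_tmul (x : M) (y : N) :
    tensorConn D a ha b hb (x ⊗ₜ[R] y) = a x ⊗ₜ[R] y + x ⊗ₜ[R] b y := rfl

theorem tensorConn_leibniz (c : R) (z : M ⊗[R] N) :
    tensorConn D a ha b hb (c • z) = D c • z + c • tensorConn D a ha b hb z := by
  induction z using TensorProduct.induction_on with
  | zero => simp
  | add z w hz hw =>
    rw [smul_add, map_add, hz, hw, map_add, smul_add, smul_add]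
    abel
  | tmul x y =>
    rw [TensorProduct.smul_tmul', tensorConn_tmul, tensorConn_tmul]
    simp only [ha, TensorProduct.add_tmul, TensorProduct.smul_tmul', smul_add]
    abel

end TensorConn

/-- A module `M` over `S` with a `σ^f`-semilinear endomorphism `φ` and a connection `∇`. The module
`Ω_S` of (continuous) differentials is free on `dT_1, …, dT_d`, so that a connection
`∇ : M → M ⊗ Ω_S` is written `∇(m) = ∑_i ∇_i(m) ⊗ dT_i`, and the Leibniz rule
`∇(a m) = m ⊗ da + a ∇(m)` reads `∇_i(a m) = (∂a/∂T_i) m + a ∇_i(m)`. (Additivity and the Leibniz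
rule make `∇` linear over `K ∩ S`, as the `∂/∂T_i` vanish on constants.) -/
structure PreSigmaNablaModule (S : FrobDiffSubring p k d) (f : ℕ) : Type (max u (v + 1)) where
  carrier : Type v
  [addCommGroup : AddCommGroup carrier]
  [module : Module S.ring carrier]
  frob : carrier →ₛₗ[S.sigma ^ f] carrier
  conn : Fin d → carrier →+ carrier
  leibniz : ∀ (i : Fin d) (a : S.ring) (x : carrier),
    conn i (a • x) = S.pderiv i a • x + a • conn i x

namespace PreSigmaNablaModule

attribute [instance] PreSigmaNablaModule.addCommGroup PreSigmaNablaModule.module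

variable {S : FrobDiffSubring p k d} {f : ℕ}

/-- `M` is a `(σ^f, ∇)`-module: it is locally free of finite rank (i.e. finite projective), the
linearization of `φ` is an isomorphism, and `∇ ∘ φ = (φ ⊗ σ^f) ∘ ∇`, where, with `q = p^f`, the
pullback on differentials is `σ^f(dT_i) = d(T_i^q) = q T_i^(q-1) dT_i`. -/
structure IsSigmaNablaModule (M : PreSigmaNablaModule.{u, v} S f) : Prop where
  finite : Module.Finite S.ring M.carrier
  projective : Module.Projective S.ring M.carrier
  linearization : IsLinearizationIso M.frob
  compat : ∀ (i : Fin d) (x : M.carrier),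
    M.conn i (M.frob x) = (((p ^ f : ℕ) : S.ring) * S.T i ^ (p ^ f - 1)) • M.frob (M.conn i x)

/-- `M` has rank one at every point of `Spec S`. -/
def IsRankOne (M : PreSigmaNablaModule.{u, v} S f) : Prop :=
  ∀ 𝔭 : PrimeSpectrum S.ring, Module.rankAtStalk (R := S.ring) M.carrier 𝔭 = 1

/-- The tensor product: `φ(x ⊗ y) = φ(x) ⊗ φ(y)` and `∇_i(x ⊗ y) = ∇_i(x) ⊗ y + x ⊗ ∇_i(y)`. -/
def tensor (M N : PreSigmaNablaModule.{u, v} S f) : PreSigmaNablaModule.{u, v} S f where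
  carrier := M.carrier ⊗[S.ring] N.carrier
  frob := TensorProduct.map M.frob N.frob
  conn i := tensorConn (S.pderiv i) (M.conn i) (M.leibniz i) (N.conn i) (N.leibniz i)
  leibniz i := tensorConn_leibniz (S.pderiv i) (M.conn i) (M.leibniz i) (N.conn i) (N.leibniz i)

/-- `M.tensorPowSucc t` is the tensor power `M^{⊗(t+1)}`. -/
def tensorPowSucc (M : PreSigmaNablaModule.{u, v} S f) : ℕ → PreSigmaNablaModule.{u, v} S f
  | 0 => M
  | t + 1 => (M.tensorPowSucc t).tensor M

/-- For `S ⊆ S'`, the module `M` over `S'` with its Frobenius and its connection is the base change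
of `N` from `S` to `S'`: there is a map `j : N → M`, linear over `S ⊆ S'` and compatible with
`φ` and with all `∇_i`, whose linearization `S' ⊗_S N → M` is an isomorphism. (The Frobenius and
the connection of the base change `S' ⊗_S N` are the only ones that are compatible with those
of `N`.) -/
def IsBaseChangeOf {S S' : FrobDiffSubring p k d} {f : ℕ} (h : S.toSubring ≤ S'.toSubring)
    (M : PreSigmaNablaModule.{u, v} S' f) (N : PreSigmaNablaModule.{u, u} S f) : Prop :=
  ∃ j : N.carrier →ₛₗ[Subring.inclusion h] M.carrier,
    (∀ x, j (N.frob x) = M.frob (j x)) ∧ (∀ i x, j (N.conn i x) = M.conn i (j x)) ∧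
      IsLinearizationIso j

end PreSigmaNablaModule

end Modules

end

end LogDecay

/-! Write q = p^f. The proof shows that M is free, and then that some tensor power has a basis on
which Frobenius acts by a unit of the Tate algebra. This is enough. If φ(e) = a e and ∇_i(e) = b_i
e, compatibility reads b_i = q T_i^(q-1) σ^f(b_i) - a⁻¹ ∂a/∂T_i. If a is a unit of the Tate algebra
then, since |q| < 1, every nonzero coefficient of b_i at an exponent with a negative entry is
exceeded in absolute value by another such coefficient. Coefficients tend to 0, so all of these
vanish (`mem_tateAlgebra_of_compatible`).

Freeness (`exists_generator_of_rank_one`). A projective module of rank one embeds in the domain 𝒜^r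
by some ι. On the image, Frobenius is σ^f times a fixed fraction, so the lattice L of elements of
Gauss norm at most 1 is proportional to its own Frobenius pullback. Modulo p this gives an ideal I
of a ring of Laurent polynomials over k that is proportional to its q-th Frobenius power. That ring
is noetherian and factorial. Removing the gcd of I leaves an ideal contained in its own square,
hence the unit ideal if I ≠ 0, so I is principal (`exists_generator_of_proportional_pow`). The
generator lifts by successive approximation if r ≤ 0, where the lattice can be taken over the
complete unit ball of the Tate algebra. If r > 0 it lifts by Nakayama's lemma, because principal
units of 𝒜^r are invertible in 𝒜^r.

Change of basis (`exists_tate_gauge`). If r < 0 then 𝒜^r is the Tate algebra and nothing remains.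
Let 0 ≤ r < 1 and put θ_i = T_i ∂/∂T_i, β_i = T_i b_i. Reduction modulo p shows a = c T^w u with |u
- 1| < 1 (`exists_eq_monomial_mul`), and compatibility becomes u⁻¹ θ_i(u) = q σ^f(β_i) - β_i - w_i.
The left side is closed, and |q| < 1 forces θ_j(β_i) = θ_i(β_j) (`euler_comm_of_log`). The part of
this closed form with negative exponents can be integrated in 𝒜: division by v_i costs at most a
factor |v_i|, which log-decay bounds by a constant times |x_v|^(-r), and |x_v|^(1-r) still tends to
0 because r < 1 (`exists_potential`). The resulting G makes every β_i + θ_i(G) an element of the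
Tate algebra.

For large N put E = p^(N+1) G and H = p^N log(u^p) + σ^f(E) - E. All θ_i(H) lie in the Tate algebra,
hence so does H, and u^(p^(N+1)) σ^f(exp E) = exp(H) exp(E) (`exists_exp_gauge`). A priori exp E
lies only in 𝒜. The last equation yields log-decay, since σ^f multiplies exponents by q
(`exp_mem_logDecayRing`). A further power q - 1 makes the monomial a Frobenius coboundary of a power
of T^w, so τ = p^(N+1) (q - 1) works. -/

namespace LogDecay

noncomputable section

namespace RestrictedSeries

set_option linter.unusedSectionVars false

/-! ### The Gauss norm on restricted series -/

section Norm

variable {K : Type*} [NormedField K] {G : Type*} [TopologicalSpace G] [DiscreteTopology G]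

/-- A restricted series as a function vanishing at infinity on the discrete space of exponents. -/
def toC0 : RestrictedSeries K G →+ ZeroAtInftyContinuousMap G K where
  toFun x := ⟨⟨x.coeff, continuous_of_discreteTopology⟩, by
    rw [cocompact_eq_cofinite]; exact x.tendsto_coeff⟩
  map_zero' := rfl
  map_add' _ _ := rfl

theorem toC0_apply (x : RestrictedSeries K G) (u : G) : toC0 x u = x.coeff u := rfl

theorem toC0_injective : Function.Injective (toC0 : RestrictedSeries K G → _) := fun x y h => by
  ext u
  rw [← toC0_apply, h, toC0_apply]

theorem toC0_surjective : Function.Surjective (toC0 : RestrictedSeries K G → _) := fun g =>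
  ⟨mk g (by rw [← cocompact_eq_cofinite]; exact g.zero_at_infty'), rfl⟩

instance : NormedAddCommGroup (RestrictedSeries K G) :=
  NormedAddCommGroup.induced _ _ toC0 toC0_injective

theorem norm_toC0 (x : RestrictedSeries K G) : ‖toC0 x‖ = ‖x‖ := rfl

theorem norm_le_iff {x : RestrictedSeries K G} {C : ℝ} (hC : 0 ≤ C) :
    ‖x‖ ≤ C ↔ ∀ u, ‖x.coeff u‖ ≤ C := by
  rw [← norm_toC0, ← ZeroAtInftyContinuousMap.norm_toBCF_eq_norm,
    BoundedContinuousFunction.norm_le hC]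
  rfl

theorem norm_coeff_le (x : RestrictedSeries K G) (u : G) : ‖x.coeff u‖ ≤ ‖x‖ :=
  (norm_le_iff (norm_nonneg x)).1 le_rfl u

/-- Only finitely many coefficients reach half of the supremum, so the supremum is a maximum. Strict
inequalities for the Gauss norm can therefore be tested on coefficients. -/
theorem exists_norm_coeff_eq [Nonempty G] (x : RestrictedSeries K G) :
    ∃ u, ‖x.coeff u‖ = ‖x‖ := by
  rcases eq_or_ne x 0 with rfl | hx
  · exact ⟨Classical.arbitrary G, by simp⟩
  have h0 : 0 < ‖x‖ := norm_pos_iff.2 hx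
  have hf := x.finite_le_norm (half_pos h0)
  rcases hf.toFinset.eq_empty_or_nonempty with h | h
  · refine absurd ((norm_le_iff (half_pos h0).le).2 fun u => ?_) (not_le.2 (half_lt_self h0))
    by_contra hlt
    have : u ∈ hf.toFinset := by simpa using (not_le.1 hlt).le
    simp [h] at this
  · obtain ⟨u, hu, hmax⟩ := hf.toFinset.exists_max_image (fun u => ‖x.coeff u‖) h
    refine ⟨u, le_antisymm (norm_coeff_le x u) ?_⟩
    refine (norm_le_iff (norm_nonneg _)).2 fun w => ?_
    by_cases hw : ‖x‖ / 2 ≤ ‖x.coeff w‖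
    · exact hmax w (by simpa using hw)
    · exact (not_le.1 hw).le.trans (by simpa using hu)

theorem norm_lt_iff [Nonempty G] {x : RestrictedSeries K G} {C : ℝ} :
    ‖x‖ < C ↔ ∀ u, ‖x.coeff u‖ < C := by
  refine ⟨fun h u => (norm_coeff_le x u).trans_lt h, fun h => ?_⟩
  obtain ⟨u, hu⟩ := exists_norm_coeff_eq x
  exact hu ▸ h u

@[simp] theorem coeff_sub (x y : RestrictedSeries K G) (u : G) :
    (x - y).coeff u = x.coeff u - y.coeff u := rfl

theorem continuous_coeff (u : G) : Continuous fun x : RestrictedSeries K G => x.coeff u := by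
  refine (LipschitzWith.of_dist_le_mul (K := 1) fun x y => ?_).continuous
  rw [NNReal.coe_one, one_mul, dist_eq_norm, dist_eq_norm]
  exact norm_coeff_le (x - y) u

instance [IsUltrametricDist K] : IsUltrametricDist (RestrictedSeries K G) :=
  IsUltrametricDist.isUltrametricDist_of_forall_norm_add_le_max_norm fun x y =>
    (norm_le_iff (le_max_of_le_left (norm_nonneg _))).2 fun u =>
      (IsUltrametricDist.norm_add_le_max _ _).trans
        (max_le_max (norm_coeff_le x u) (norm_coeff_le y u))

instance [CompleteSpace K] : CompleteSpace (RestrictedSeries K G) := by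
  have hi : IsUniformInducing (toC0 : RestrictedSeries K G → _) := ⟨rfl⟩
  refine (hi.completeSpace_congr toC0_surjective).2 inferInstance

theorem norm_monomial (v : G) (a : K) : ‖(monomial v a : RestrictedSeries K G)‖ = ‖a‖ := by
  refine le_antisymm ((norm_le_iff (norm_nonneg a)).2 fun u => ?_) ?_
  · rw [coeff_monomial]
    split_ifs <;> simp
  · have := norm_coeff_le (monomial v a) v
    rwa [coeff_monomial, if_pos rfl] at this

variable [AddCommGroup G] [IsUltrametricDist K]

/-- Only submultiplicativity is formal. Equality over `WittField p k` comes later, from the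
reduction modulo p having values in a domain. -/
theorem norm_mul_le' (x y : RestrictedSeries K G) : ‖x * y‖ ≤ ‖x‖ * ‖y‖ := by
  refine (norm_le_iff (by positivity)).2 fun u => ?_
  rw [coeff_mul]
  refine IsUltrametricDist.norm_tsum_le_of_forall_le_of_nonneg (by positivity) fun v => ?_
  rw [norm_mul]
  exact mul_le_mul (norm_coeff_le _ _) (norm_coeff_le _ _) (norm_nonneg _) (norm_nonneg _)

variable [CompleteSpace K]

instance : NormedCommRing (RestrictedSeries K G) where
  __ := (inferInstance : NormedAddCommGroup (RestrictedSeries K G))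
  __ := (inferInstance : CommRing (RestrictedSeries K G))
  norm_mul_le := norm_mul_le'

instance : NormOneClass (RestrictedSeries K G) :=
  ⟨(norm_monomial 0 1).trans norm_one⟩

/-- The constants. -/
def const : K →+* RestrictedSeries K G where
  toFun a := monomial 0 a
  map_one' := rfl
  map_zero' := by ext u; simp [coeff_monomial]
  map_mul' a b := by ext u; rw [coeff_monomial_mul]; simp [coeff_monomial]
  map_add' a b := by
    ext u
    simp only [coeff_monomial, coeff_add]
    split_ifs <;> simp

instance : Algebra K (RestrictedSeries K G) := const.toAlgebra

theorem smul_def' (a : K) (x : RestrictedSeries K G) : a • x = monomial 0 a * x := rfl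

@[simp] theorem coeff_smul (a : K) (x : RestrictedSeries K G) (u : G) :
    (a • x).coeff u = a * x.coeff u := by
  rw [smul_def', coeff_monomial_mul, sub_zero]

theorem norm_smul' (a : K) (x : RestrictedSeries K G) : ‖a • x‖ = ‖a‖ * ‖x‖ := by
  refine le_antisymm ?_ ?_
  · exact (norm_mul_le' (monomial 0 a) x).trans_eq (by rw [norm_monomial])
  · obtain ⟨u, hu⟩ := exists_norm_coeff_eq x
    rw [← hu, ← norm_mul, ← coeff_smul]
    exact norm_coeff_le _ _

instance : NormedAlgebra K (RestrictedSeries K G) where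
  norm_smul_le a x := (norm_smul' a x).le

theorem monomial_mul_monomial (u v : G) (a b : K) :
    (monomial u a * monomial v b : RestrictedSeries K G) = monomial (u + v) (a * b) := by
  ext w
  rw [coeff_monomial_mul, coeff_monomial, coeff_monomial]
  by_cases h : w = u + v
  · simp [h]
  · have h' : w - u ≠ v := fun h0 => h (by rw [← h0]; abel)
    simp [h, h']

/-- A coefficient of a product is bounded by some product of coefficients. -/
theorem exists_norm_coeff_mul_le {x y : RestrictedSeries K G} {u : G}
    (h : (x * y).coeff u ≠ 0) :
    ∃ v w, v + w = u ∧ x.coeff v ≠ 0 ∧ y.coeff w ≠ 0 ∧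
      ‖(x * y).coeff u‖ ≤ ‖x.coeff v‖ * ‖y.coeff w‖ := by
  obtain ⟨v, hv⟩ := exists_le_norm_of_tsum (norm_pos_iff.2 h) le_rfl (tendsto_conv x y u)
  have h0 : x.coeff v * y.coeff (u - v) ≠ 0 := norm_pos_iff.1 ((norm_pos_iff.2 h).trans_le hv)
  exact ⟨v, u - v, by simp, left_ne_zero_of_mul h0, right_ne_zero_of_mul h0,
    hv.trans_eq (norm_mul _ _)⟩

end Norm

end RestrictedSeries

end

end LogDecay

namespace LogDecay

noncomputable section

set_option linter.unusedSectionVars false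

/-! ### The value group of K, and series as a free module over the image of σ^f -/

section Frobenius

variable (p : ℕ) [Fact p.Prime] (k : Type*) [Field k] [CharP k p] [PerfectRing k p]

theorem one_lt_cast_p : (1 : ℝ) < p := by exact_mod_cast (Fact.out : p.Prime).one_lt

theorem cast_p_pos : (0 : ℝ) < p := zero_lt_one.trans (one_lt_cast_p p)

theorem pow_f_pos (f : ℕ) : 0 < p ^ f := pow_pos (Fact.out : p.Prime).pos f

namespace WittField

theorem frobenius_surjective : Function.Surjective (frobenius p k) := by
  have h : (frobenius p k : WittField p k → WittField p k) =
      IsFractionRing.ringEquivOfRingEquiv (K := FractionRing (WittVector p k))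
        (L := FractionRing (WittVector p k)) (WittVector.frobeniusEquiv p k) := rfl
  rw [h]
  exact RingEquiv.surjective _

theorem frobenius_pow_apply_bijective (f : ℕ) : Function.Bijective (frobenius p k ^ f) := by
  rw [RingHom.coe_pow]
  exact Function.Bijective.iterate ⟨(frobenius p k).injective, frobenius_surjective p k⟩ f

theorem norm_frobenius_pow (f : ℕ) (x : WittField p k) : ‖(frobenius p k ^ f) x‖ = ‖x‖ := by
  induction f with
  | zero => rfl
  | succ f ih => rw [pow_succ', RingHom.mul_def, RingHom.comp_apply, norm_frobenius, ih]

variable {p k}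

theorem exists_norm_eq_zpow {x : WittField p k} (hx : x ≠ 0) :
    ∃ c : ℤ, ‖x‖ = ‖(p : WittField p k) ^ c‖ := by
  have key : ∀ w : WittVector p k, w ≠ 0 →
      ∃ m : ℕ, ‖algebraMap (WittVector p k) (WittField p k) w‖ = ‖(p : WittField p k) ^ m‖ := by
    intro w h0
    obtain ⟨m, b, rfl⟩ := WittVector.exists_eq_pow_p_mul' w h0
    exact ⟨m, by rw [map_mul, norm_mul, WittField.norm_unit, mul_one, map_pow, map_natCast]⟩
  obtain ⟨a, b, hb, rfl⟩ := IsFractionRing.div_surjective (WittVector p k) x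
  have ha : a ≠ 0 := by
    rintro rfl
    exact hx (by simp)
  obtain ⟨m, hm⟩ := key a ha
  obtain ⟨n, hn⟩ := key b (nonZeroDivisors.ne_zero hb)
  refine ⟨(m : ℤ) - n, ?_⟩
  rw [norm_div, hm, hn, zpow_sub₀ (WittField.p_ne_zero p k), norm_div, zpow_natCast, zpow_natCast]

theorem norm_p_lt_one : ‖(p : WittField p k)‖ < 1 := by
  rw [WittField.norm_p]
  exact inv_lt_one_of_one_lt₀ (one_lt_cast_p p)

theorem norm_p_pos : 0 < ‖(p : WittField p k)‖ := norm_pos_iff.2 (WittField.p_ne_zero p k)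

/-- If n = p^a m vanishes with p ∤ m, then m vanishes, and a Bézout relation x m + y p = 1 gives |1|
≤ |p| < 1. Characteristic zero is what later permits division by factorials and by exponents. -/
instance : CharZero (WittField p k) := by
  refine charZero_of_inj_zero fun n hn => ?_
  by_contra h0
  obtain ⟨a, m, hm, rfl⟩ := Nat.exists_eq_pow_mul_and_not_dvd h0 p (Fact.out : p.Prime).ne_one
  rw [Nat.cast_mul, Nat.cast_pow, mul_eq_zero,
    or_iff_right (pow_ne_zero _ (WittField.p_ne_zero p k))] at hn
  have h1 : IsCoprime (m : ℤ) p :=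
    Nat.isCoprime_iff_coprime.2 (((Fact.out : p.Prime).coprime_iff_not_dvd.2 hm).symm)
  obtain ⟨x, y, hxy⟩ := h1
  have h2 := congrArg (fun z : ℤ => ‖(z : WittField p k)‖) hxy
  simp only [Int.cast_add, Int.cast_mul, Int.cast_natCast, hn, mul_zero, zero_add, norm_mul,
    Int.cast_one, norm_one] at h2
  refine absurd h2 (ne_of_lt ?_)
  exact (mul_le_of_le_one_left (norm_nonneg _)
    (IsUltrametricDist.norm_intCast_le_one _ _)).trans_lt norm_p_lt_one

/-- The value group is generated by `|p|`. -/
theorem norm_le_norm_p_of_lt {x : WittField p k} (hx : ‖x‖ < 1) : ‖x‖ ≤ ‖(p : WittField p k)‖ := by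
  rcases eq_or_ne x 0 with rfl | h0
  · simp
  obtain ⟨c, hc⟩ := exists_norm_eq_zpow h0
  rw [hc] at hx ⊢
  rw [norm_zpow] at hx ⊢
  have h1 : 1 ≤ c := by
    by_contra h
    have h : c ≤ 0 := by omega
    exact absurd hx (not_lt.2 (one_le_zpow_of_nonpos₀ norm_p_pos norm_p_lt_one.le h))
  calc ‖(p : WittField p k)‖ ^ c ≤ ‖(p : WittField p k)‖ ^ (1 : ℤ) :=
        zpow_le_zpow_right_of_le_one₀ norm_p_pos norm_p_lt_one.le h1
    _ = _ := zpow_one _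

end WittField

namespace LaurentRing

open RestrictedSeries

variable {p k} {d : ℕ}

/-- The Gauss norm is attained at a coefficient and the value group of K is generated by |p|, so a
power of p normalises any nonzero series. -/
theorem exists_norm_smul_eq_one {x : LaurentRing p k d} (hx : x ≠ 0) :
    ∃ c : ℤ, ‖x‖ = ‖(p : WittField p k) ^ c‖ ∧ ‖(p : WittField p k) ^ (-c) • x‖ = 1 := by
  obtain ⟨u, hu⟩ := exists_norm_coeff_eq x
  have h0 : x.coeff u ≠ 0 := by
    rw [← norm_ne_zero_iff, hu]
    exact norm_ne_zero_iff.2 hx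
  obtain ⟨c, hc⟩ := WittField.exists_norm_eq_zpow h0
  refine ⟨c, hu ▸ hc, ?_⟩
  rw [norm_smul', ← hu, hc, ← norm_mul, ← zpow_add₀ (WittField.p_ne_zero p k), neg_add_cancel,
    zpow_zero, norm_one]

theorem norm_le_norm_p_of_lt {x : LaurentRing p k d} (hx : ‖x‖ < 1) :
    ‖x‖ ≤ ‖(p : WittField p k)‖ := by
  obtain ⟨u, hu⟩ := exists_norm_coeff_eq x
  rw [← hu] at hx ⊢
  exact WittField.norm_le_norm_p_of_lt hx

theorem norm_inv_p_smul_le {x : LaurentRing p k d} (hx : ‖x‖ < 1) :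
    ‖(p : WittField p k)⁻¹ • x‖ ≤ 1 := by
  rw [norm_smul', norm_inv, inv_mul_le_iff₀ WittField.norm_p_pos, mul_one]
  exact norm_le_norm_p_of_lt hx

variable (p k d)

/-- The `f`-th power of the Frobenius lift of `K⟨T_1^±, …, T_d^±⟩`. -/
def sigmaPow (f : ℕ) : LaurentRing p k d →+* LaurentRing p k d := LaurentRing.sigma p k d ^ f

variable {p k d}

theorem sigmaPow_succ (f : ℕ) (x : LaurentRing p k d) :
    sigmaPow p k d (f + 1) x = LaurentRing.sigma p k d (sigmaPow p k d f x) := by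
  rw [sigmaPow, pow_succ', RingHom.mul_def, RingHom.comp_apply, ← sigmaPow]

theorem coeff_sigmaPow (f : ℕ) (x : LaurentRing p k d) (u : Fin d → ℤ) :
    (sigmaPow p k d f x).coeff (p ^ f • u) = (WittField.frobenius p k ^ f) (x.coeff u) := by
  induction f with
  | zero => rw [pow_zero, one_smul]; rfl
  | succ f ih =>
    have h : p ^ (f + 1) • u = nsmulAddMonoidHom (α := Fin d → ℤ) p (p ^ f • u) := by
      rw [pow_succ', mul_smul]; rfl
    rw [sigmaPow_succ, h, LaurentRing.sigma, coeff_mapExp_apply, ih, pow_succ', RingHom.mul_def,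
      RingHom.comp_apply]

theorem coeff_sigmaPow_of_ne (f : ℕ) (x : LaurentRing p k d) {u : Fin d → ℤ}
    (hu : ∀ v, p ^ f • v ≠ u) : (sigmaPow p k d f x).coeff u = 0 := by
  induction f generalizing u with
  | zero => exact absurd (by simp) (hu u)
  | succ f ih =>
    rw [sigmaPow_succ]
    by_contra h
    obtain ⟨v, hv, hn⟩ := exists_of_coeff_sigma h
    have h1 : (sigmaPow p k d f x).coeff v = 0 := ih fun w hw => hu w (by
      funext l
      have h3 : p ^ f • w l = v l := congrFun hw l
      rw [Pi.smul_apply, hv l, ← h3, pow_succ', mul_smul, nsmul_eq_mul])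
    rw [h1, norm_zero, norm_eq_zero] at hn
    exact h hn

theorem norm_sigmaPow (f : ℕ) (x : LaurentRing p k d) : ‖sigmaPow p k d f x‖ = ‖x‖ := by
  refine le_antisymm ((norm_le_iff (norm_nonneg _)).2 fun u => ?_)
    ((norm_le_iff (norm_nonneg _)).2 fun u => ?_)
  · by_cases h : ∃ v, p ^ f • v = u
    · obtain ⟨v, rfl⟩ := h
      rw [coeff_sigmaPow, WittField.norm_frobenius_pow]
      exact norm_coeff_le _ _
    · rw [coeff_sigmaPow_of_ne f x fun v hv => h ⟨v, hv⟩, norm_zero]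
      exact norm_nonneg _
  · rw [← WittField.norm_frobenius_pow p k f, ← coeff_sigmaPow]
    exact norm_coeff_le _ _

theorem continuous_sigmaPow (f : ℕ) : Continuous (sigmaPow p k d f) :=
  (AddMonoidHomClass.isometry_of_norm (sigmaPow p k d f) (norm_sigmaPow f)).continuous

theorem natSmul_apply (q : ℕ) (v : Fin d → ℤ) (i : Fin d) : (q • v) i = q * v i := by
  rw [Pi.smul_apply, nsmul_eq_mul]

theorem smul_pow_injective (f : ℕ) : Function.Injective fun v : Fin d → ℤ => p ^ f • v := by
  intro u v h
  funext i
  have h1 : (p ^ f • u) i = (p ^ f • v) i := congrFun h i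
  rw [natSmul_apply, natSmul_apply] at h1
  exact mul_left_cancel₀ (by exact_mod_cast (pow_f_pos p f).ne') h1

theorem sigmaPow_monomial (f : ℕ) (v : Fin d → ℤ) (a : WittField p k) :
    sigmaPow p k d f (monomial v a) = monomial (p ^ f • v) ((WittField.frobenius p k ^ f) a) := by
  ext u
  by_cases h : ∃ w, p ^ f • w = u
  · obtain ⟨w, rfl⟩ := h
    rw [coeff_sigmaPow, coeff_monomial, coeff_monomial]
    by_cases hw : w = v
    · simp [hw]
    · rw [if_neg hw, if_neg fun h => hw (smul_pow_injective f h), map_zero]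
  · rw [coeff_sigmaPow_of_ne f _ fun v hv => h ⟨v, hv⟩, coeff_monomial,
      if_neg fun h' => h ⟨v, h'.symm⟩]

theorem sigmaPow_smul (f : ℕ) (a : WittField p k) (x : LaurentRing p k d) :
    sigmaPow p k d f (a • x) = (WittField.frobenius p k ^ f) a • sigmaPow p k d f x := by
  rw [smul_def', map_mul, sigmaPow_monomial, smul_zero, ← smul_def']

/-- The exponents `0 ≤ α_i < q`. -/
def boxExp {q : ℕ} (α : Fin d → Fin q) : Fin d → ℤ := fun i => ((α i : ℕ) : ℤ)

theorem exists_eq_smul_add_boxExp {q : ℕ} (hq : 0 < q) (u : Fin d → ℤ) :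
    ∃ (v : Fin d → ℤ) (α : Fin d → Fin q), u = q • v + boxExp α := by
  have hq' : (0 : ℤ) < q := by exact_mod_cast hq
  refine ⟨fun i => u i / q, fun i => ⟨(u i % q).toNat, ?_⟩, ?_⟩
  · have := Int.emod_lt_of_pos (u i) hq'
    have := Int.emod_nonneg (u i) hq'.ne'
    omega
  · funext i
    have := Int.emod_nonneg (u i) hq'.ne'
    have h2 := Int.mul_ediv_add_emod (u i) q
    simp only [boxExp, Pi.add_apply, natSmul_apply]
    rw [Int.toNat_of_nonneg this, h2]

theorem smul_add_boxExp_inj {q : ℕ} {u v : Fin d → ℤ} {α β : Fin d → Fin q}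
    (h : q • u + boxExp α = q • v + boxExp β) : u = v ∧ α = β := by
  have key : ∀ i, u i = v i ∧ α i = β i := by
    intro i
    have h1 := congrFun h i
    simp only [boxExp, Pi.add_apply, natSmul_apply] at h1
    have ha := (α i).2
    have hb := (β i).2
    have hq' : (0 : ℤ) < q := by omega
    have e1 : u i = v i := by
      have := congrArg (· / (q : ℤ)) h1
      simp only [add_comm ((q : ℤ) * _), Int.add_mul_ediv_left _ _ hq'.ne'] at this
      rwa [Int.ediv_eq_zero_of_lt (by omega) (by omega),
        Int.ediv_eq_zero_of_lt (by omega) (by omega), zero_add, zero_add] at this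
    refine ⟨e1, Fin.ext ?_⟩
    rw [e1] at h1
    omega
  exact ⟨funext fun i => (key i).1, funext fun i => (key i).2⟩

/-- Each exponent is q v + β with 0 ≤ β_i < q in exactly one way, so only one summand contributes to
a given coefficient. Bounds on norms and exponents of the sum can thus be read off from the y_α
separately. -/
theorem coeff_sum_monomial_mul_sigmaPow (f : ℕ) (y : (Fin d → Fin (p ^ f)) → LaurentRing p k d)
    (v : Fin d → ℤ) (β : Fin d → Fin (p ^ f)) :
    (∑ α, monomial (boxExp α) 1 * sigmaPow p k d f (y α)).coeff (p ^ f • v + boxExp β) =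
      (WittField.frobenius p k ^ f) ((y β).coeff v) := by
  have hsum : ∀ (s : Finset (Fin d → Fin (p ^ f))) (g : (Fin d → Fin (p ^ f)) → LaurentRing p k d)
      (u : Fin d → ℤ), (∑ α ∈ s, g α).coeff u = ∑ α ∈ s, (g α).coeff u := by
    classical
    intro s g u
    induction s using Finset.induction_on with
    | empty => simp
    | insert a s ha ih => rw [Finset.sum_insert ha, Finset.sum_insert ha, coeff_add, ih]
  rw [hsum, Finset.sum_eq_single β]
  · rw [coeff_monomial_mul, one_mul, add_sub_cancel_right, coeff_sigmaPow]
  · intro α _ hα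
    rw [coeff_monomial_mul, one_mul]
    refine coeff_sigmaPow_of_ne f _ fun w hw => hα ?_
    exact (smul_add_boxExp_inj (u := w) (v := v) (by rw [hw]; abel)).2
  · simp

/-- The coefficients of `x` in the basis `T^α`, `0 ≤ α_i < q`, over the image of `σ^f`. -/
def frobPart (f : ℕ) (α : Fin d → Fin (p ^ f)) (x : LaurentRing p k d) : LaurentRing p k d :=
  RestrictedSeries.mk (fun v => (Equiv.ofBijective _
    (WittField.frobenius_pow_apply_bijective p k f)).symm (x.coeff (p ^ f • v + boxExp α))) (by
    refine tendsto_of_finite fun ε hε => ?_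
    refine ((x.finite_le_norm hε).preimage (f := fun v => p ^ f • v + boxExp α)
      (fun u _ v _ h => (smul_add_boxExp_inj h).1)).subset fun v hv => ?_
    have h := WittField.norm_frobenius_pow p k f ((Equiv.ofBijective _
      (WittField.frobenius_pow_apply_bijective p k f)).symm (x.coeff (p ^ f • v + boxExp α)))
    rw [← Equiv.ofBijective_apply _ (hf := WittField.frobenius_pow_apply_bijective p k f),
      Equiv.apply_symm_apply] at h
    exact (hv : ε ≤ ‖_‖).trans_eq h.symm)

theorem frobenius_coeff_frobPart (f : ℕ) (α : Fin d → Fin (p ^ f)) (x : LaurentRing p k d)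
    (v : Fin d → ℤ) : (WittField.frobenius p k ^ f) ((frobPart f α x).coeff v) =
      x.coeff (p ^ f • v + boxExp α) := by
  rw [← Equiv.ofBijective_apply _ (hf := WittField.frobenius_pow_apply_bijective p k f), frobPart,
    coeff_mk, Equiv.apply_symm_apply]

theorem norm_coeff_frobPart (f : ℕ) (α : Fin d → Fin (p ^ f)) (x : LaurentRing p k d)
    (v : Fin d → ℤ) : ‖(frobPart f α x).coeff v‖ = ‖x.coeff (p ^ f • v + boxExp α)‖ := by
  rw [← frobenius_coeff_frobPart, WittField.norm_frobenius_pow]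

theorem sum_frobPart (f : ℕ) (x : LaurentRing p k d) :
    ∑ α, monomial (boxExp α) 1 * sigmaPow p k d f (frobPart f α x) = x := by
  ext u
  obtain ⟨v, β, rfl⟩ := exists_eq_smul_add_boxExp (pow_f_pos p f) u
  rw [coeff_sum_monomial_mul_sigmaPow, frobenius_coeff_frobPart]

end LaurentRing

end Frobenius

end

end LogDecay

namespace LogDecay

noncomputable section

set_option linter.unusedSectionVars false

/-! ### Ideals proportional to their Frobenius powers -/

section FrobeniusIdeal

variable {B : Type*} [CommRing B] [IsDomain B] [UniqueFactorizationMonoid B] [IsNoetherianRing B]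

/-- Take the gcd g of finitely many generators: if d divides everything in g⁻¹I, then g d divides
the generators, hence g. The last clause thus says that g⁻¹I has no common factor left. -/
theorem exists_gcd_of_ideal (I : Ideal B) (hI : I ≠ ⊥) :
    ∃ g : B, g ≠ 0 ∧ (∀ x ∈ I, g ∣ x) ∧ ∀ d, (∀ z, g * z ∈ I → d ∣ z) → IsUnit d := by
  let _ : NormalizedGCDMonoid B := Classical.choice inferInstance
  obtain ⟨s, hs⟩ := (isNoetherianRing_iff_ideal_fg B).1 inferInstance I
  have hg0 : s.gcd id ≠ 0 := by
    intro h0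
    rw [Finset.gcd_eq_zero_iff] at h0
    refine hI (hs ▸ Ideal.span_eq_bot.2 fun x hx => h0 x hx)
  have hdvd : ∀ x ∈ I, s.gcd id ∣ x := by
    intro x hx
    rw [← Ideal.mem_span_singleton]
    refine (?_ : I ≤ _) hx
    rw [← hs, Ideal.span_le]
    intro y hy
    exact Ideal.mem_span_singleton.2 (Finset.gcd_dvd (f := id) hy)
  refine ⟨s.gcd id, hg0, hdvd, fun d hd => ?_⟩
  have h1 : s.gcd id * d ∣ s.gcd id * 1 := by
    rw [mul_one]
    refine Finset.dvd_gcd fun x hx => ?_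
    have hxI : x ∈ I := hs ▸ Ideal.subset_span hx
    obtain ⟨z, hz⟩ := hdvd x hxI
    rw [id, hz]
    exact mul_dvd_mul_left _ (hd z (hz ▸ hxI))
  exact isUnit_of_dvd_one ((mul_dvd_mul_iff_left hg0).1 h1)

/-- An ideal `I` of a noetherian factorial domain for which `I` and its Frobenius power are
proportional is principal. -/
theorem exists_generator_of_proportional_pow {I : Ideal B} {q : ℕ} (hq : 2 ≤ q) {a b : B}
    (ha : a ≠ 0) (hb : b ≠ 0)
    (h1 : ∀ x ∈ I, ∃ z ∈ Ideal.span ((fun y => y ^ q) '' (I : Set B)), b * x = a * z)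
    (h2 : ∀ y ∈ I, ∃ x ∈ I, b * x = a * y ^ q) :
    ∃ g ∈ I, ∀ x ∈ I, ∃ c, x = c * g := by
  by_cases hI : I = ⊥
  · refine ⟨0, I.zero_mem, fun x hx => ⟨0, ?_⟩⟩
    rw [hI, Ideal.mem_bot] at hx
    simpa using hx
  obtain ⟨g, hg0, hg, hunit⟩ := exists_gcd_of_ideal I hI
  -- The ideal J = g⁻¹I has only units as common divisors, and its Frobenius power is proportional
  -- to it with the factors a g^q and b g.
  set J : Ideal B := Submodule.comap (LinearMap.mulLeft B g) I with hJ
  have memJ : ∀ z, z ∈ J ↔ g * z ∈ I := fun z => Iff.rfl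
  have hJunit : ∀ d, (∀ z ∈ J, d ∣ z) → IsUnit d := fun d hd => hunit d fun z hz => hd z hz
  have hu : b * g ≠ 0 := mul_ne_zero hb hg0
  have hv : a * g ^ q ≠ 0 := mul_ne_zero ha (pow_ne_zero _ hg0)
  set Jq : Ideal B := Ideal.span ((fun y => y ^ q) '' (J : Set B)) with hJq
  have h1' : ∀ z ∈ J, ∃ w ∈ Jq, b * g * z = a * g ^ q * w := by
    intro z hz
    obtain ⟨w, hw, hw'⟩ := h1 _ hz
    have key : ∀ w ∈ Ideal.span ((fun y => y ^ q) '' (I : Set B)), ∃ w' ∈ Jq, w = g ^ q * w' := by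
      intro w hw
      induction hw using Submodule.span_induction with
      | mem x hx =>
        obtain ⟨y, hy, rfl⟩ := hx
        obtain ⟨y', rfl⟩ := hg y hy
        exact ⟨y' ^ q, Ideal.subset_span ⟨y', hy, rfl⟩, mul_pow _ _ _⟩
      | zero => exact ⟨0, Jq.zero_mem, by simp⟩
      | add x y _ _ hx hy =>
        obtain ⟨x', hx', rfl⟩ := hx
        obtain ⟨y', hy', rfl⟩ := hy
        exact ⟨x' + y', Jq.add_mem hx' hy', by ring⟩
      | smul c x _ hx =>
        obtain ⟨x', hx', rfl⟩ := hx
        exact ⟨c * x', Jq.mul_mem_left c hx', by simp only [smul_eq_mul]; ring⟩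
    obtain ⟨w', hw1, rfl⟩ := key w hw
    exact ⟨w', hw1, by
      rw [mul_assoc, mul_assoc]
      exact hw'⟩
  have h2' : ∀ y ∈ J, ∃ x ∈ J, b * g * x = a * g ^ q * y ^ q := by
    intro y hy
    obtain ⟨x, hx, hx'⟩ := h2 _ hy
    obtain ⟨x', rfl⟩ := hg x hx
    exact ⟨x', hx, by
      rw [mul_assoc, mul_assoc, ← mul_pow]
      exact hx'⟩
  -- After cancelling the common factor c of a g^q and b g, the coprime v' and u' satisfy u' J ⊆ v'
  -- Jq, and v' y^q ∈ u' J for y ∈ J. So v' divides every element of J, and a prime factor of u'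
  -- divides y^q, hence y, for every y ∈ J. Both are therefore units.
  obtain ⟨v', u', c, hrel, hcv, hcu⟩ :=
    UniqueFactorizationMonoid.exists_reduced_factors _ hv (b * g)
  have hc0 : c ≠ 0 := by
    rintro rfl
    rw [zero_mul] at hcu
    exact hu hcu.symm
  have hv'unit : IsUnit v' := by
    refine hJunit _ fun z hz => ?_
    obtain ⟨w, -, hw⟩ := h1' z hz
    rw [← hcv, ← hcu, mul_assoc, mul_assoc] at hw
    exact hrel.dvd_of_dvd_mul_left ⟨w, mul_left_cancel₀ hc0 hw⟩
  have hu'unit : IsUnit u' := by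
    by_contra hnu
    have hu'0 : u' ≠ 0 := by
      rintro rfl
      rw [mul_zero] at hcu
      exact hu hcu.symm
    obtain ⟨π, hπ, hπu⟩ := WfDvdMonoid.exists_irreducible_factor hnu hu'0
    refine hπ.not_isUnit (hJunit _ fun y hy => ?_)
    obtain ⟨x, -, hx⟩ := h2' y hy
    rw [← hcv, ← hcu, mul_assoc, mul_assoc] at hx
    have h3 : π ∣ v' * y ^ q := (hπu.mul_right x).trans (mul_left_cancel₀ hc0 hx).dvd
    exact hπ.prime.dvd_of_dvd_pow ((hv'unit.dvd_mul_left).1 h3)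
  have hJJ : J ≤ Jq := by
    intro z hz
    obtain ⟨w, hw, hw'⟩ := h1' z hz
    rw [← hcv, ← hcu, mul_assoc, mul_assoc] at hw'
    obtain ⟨t, ht⟩ := hu'unit.exists_left_inv
    have : z = t * (v' * w) := by
      rw [← mul_left_cancel₀ hc0 hw', ← mul_assoc, ht, one_mul]
    rw [this]
    exact Jq.mul_mem_left _ (Jq.mul_mem_left _ hw)
  have hJqJ : Jq ≤ J * J := by
    rw [hJq, Ideal.span_le]
    rintro _ ⟨y, hy, rfl⟩
    obtain ⟨e, rfl⟩ := Nat.exists_eq_add_of_le hq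
    change y ^ (2 + e) ∈ J * J
    rw [pow_add, sq]
    exact Ideal.mul_mem_right _ _ (Ideal.mul_mem_mul hy hy)
  -- As q ≥ 2, the Frobenius power lies in J², so J = J². A finitely generated idempotent ideal of a
  -- domain is zero or everything.
  have hidem : IsIdempotentElem J := le_antisymm Ideal.mul_le_left (hJJ.trans hJqJ)
  have hfg : J.FG := (isNoetherianRing_iff_ideal_fg B).1 inferInstance J
  rcases (Ideal.isIdempotentElem_iff_eq_bot_or_top J hfg).1 hidem with h | h
  · exfalso
    refine hI (eq_bot_iff.2 fun x hx => ?_)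
    obtain ⟨z, rfl⟩ := hg x hx
    have hz : z ∈ J := hx
    rw [h, Ideal.mem_bot] at hz
    simp [hz]
  · have h1J : (1 : B) ∈ J := h ▸ Submodule.mem_top
    rw [memJ, mul_one] at h1J
    refine ⟨g, h1J, fun x hx => ?_⟩
    obtain ⟨z, rfl⟩ := hg x hx
    exact ⟨z, mul_comm _ _⟩

end FrobeniusIdeal

/-! ### Laurent polynomials over the residue field -/

section LaurentPolynomials

variable (k : Type*) [Field k] {d : ℕ}

-- Unless both supports are single points, two different pairs of exponents have sums that occur
-- only once. Each such sum carries a nonzero coefficient of the product 1, so both sums are 0,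
-- which contradicts their uniqueness.
open AddMonoidAlgebra in
theorem exists_eq_single_of_mul_eq_one {k} [Field k] {G : Type*} [AddCommGroup G] [TwoUniqueSums G]
    {x y : AddMonoidAlgebra k G} (h : x * y = 1) :
    ∃ (w : G) (c : k), c ≠ 0 ∧ x = single w c ∧ y = single (-w) c⁻¹ := by
  classical
  have hx0 : x ≠ 0 := by rintro rfl; simp at h
  have hy0 : y ≠ 0 := by rintro rfl; simp at h
  have hone : ∀ g, (1 : AddMonoidAlgebra k G).coeff g ≠ 0 → g = 0 := by
    intro g hg
    by_contra hne
    rw [one_def, coeff_single, Finsupp.single_apply, if_neg (Ne.symm hne)] at hg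
    exact hg rfl
  have hcard : ¬ 1 < x.coeff.support.card * y.coeff.support.card := by
    intro hlt
    obtain ⟨a, ha, b, hb, hab, hua, hub⟩ := TwoUniqueSums.uniqueAdd_of_one_lt_card hlt
    have key : ∀ a ∈ x.coeff.support ×ˢ y.coeff.support,
        UniqueAdd x.coeff.support y.coeff.support a.1 a.2 → a.1 + a.2 = 0 := by
      intro a ha hua
      rw [Finset.mem_product] at ha
      refine hone _ ?_
      rw [← h, coeff_mul_add_of_uniqueAdd hua]
      exact mul_ne_zero (Finsupp.mem_support_iff.1 ha.1) (Finsupp.mem_support_iff.1 ha.2)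
    have h1 := key a ha hua
    have h2 := key b hb hub
    rw [Finset.mem_product] at hb
    have := hua hb.1 hb.2 (h2.trans h1.symm)
    exact hab (Prod.ext this.1.symm this.2.symm)
  have hcx : 0 < x.coeff.support.card :=
    Finset.card_pos.2 (Finsupp.support_nonempty_iff.2 fun h0 => hx0 (coeff_eq_zero.1 h0))
  have hcy : 0 < y.coeff.support.card :=
    Finset.card_pos.2 (Finsupp.support_nonempty_iff.2 fun h0 => hy0 (coeff_eq_zero.1 h0))
  have h1 : x.coeff.support.card = 1 := by nlinarith
  obtain ⟨w, c, hc, hw⟩ := Finsupp.card_support_eq_one'.1 h1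
  have hx : x = single w c := coeff_injective hw
  refine ⟨w, c, hc, hx, ?_⟩
  have h3 : (single (-w) c⁻¹ : AddMonoidAlgebra k G) * x = 1 := by
    rw [hx, single_mul_single, inv_mul_cancel₀ hc, neg_add_cancel, one_def]
  calc y = (single (-w) c⁻¹ * x) * y := by rw [h3, one_mul]
    _ = _ := by rw [mul_assoc, h, mul_one]

/-- The Laurent polynomials in which the variables `T_i`, `i ∈ J`, occur with exponents `≥ 0`
only. -/
def laurentNonneg (J : Set (Fin d)) : Subring (AddMonoidAlgebra k (Fin d → ℤ)) where
  carrier := {x | ∀ u, x.coeff u ≠ 0 → ∀ i ∈ J, 0 ≤ u i}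
  zero_mem' u hu := absurd (by simp) hu
  one_mem' u hu i _ := by
    classical
    rw [AddMonoidAlgebra.one_def, AddMonoidAlgebra.coeff_single, Finsupp.single_apply] at hu
    have : (0 : Fin d → ℤ) = u := by
      by_contra hne
      exact hu (if_neg hne)
    simp [← this]
  add_mem' {x y} hx hy u hu i hi := by
    by_cases h : x.coeff u = 0
    · refine hy u (fun h' => hu ?_) i hi
      simp [h, h']
    · exact hx u h i hi
  neg_mem' {x} hx u hu i hi := hx u (fun h => hu (by simp [h])) i hi
  mul_mem' {x y} hx hy u hu i hi := by
    classical
    have hs : u ∈ (x * y).coeff.support := Finsupp.mem_support_iff.2 hu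
    obtain ⟨v, hv, w, hw, rfl⟩ := Finset.mem_add.1 (AddMonoidAlgebra.support_coeff_mul_subset x y hs)
    exact add_nonneg (hx v (Finsupp.mem_support_iff.1 hv) i hi)
      (hy w (Finsupp.mem_support_iff.1 hw) i hi)

/-- The inclusion of the exponents `≥ 0`. -/
def natExp : (Fin d →₀ ℕ) →+ (Fin d → ℤ) where
  toFun m i := (m i : ℤ)
  map_zero' := by ext; simp
  map_add' m m' := by ext; simp

theorem natExp_injective : Function.Injective (natExp (d := d)) := fun m m' h => by
  ext i
  exact Int.natCast_inj.1 (congrFun h i : ((m i : ℕ) : ℤ) = (m' i : ℕ))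

theorem exists_natExp {v : Fin d → ℤ} (hv : ∀ i, 0 ≤ v i) : ∃ m, natExp m = v :=
  ⟨Finsupp.equivFunOnFinite.symm fun i => (v i).toNat, by
    funext i
    simp [natExp, hv i]⟩

/-- The inclusion of the polynomials into the Laurent polynomials. -/
def polyToLaurent (J : Set (Fin d)) : MvPolynomial (Fin d) k →+* laurentNonneg k J :=
  (AddMonoidAlgebra.mapDomainRingHom k (natExp (d := d))).codRestrict _ (by
    classical
    intro x u hu i _
    have hs : u ∈ (AddMonoidAlgebra.mapDomain (natExp (d := d)) x).coeff.support :=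
      Finsupp.mem_support_iff.2 hu
    obtain ⟨m, -, rfl⟩ := Finset.mem_image.1 (Finsupp.mapDomain_support hs)
    exact Int.natCast_nonneg _)

theorem coe_polyToLaurent (J : Set (Fin d)) (x : MvPolynomial (Fin d) k) :
    (polyToLaurent k J x : AddMonoidAlgebra k (Fin d → ℤ)) =
      AddMonoidAlgebra.mapDomain (natExp (d := d)) x := rfl

theorem polyToLaurent_injective (J : Set (Fin d)) : Function.Injective (polyToLaurent k J) :=
  fun _ _ h => AddMonoidAlgebra.mapDomain_injective natExp_injective (congrArg Subtype.val h)

instance (J : Set (Fin d)) : Algebra (MvPolynomial (Fin d) k) (laurentNonneg k J) :=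
  (polyToLaurent k J).toAlgebra

theorem exists_polyToLaurent {J : Set (Fin d)} {x : laurentNonneg k J}
    (hx : ∀ u, x.1.coeff u ≠ 0 → ∀ i, 0 ≤ u i) : ∃ y, polyToLaurent k J y = x := by
  refine ⟨AddMonoidAlgebra.comapDomain natExp natExp_injective x.1, Subtype.ext ?_⟩
  rw [coe_polyToLaurent]
  refine AddMonoidAlgebra.mapDomain_comapDomain ?_ _
  intro u hu
  obtain ⟨m, hm⟩ := exists_natExp (hx u (Finsupp.mem_support_iff.1 hu))
  exact ⟨m, hm⟩

/-- The exponent of the product of the variables outside `J`. -/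
def outsideExp (J : Set (Fin d)) : Fin d →₀ ℕ := by
  classical
  exact Finsupp.equivFunOnFinite.symm fun i => if i ∈ J then 0 else 1

theorem natExp_smul_outsideExp (J : Set (Fin d)) (N : ℕ) (i : Fin d) :
    (i ∈ J → natExp (N • outsideExp J) i = 0) ∧ (i ∉ J → natExp (N • outsideExp J) i = N) := by
  classical
  simp only [natExp, outsideExp, AddMonoidHom.coe_mk, ZeroHom.coe_mk, Finsupp.smul_apply,
    Finsupp.equivFunOnFinite_symm_apply_apply]
  constructor <;> intro h <;> simp [h]

/-- A high power of the product of the variables outside J clears all negative exponents. The ring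
thereby inherits unique factorization and the noetherian property from polynomials. -/
instance (J : Set (Fin d)) : IsLocalization.Away
    (AddMonoidAlgebra.single (outsideExp J) 1 : MvPolynomial (Fin d) k) (laurentNonneg k J) := by
  have hpow : ∀ N : ℕ, (AddMonoidAlgebra.single (outsideExp J) 1 : MvPolynomial (Fin d) k) ^ N =
      AddMonoidAlgebra.single (N • outsideExp J) 1 := by
    intro N
    rw [AddMonoidAlgebra.single_pow, one_pow]
  have halg : ∀ (x : MvPolynomial (Fin d) k), algebraMap (MvPolynomial (Fin d) k)
    (laurentNonneg k J) x = polyToLaurent k J x := fun _ => rfl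
  rw [IsLocalization.Away, isLocalization_iff]
  refine ⟨?_, ?_, ?_⟩
  · rintro ⟨_, N, rfl⟩
    simp only [hpow]
    refine IsUnit.of_mul_eq_one (⟨AddMonoidAlgebra.single (-natExp (N • outsideExp J)) 1, ?_⟩) ?_
    · classical
      intro u hu i hi
      rw [AddMonoidAlgebra.coeff_single, Finsupp.single_apply] at hu
      have : -natExp (N • outsideExp J) = u := by
        by_contra hne
        exact hu (if_neg hne)
      rw [← this, Pi.neg_apply, (natExp_smul_outsideExp J N i).1 hi, neg_zero]
    · refine Subtype.ext ?_
      rw [halg, Subring.coe_mul, coe_polyToLaurent, AddMonoidAlgebra.mapDomain_single,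
        AddMonoidAlgebra.single_mul_single, add_neg_cancel, mul_one]
      rfl
  · intro z
    obtain ⟨N, hN⟩ : ∃ N : ℕ, ∀ u ∈ z.1.coeff.support, ∀ i, -(u i) ≤ N := by
      -- A crude bound: the sum of the absolute values of all entries of all exponents that occur.
      refine ⟨∑ u ∈ z.1.coeff.support, ∑ i, (u i).natAbs, fun u hu i => ?_⟩
      have h1 : (u i).natAbs ≤ ∑ i, (u i).natAbs :=
        Finset.single_le_sum (f := fun i => (u i).natAbs) (fun _ _ => Nat.zero_le _)
          (Finset.mem_univ i)
      have h2 : ∑ i, (u i).natAbs ≤ ∑ u ∈ z.1.coeff.support, ∑ i, (u i).natAbs :=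
        Finset.single_le_sum (f := fun u : Fin d → ℤ => ∑ i, (u i).natAbs)
          (fun _ _ => Nat.zero_le _) hu
      omega
    have hx : ∀ u, (z * polyToLaurent k J (AddMonoidAlgebra.single (N • outsideExp J) 1)).1.coeff u
        ≠ 0 → ∀ i, 0 ≤ u i := by
      intro u hu i
      rw [Subring.coe_mul, coe_polyToLaurent, AddMonoidAlgebra.mapDomain_single,
        AddMonoidAlgebra.coeff_mul_single_apply, mul_one] at hu
      have h1 := hN _ (Finsupp.mem_support_iff.2 hu) i
      by_cases hi : i ∈ J
      · have h2 := z.2 _ hu i hi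
        have h3 := (natExp_smul_outsideExp J N i).1 hi
        simp only [Pi.add_apply, Pi.neg_apply, h3] at h2
        omega
      · have h3 := (natExp_smul_outsideExp J N i).2 hi
        simp only [Pi.add_apply, Pi.neg_apply, h3] at h1
        omega
    obtain ⟨y, hy⟩ := exists_polyToLaurent k hx
    refine ⟨(y, ⟨_, N, rfl⟩), ?_⟩
    simp only [hpow]
    exact hy.symm
  · intro x y hxy
    exact ⟨1, by rw [polyToLaurent_injective k J hxy]⟩

instance (J : Set (Fin d)) : IsDomain (laurentNonneg k J) := by
  have : IsDomain (AddMonoidAlgebra k (Fin d → ℤ)) := NoZeroDivisors.to_isDomain _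
  infer_instance

instance (J : Set (Fin d)) : UniqueFactorizationMonoid (laurentNonneg k J) :=
  UniqueFactorizationMonoid.of_isLocalization (M := MvPolynomial (Fin d) k)
    (Submonoid.powers (AddMonoidAlgebra.single (outsideExp J) 1)) _

instance (J : Set (Fin d)) : IsNoetherianRing (laurentNonneg k J) :=
  IsLocalization.isNoetherianRing
    (Submonoid.powers (AddMonoidAlgebra.single (outsideExp J) 1 : MvPolynomial (Fin d) k)) _
    inferInstance

end LaurentPolynomials

end

end LogDecay

namespace LogDecay

noncomputable section

set_option linter.unusedSectionVars false

/-! ### Reduction modulo p and multiplicativity of the Gauss norm -/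

section Reduction

variable {p : ℕ} [Fact p.Prime] {k : Type*} [Field k] [CharP k p] [PerfectRing k p]

namespace WittField

open Classical in
/-- The reduction of `x ∈ K` with `|x| ≤ 1` in the residue field `k`, and `0` for other `x`. -/
def residue (x : WittField p k) : k :=
  if h : ‖x‖ ≤ 1 then (exists_lift p k h).choose.coeff 0 else 0

theorem residue_algebraMap (w : WittVector p k) :
    residue (algebraMap (WittVector p k) (WittField p k) w) = w.coeff 0 := by
  have h := norm_algebraMap_le_one p k w
  rw [residue, dif_pos h]
  congr 1
  exact IsFractionRing.injective (WittVector p k) (WittField p k) (exists_lift p k h).choose_spec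

theorem residue_add {x y : WittField p k} (hx : ‖x‖ ≤ 1) (hy : ‖y‖ ≤ 1) :
    residue (x + y) = residue x + residue y := by
  obtain ⟨a, rfl⟩ := exists_lift p k hx
  obtain ⟨b, rfl⟩ := exists_lift p k hy
  rw [← map_add, residue_algebraMap, residue_algebraMap, residue_algebraMap]
  exact map_add (WittVector.constantCoeff (p := p) (R := k)) a b

theorem residue_mul {x y : WittField p k} (hx : ‖x‖ ≤ 1) (hy : ‖y‖ ≤ 1) :
    residue (x * y) = residue x * residue y := by
  obtain ⟨a, rfl⟩ := exists_lift p k hx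
  obtain ⟨b, rfl⟩ := exists_lift p k hy
  rw [← map_mul, residue_algebraMap, residue_algebraMap, residue_algebraMap]
  exact map_mul (WittVector.constantCoeff (p := p) (R := k)) a b

theorem residue_one : residue (1 : WittField p k) = 1 := by
  rw [← map_one (algebraMap (WittVector p k) (WittField p k)), residue_algebraMap]
  exact map_one (WittVector.constantCoeff (p := p) (R := k))

/-- A Witt vector with vanishing zeroth component is V(b). As k is perfect, b = F(c), and V(F(c)) =
p c has norm below 1. -/
theorem residue_eq_zero_iff {x : WittField p k} (hx : ‖x‖ ≤ 1) : residue x = 0 ↔ ‖x‖ < 1 := by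
  obtain ⟨a, rfl⟩ := exists_lift p k hx
  rw [residue_algebraMap]
  constructor
  · intro h
    obtain ⟨b, hb⟩ : ∃ b, a = WittVector.verschiebung b := by
      refine ⟨WittVector.mk p fun n => a.coeff (n + 1), ?_⟩
      ext n
      cases n with
      | zero => rw [h, WittVector.verschiebung_coeff_zero]
      | succ n => rw [WittVector.verschiebung_coeff_succ, WittVector.coeff_mk]
    obtain ⟨c, rfl⟩ := (WittVector.frobenius_bijective p k).2 b
    rw [WittVector.verschiebung_frobenius] at hb
    rw [hb, map_mul, map_natCast, norm_mul]
    exact (mul_le_of_le_one_left (norm_nonneg _) (norm_algebraMap_le_one p k c)).trans_lt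
      norm_p_lt_one
  · intro h
    by_contra h0
    have hu : IsUnit a := WittVector.isUnit_of_coeff_zero_ne_zero a h0
    obtain ⟨u, rfl⟩ := hu
    exact absurd (norm_unit p k u) h.ne

theorem residue_eq_zero_of_lt {x : WittField p k} (hx : ‖x‖ < 1) : residue x = 0 :=
  (residue_eq_zero_iff hx.le).2 hx

theorem residue_frobenius (x : WittField p k) : residue (frobenius p k x) = residue x ^ p := by
  by_cases hx : ‖x‖ ≤ 1
  · obtain ⟨a, rfl⟩ := exists_lift p k hx
    rw [frobenius_algebraMap, residue_algebraMap, residue_algebraMap,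
      WittVector.coeff_frobenius_charP]
  -- Outside the unit ball both residues have the default value 0.
  · have h1 : residue x = 0 := dif_neg hx
    have h2 : residue (frobenius p k x) = 0 := dif_neg (by rwa [norm_frobenius])
    rw [h1, h2, zero_pow (Fact.out : p.Prime).ne_zero]

theorem residue_frobenius_pow (f : ℕ) (x : WittField p k) :
    residue ((frobenius p k ^ f) x) = residue x ^ p ^ f := by
  induction f with
  | zero => rw [pow_zero, pow_zero, pow_one]; rfl
  | succ f ih => rw [pow_succ', RingHom.mul_def, RingHom.comp_apply, residue_frobenius, ih,
      ← pow_mul, pow_succ]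

theorem exists_residue_eq (c : k) : ∃ x : WittField p k, ‖x‖ ≤ 1 ∧ residue x = c :=
  ⟨_, norm_algebraMap_le_one p k (WittVector.teichmuller p c), by
    rw [residue_algebraMap, WittVector.teichmuller_coeff_zero]⟩

theorem residue_zero : residue (0 : WittField p k) = 0 :=
  residue_eq_zero_of_lt (by rw [norm_zero]; exact one_pos)

end WittField

namespace LaurentRing

open RestrictedSeries WittField

variable {d : ℕ}

/-- The reduction of a series with coefficients of absolute value at most `1`. -/
def reduction (x : LaurentRing p k d) : AddMonoidAlgebra k (Fin d → ℤ) :=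
  .ofCoeff (Finsupp.ofSupportFinite (fun u => residue (x.coeff u))
    ((x.finite_le_norm one_pos).subset fun u hu => by
      by_contra h
      exact hu (residue_eq_zero_of_lt (not_le.1 h))))

theorem coeff_reduction (x : LaurentRing p k d) (u : Fin d → ℤ) :
    (reduction x).coeff u = residue (x.coeff u) := rfl

theorem reduction_add {x y : LaurentRing p k d} (hx : ‖x‖ ≤ 1) (hy : ‖y‖ ≤ 1) :
    reduction (x + y) = reduction x + reduction y := by
  refine AddMonoidAlgebra.coeff_injective (Finsupp.ext fun u => ?_)
  rw [AddMonoidAlgebra.coeff_add, Finsupp.add_apply, coeff_reduction, coeff_reduction,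
    coeff_reduction, coeff_add,
    residue_add ((norm_coeff_le _ _).trans hx) ((norm_coeff_le _ _).trans hy)]

theorem reduction_eq_zero_iff {x : LaurentRing p k d} (hx : ‖x‖ ≤ 1) :
    reduction x = 0 ↔ ‖x‖ < 1 := by
  rw [norm_lt_iff, ← AddMonoidAlgebra.coeff_eq_zero, Finsupp.ext_iff]
  exact forall_congr' fun u => residue_eq_zero_iff ((norm_coeff_le _ _).trans hx)

theorem reduction_of_lt {x : LaurentRing p k d} (hx : ‖x‖ < 1) : reduction x = 0 :=
  (reduction_eq_zero_iff hx.le).2 hx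

theorem reduction_monomial (v : Fin d → ℤ) (a : WittField p k) :
    reduction (monomial v a) = AddMonoidAlgebra.single v (residue a) := by
  classical
  refine AddMonoidAlgebra.coeff_injective (Finsupp.ext fun u => ?_)
  rw [coeff_reduction, AddMonoidAlgebra.coeff_single, Finsupp.single_apply, coeff_monomial]
  by_cases h : u = v
  · simp [h]
  · simp [h, Ne.symm h, residue_zero]

theorem coeff_sum {ι : Type*} (s : Finset ι) (g : ι → LaurentRing p k d) (u : Fin d → ℤ) :
    (∑ i ∈ s, g i).coeff u = ∑ i ∈ s, (g i).coeff u := by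
  classical
  induction s using Finset.induction_on with
  | empty => simp
  | insert a s ha ih => rw [Finset.sum_insert ha, Finset.sum_insert ha, coeff_add, ih]

theorem norm_sum_le_one {ι : Type*} (s : Finset ι) (g : ι → LaurentRing p k d)
    (h : ∀ i ∈ s, ‖g i‖ ≤ 1) : ‖∑ i ∈ s, g i‖ ≤ 1 :=
  IsUltrametricDist.norm_sum_le_of_forall_le_of_nonneg zero_le_one h

/-- Only finitely many coefficients have norm 1, so x is a finite sum of integral monomials plus a
series of norm below 1. This reduces identities about reductions to monomials. -/
theorem ball_induction {P : LaurentRing p k d → Prop} (h_small : ∀ x, ‖x‖ < 1 → P x)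
    (h_mono : ∀ v a, ‖a‖ ≤ 1 → P (monomial v a))
    (h_add : ∀ x y, ‖x‖ ≤ 1 → ‖y‖ ≤ 1 → P x → P y → P (x + y)) (x : LaurentRing p k d)
    (hx : ‖x‖ ≤ 1) : P x := by
  classical
  set F := (x.finite_le_norm one_pos).toFinset with hF
  have h1 : ∀ s : Finset (Fin d → ℤ), P (∑ u ∈ s, monomial u (x.coeff u)) ∧
      ‖∑ u ∈ s, (monomial u (x.coeff u) : LaurentRing p k d)‖ ≤ 1 := by
    intro s
    have hm : ∀ u, ‖(monomial u (x.coeff u) : LaurentRing p k d)‖ ≤ 1 := fun u => by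
      rw [norm_monomial]
      exact (norm_coeff_le _ _).trans hx
    refine ⟨?_, norm_sum_le_one _ _ fun u _ => hm u⟩
    induction s using Finset.induction_on with
    | empty => exact h_small _ (by simp)
    | insert a s ha ih =>
      rw [Finset.sum_insert ha]
      exact h_add _ _ (hm a) (norm_sum_le_one _ _ fun u _ => hm u)
        (h_mono _ _ ((norm_coeff_le _ _).trans hx)) ih
  have h2 : ‖x - ∑ u ∈ F, monomial u (x.coeff u)‖ < 1 := by
    refine norm_lt_iff.2 fun u => ?_
    rw [coeff_sub, coeff_sum]
    by_cases hu : u ∈ F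
    · rw [Finset.sum_eq_single u, coeff_monomial, if_pos rfl, sub_self, norm_zero]
      · exact one_pos
      · intro v _ hv
        rw [coeff_monomial, if_neg hv.symm]
      · exact fun h => absurd hu h
    · rw [Finset.sum_eq_zero, sub_zero]
      · simpa [hF] using hu
      · intro v hv
        rw [coeff_monomial, if_neg]
        rintro rfl
        exact hu hv
  rw [← sub_add_cancel x (∑ u ∈ F, monomial u (x.coeff u))]
  exact h_add _ _ h2.le (h1 F).2 (h_small _ h2) (h1 F).1

theorem norm_mul_le_one {x y : LaurentRing p k d} (hx : ‖x‖ ≤ 1) (hy : ‖y‖ ≤ 1) :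
    ‖x * y‖ ≤ 1 :=
  (norm_mul_le x y).trans (mul_le_one₀ hx (norm_nonneg _) hy)

theorem norm_mul_lt_one {x y : LaurentRing p k d} (hx : ‖x‖ < 1) (hy : ‖y‖ ≤ 1) :
    ‖x * y‖ < 1 :=
  (norm_mul_le x y).trans_lt ((mul_le_of_le_one_right (norm_nonneg _) hy).trans_lt hx)

theorem reduction_mul {x y : LaurentRing p k d} (hx : ‖x‖ ≤ 1) (hy : ‖y‖ ≤ 1) :
    reduction (x * y) = reduction x * reduction y := by
  refine ball_induction (P := fun x => reduction (x * y) = reduction x * reduction y)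
    (fun x hx => ?_) (fun v a ha => ?_) (fun x x' hx hx' ih ih' => ?_) x hx
  · rw [reduction_of_lt hx, zero_mul, reduction_of_lt (norm_mul_lt_one hx hy)]
  · have hm : ‖(monomial v a : LaurentRing p k d)‖ ≤ 1 := by rwa [norm_monomial]
    refine ball_induction (P := fun y => reduction (monomial v a * y) =
      reduction (monomial v a) * reduction y)
      (fun y hy => ?_) (fun w b hb => ?_) (fun x x' hx hx' ih ih' => ?_) y hy
    · rw [reduction_of_lt hy, mul_zero, mul_comm, reduction_of_lt (norm_mul_lt_one hy hm)]
    · rw [monomial_mul_monomial, reduction_monomial, reduction_monomial, reduction_monomial,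
        AddMonoidAlgebra.single_mul_single, residue_mul ha hb]
    · rw [mul_add, reduction_add (norm_mul_le_one hm hx) (norm_mul_le_one hm hx'), ih, ih',
        reduction_add hx hx', mul_add]
  · rw [add_mul, reduction_add (norm_mul_le_one hx hy) (norm_mul_le_one hx' hy), ih, ih',
      reduction_add hx hx', add_mul]

theorem reduction_sum {ι : Type*} (s : Finset ι) (g : ι → LaurentRing p k d)
    (h : ∀ i ∈ s, ‖g i‖ ≤ 1) : reduction (∑ i ∈ s, g i) = ∑ i ∈ s, reduction (g i) := by
  classical
  induction s using Finset.induction_on with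
  | empty => exact reduction_of_lt (by simp)
  | insert a s ha ih =>
    rw [Finset.forall_mem_insert] at h
    rw [Finset.sum_insert ha, Finset.sum_insert ha, reduction_add h.1 (norm_sum_le_one s g h.2),
      ih h.2]

instance : CharP (AddMonoidAlgebra k (Fin d → ℤ)) p :=
  charP_of_injective_algebraMap (algebraMap k (AddMonoidAlgebra k (Fin d → ℤ))).injective p

/-- On monomials this is the Frobenius on residues, and the q-th power is additive in characteristic
p. -/
theorem reduction_sigmaPow (f : ℕ) {x : LaurentRing p k d} (hx : ‖x‖ ≤ 1) :
    reduction (sigmaPow p k d f x) = reduction x ^ p ^ f := by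
  refine ball_induction (P := fun x => reduction (sigmaPow p k d f x) = reduction x ^ p ^ f)
    (fun x hx => ?_) (fun v a ha => ?_) (fun x y hx hy ih ih' => ?_) x hx
  · rw [reduction_of_lt hx, reduction_of_lt (by rwa [norm_sigmaPow]),
      zero_pow (pow_f_pos p f).ne']
  · rw [sigmaPow_monomial, reduction_monomial, reduction_monomial, AddMonoidAlgebra.single_pow,
      residue_frobenius_pow]
  · rw [map_add, reduction_add (by rwa [norm_sigmaPow]) (by rwa [norm_sigmaPow]), ih, ih',
      reduction_add hx hy, add_pow_char_pow]

theorem exists_reduction_eq {J : Set (Fin d)} {Q : Subring (LaurentRing p k d)}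
    (hQ : ∀ (v : Fin d → ℤ) (c : WittField p k), (∀ i ∈ J, 0 ≤ v i) → ‖c‖ ≤ 1 →
      monomial v c ∈ Q) {b : AddMonoidAlgebra k (Fin d → ℤ)} (hb : b ∈ laurentNonneg k J) :
    ∃ s ∈ Q, ‖s‖ ≤ 1 ∧ reduction s = b := by
  choose l hl hl' using (exists_residue_eq (p := p) (k := k))
  have hm : ∀ u, ‖(monomial u (l (b.coeff u)) : LaurentRing p k d)‖ ≤ 1 := fun u => by
    rw [norm_monomial]
    exact hl _
  refine ⟨∑ u ∈ b.coeff.support, monomial u (l (b.coeff u)), sum_mem fun u hu => ?_,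
    norm_sum_le_one _ _ fun u _ => hm u, ?_⟩
  · exact hQ _ _ (hb u (Finsupp.mem_support_iff.1 hu)) (hl _)
  · rw [reduction_sum _ _ fun u _ => hm u]
    simp only [reduction_monomial, hl']
    exact AddMonoidAlgebra.sum_coeff_single b

/-- The two reductions are nonzero and Laurent polynomials over a field form a domain, so the
reduction of the product does not vanish. -/
theorem norm_mul_of_norm_one {x y : LaurentRing p k d} (hx : ‖x‖ = 1) (hy : ‖y‖ = 1) :
    ‖x * y‖ = 1 := by
  refine le_antisymm (norm_mul_le_one hx.le hy.le) ?_
  by_contra h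
  have h1 := (reduction_eq_zero_iff (norm_mul_le_one hx.le hy.le)).2 (not_le.1 h)
  rw [reduction_mul hx.le hy.le] at h1
  rcases mul_eq_zero.1 h1 with h1 | h1
  · exact absurd ((reduction_eq_zero_iff hx.le).1 h1) hx.not_lt
  · exact absurd ((reduction_eq_zero_iff hy.le).1 h1) hy.not_lt

/-- The Gauss norm is multiplicative. -/
instance : NormMulClass (LaurentRing p k d) where
  norm_mul x y := by
    rcases eq_or_ne x 0 with rfl | hx
    · simp
    rcases eq_or_ne y 0 with rfl | hy
    · simp
    obtain ⟨c, hc, hx1⟩ := exists_norm_smul_eq_one hx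
    obtain ⟨e, he, hy1⟩ := exists_norm_smul_eq_one hy
    have h := norm_mul_of_norm_one hx1 hy1
    rw [smul_mul_smul_comm, norm_smul', ← zpow_add₀ (WittField.p_ne_zero p k), ← neg_add,
      zpow_neg, norm_inv] at h
    rw [hc, he, ← norm_mul, ← zpow_add₀ (WittField.p_ne_zero p k)]
    have h0 : ‖(p : WittField p k) ^ (c + e)‖ ≠ 0 :=
      norm_ne_zero_iff.2 (zpow_ne_zero _ (WittField.p_ne_zero p k))
    field_simp at h
    exact h

instance : Nontrivial (LaurentRing p k d) :=
  ⟨0, 1, fun h => by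
    have := congrArg norm h
    rw [norm_zero, norm_one] at this
    exact zero_ne_one this⟩

instance : NoZeroDivisors (LaurentRing p k d) where
  eq_zero_or_eq_zero_of_mul_eq_zero {x y} h := by
    rw [← norm_eq_zero, norm_mul, mul_eq_zero, norm_eq_zero, norm_eq_zero] at h
    exact h

instance : IsDomain (LaurentRing p k d) := NoZeroDivisors.to_isDomain _

end LaurentRing

end Reduction

end

end LogDecay

namespace LogDecay

noncomputable section

set_option linter.unusedSectionVars false

/-! ### Generators of lattices modulo p and their lifting -/

section Lattices

variable {p : ℕ} [Fact p.Prime] {k : Type*} [Field k] [CharP k p] [PerfectRing k p]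

namespace LaurentRing

open RestrictedSeries WittField

variable {d : ℕ}

theorem reduction_mem_laurentNonneg {J : Set (Fin d)} {x : LaurentRing p k d}
    (hx : x ∈ (nonnegOn p k J).toSubring) : reduction x ∈ laurentNonneg k J := by
  intro u hu i hi
  refine hx u (fun h => hu ?_) i hi
  rw [coeff_reduction, h, residue_zero]

/-- A lattice `L` whose Frobenius pullback is proportional to `L` is generated by one element
modulo `p`. -/
theorem exists_generator_mod_p {J : Set (Fin d)} {Q : Subring (LaurentRing p k d)}
    (hQm : ∀ (v : Fin d → ℤ) (c : WittField p k), (∀ i ∈ J, 0 ≤ v i) → ‖c‖ ≤ 1 →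
      monomial v c ∈ Q) {L : AddSubgroup (LaurentRing p k d)} (hL1 : ∀ x ∈ L, ‖x‖ ≤ 1)
    (hLJ : ∀ x ∈ L, x ∈ (nonnegOn p k J).toSubring) (hQL : ∀ s ∈ Q, ∀ x ∈ L, s * x ∈ L)
    (hsat : ∀ x ∈ L, ‖x‖ < 1 → (p : WittField p k)⁻¹ • x ∈ L) {f : ℕ} (hf : 0 < f)
    {a b : LaurentRing p k d} (ha : ‖a‖ = 1) (hb : ‖b‖ = 1)
    (haJ : a ∈ (nonnegOn p k J).toSubring) (hbJ : b ∈ (nonnegOn p k J).toSubring)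
    (h1 : ∀ x ∈ L, ∃ y : (Fin d → Fin (p ^ f)) → LaurentRing p k d, (∀ α, y α ∈ L) ∧
      b * x = a * ∑ α, monomial (boxExp α) 1 * sigmaPow p k d f (y α))
    (h2 : ∀ y ∈ L, ∃ x ∈ L, b * x = a * sigmaPow p k d f y) :
    ∃ e ∈ L, ∀ x ∈ L, ∃ s ∈ Q, ∃ x' ∈ L, x = s * e + (p : WittField p k) • x' := by
  -- The reduction of L is an ideal because every element of `laurentNonneg k J` lifts to Q. Since
  -- σ^f reduces to the q-th power, `h1` and `h2` become the proportionality of I with its Frobenius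
  -- power.
  let I : Ideal (laurentNonneg k J) :=
    { carrier := {z | ∃ x ∈ L, reduction x = z.1}
      zero_mem' := ⟨0, L.zero_mem, reduction_of_lt (by simp)⟩
      add_mem' := by
        rintro z w ⟨x, hx, hxz⟩ ⟨y, hy, hyw⟩
        exact ⟨x + y, L.add_mem hx hy, by
          rw [reduction_add (hL1 x hx) (hL1 y hy), hxz, hyw]; rfl⟩
      smul_mem' := by
        rintro c z ⟨x, hx, hxz⟩
        obtain ⟨s, hs, hs1, hsc⟩ := exists_reduction_eq hQm c.2
        exact ⟨s * x, hQL s hs x hx, by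
          rw [reduction_mul hs1 (hL1 x hx), hxz, hsc]; rfl⟩ }
  have memI : ∀ z, z ∈ I ↔ ∃ x ∈ L, reduction x = z.1 := fun z => Iff.rfl
  have hne : ∀ c : LaurentRing p k d, ‖c‖ = 1 → reduction c ≠ 0 := fun c hc h0 =>
    ((reduction_eq_zero_iff hc.le).1 h0).ne hc
  have hsig : ∀ y ∈ L, ‖sigmaPow p k d f y‖ ≤ 1 := fun y hy => by
    rw [norm_sigmaPow]; exact hL1 y hy
  have hmn : ∀ α : Fin d → Fin (p ^ f), ‖(monomial (boxExp α) 1 : LaurentRing p k d)‖ ≤ 1 :=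
    fun α => by rw [norm_monomial, norm_one]
  have hbox : ∀ α : Fin d → Fin (p ^ f),
      AddMonoidAlgebra.single (boxExp α) (1 : k) ∈ laurentNonneg k J := by
    classical
    intro α u hu i _
    rw [AddMonoidAlgebra.coeff_single, Finsupp.single_apply] at hu
    have : boxExp α = u := by
      by_contra hne
      exact hu (if_neg hne)
    rw [← this]
    exact Int.natCast_nonneg _
  obtain ⟨g, ⟨e, he, heg⟩, hg⟩ := exists_generator_of_proportional_pow (I := I)
    (q := p ^ f) (a := ⟨_, reduction_mem_laurentNonneg haJ⟩)
    (b := ⟨_, reduction_mem_laurentNonneg hbJ⟩)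
    ((Fact.out : p.Prime).two_le.trans (Nat.le_self_pow hf.ne' p))
    (fun h => hne a ha (congrArg Subtype.val h)) (fun h => hne b hb (congrArg Subtype.val h)) (by
      rintro z ⟨x, hx, hxz⟩
      obtain ⟨y, hy, hxy⟩ := h1 x hx
      refine ⟨∑ α, ⟨AddMonoidAlgebra.single (boxExp α) 1, hbox α⟩ *
        (⟨_, reduction_mem_laurentNonneg (hLJ _ (hy α))⟩ : laurentNonneg k J) ^ p ^ f,
        sum_mem fun α _ => Ideal.mul_mem_left _ _ (Ideal.subset_span ⟨_, ⟨y α, hy α, rfl⟩, rfl⟩),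
        Subtype.ext ?_⟩
      have h := congrArg reduction hxy
      rw [reduction_mul hb.le (hL1 x hx), hxz, reduction_mul ha.le (norm_sum_le_one _ _ fun α _ =>
        norm_mul_le_one (hmn α) (hsig _ (hy α))), reduction_sum _ _ fun α _ =>
        norm_mul_le_one (hmn α) (hsig _ (hy α))] at h
      refine h.trans ?_
      change _ = reduction a * (laurentNonneg k J).subtype _
      rw [map_sum]
      congr 1
      refine Finset.sum_congr rfl fun α _ => ?_
      rw [map_mul, map_pow]
      change _ = AddMonoidAlgebra.single (boxExp α) 1 * reduction (y α) ^ p ^ f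
      rw [reduction_mul (hmn α) (hsig _ (hy α)), reduction_monomial, residue_one,
          reduction_sigmaPow f (hL1 _ (hy α))])
    (by
      rintro z ⟨y, hy, hyz⟩
      obtain ⟨x, hx, hxy⟩ := h2 y hy
      refine ⟨⟨_, reduction_mem_laurentNonneg (hLJ x hx)⟩, ⟨x, hx, rfl⟩, Subtype.ext ?_⟩
      have h := congrArg reduction hxy
      rw [reduction_mul hb.le (hL1 x hx), reduction_mul ha.le (hsig y hy),
        reduction_sigmaPow f (hL1 y hy), hyz] at h
      exact h)
  refine ⟨e, he, fun x hx => ?_⟩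
  obtain ⟨c, hc⟩ := hg ⟨_, reduction_mem_laurentNonneg (hLJ x hx)⟩ ⟨x, hx, rfl⟩
  obtain ⟨s, hs, hs1, hsc⟩ := exists_reduction_eq hQm c.2
  have hse : s * e ∈ L := hQL s hs e he
  -- Equality of reductions means that the difference is small, and `hsat` then permits division by
  -- p inside L.
  have h0 : ‖x - s * e‖ < 1 := by
    refine (reduction_eq_zero_iff (hL1 _ (L.sub_mem hx hse))).1 ?_
    have h3 : reduction x = reduction (s * e) := by
      rw [reduction_mul hs1 (hL1 e he), hsc, heg]
      exact congrArg Subtype.val hc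
    have h4 := reduction_add (hL1 _ (L.sub_mem hx hse)) (hL1 _ hse)
    rw [sub_add_cancel, h3] at h4
    exact left_eq_add.1 (by rw [add_comm] at h4; exact h4)
  refine ⟨s, hs, _, hsat _ (L.sub_mem hx hse) h0, ?_⟩
  rw [smul_smul, mul_inv_cancel₀ (WittField.p_ne_zero p k), one_smul, add_sub_cancel]

/-- If `L ⊆ Q e + p L` with a closed ring `Q` in the unit ball then `L ⊆ Q e`. -/
theorem exists_mul_eq_of_isClosed {Q : Subring (LaurentRing p k d)}
    (hQ1 : ∀ s ∈ Q, ‖s‖ ≤ 1) (hQc : IsClosed (Q : Set (LaurentRing p k d)))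
    {L : AddSubgroup (LaurentRing p k d)} (hL1 : ∀ x ∈ L, ‖x‖ ≤ 1) {e : LaurentRing p k d}
    (he : ∀ x ∈ L, ∃ s ∈ Q, ∃ x' ∈ L, x = s * e + (p : WittField p k) • x')
    {x : LaurentRing p k d} (hx : x ∈ L) : ∃ s ∈ Q, x = s * e := by
  choose! s hs x' hx' h using he
  -- Iterating the remainder gives x = (∑_{i<n} p^i s(z_i)) e + p^n z_n. The partial sums lie in Q
  -- and converge, and Q is closed.
  set z : ℕ → LaurentRing p k d := fun n => x'^[n] x with hz
  have hzL : ∀ n, z n ∈ L := by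
    intro n
    induction n with
    | zero => exact hx
    | succ n ih => rw [hz]; simp only [Function.iterate_succ_apply']; exact hx' _ ih
  have hzs : ∀ n, z n = s (z n) * e + (p : WittField p k) • z (n + 1) := by
    intro n
    have h3 := h _ (hzL n)
    rwa [show x' (z n) = z (n + 1) from (Function.iterate_succ_apply' x' n x).symm] at h3
  set t : ℕ → LaurentRing p k d := fun n => ∑ i ∈ Finset.range n, (p : LaurentRing p k d) ^ i * s (z i)
    with ht
  have hps : ∀ y : LaurentRing p k d, (p : WittField p k) • y = (p : LaurentRing p k d) * y := by
    intro y
    rw [Algebra.smul_def, map_natCast]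
  have hpn : ‖(p : LaurentRing p k d)‖ = ‖(p : WittField p k)‖ := by
    have := norm_smul' (p : WittField p k) (1 : LaurentRing p k d)
    rwa [hps, mul_one, norm_one, mul_one] at this
  have hp1 : ‖(p : LaurentRing p k d)‖ < 1 := hpn ▸ norm_p_lt_one
  have hpQ : (p : LaurentRing p k d) ∈ Q := natCast_mem Q p
  have htQ : ∀ n, t n ∈ Q := fun n =>
    sum_mem fun i _ => Q.mul_mem (Q.pow_mem hpQ i) (hs _ (hzL i))
  have hpart : ∀ n, x = t n * e + (p : LaurentRing p k d) ^ n * z n := by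
    intro n
    induction n with
    | zero => simp [ht, hz]
    | succ n ih =>
      rw [ih]
      have h3 := hzs n
      rw [hps] at h3
      rw [ht]
      simp only [Finset.sum_range_succ]
      rw [h3]
      have h4 := hzs n
      rw [hps] at h4
      rw [← h4, pow_succ]
      linear_combination (p : LaurentRing p k d) ^ n * h4
  have hsum : Summable fun i => (p : LaurentRing p k d) ^ i * s (z i) := by
    refine Summable.of_norm_bounded (summable_geometric_of_lt_one (norm_nonneg _) hp1) fun i => ?_
    rw [norm_mul, norm_pow]
    exact mul_le_of_le_one_right (by positivity) (hQ1 _ (hs _ (hzL i)))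
  have hlim := hsum.hasSum.tendsto_sum_nat
  refine ⟨_, hQc.mem_of_tendsto hlim (Eventually.of_forall htQ), ?_⟩
  have h5 : Tendsto (fun n => x - (p : LaurentRing p k d) ^ n * z n) atTop (𝓝 (x - 0)) := by
    refine tendsto_const_nhds.sub ?_
    refine squeeze_zero_norm (fun n => ?_) (tendsto_pow_atTop_nhds_zero_of_lt_one
      (norm_nonneg (p : LaurentRing p k d)) hp1)
    rw [norm_mul, norm_pow]
    exact mul_le_of_le_one_right (by positivity) (hL1 _ (hzL n))
  have h6 : Tendsto (fun n => x - (p : LaurentRing p k d) ^ n * z n) atTop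
      (𝓝 ((∑' i, (p : LaurentRing p k d) ^ i * s (z i)) * e)) := by
    refine (hlim.mul_const e).congr fun n => ?_
    rw [eq_sub_iff_add_eq]
    exact (hpart n).symm
  rw [← tendsto_nhds_unique h5 h6, sub_zero]

end LaurentRing

end Lattices

end

end LogDecay

namespace LogDecay

noncomputable section

set_option linter.unusedSectionVars false

/-! ### Estimates for log-decay -/

section Decay

variable {p : ℕ} [Fact p.Prime] {k : Type*} [Field k] [CharP k p] [PerfectRing k p]

open RestrictedSeries

theorem isClosed_nonnegOn {d : ℕ} (J : Set (Fin d)) :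
    IsClosed ((nonnegOn p k J).toSubring : Set (LaurentRing p k d)) := by
  have : ((nonnegOn p k J).toSubring : Set (LaurentRing p k d)) =
      ⋂ (u : Fin d → ℤ) (_ : ¬ ∀ i ∈ J, 0 ≤ u i), {x | x.coeff u = 0} := by
    ext x
    simp only [Set.mem_iInter, Set.mem_ofPred_eq]
    constructor
    · intro h u hu
      by_contra h0
      exact hu (h u h0)
    · intro h u hu
      by_contra h0
      exact hu (h u h0)
  rw [this]
  exact isClosed_iInter fun u => isClosed_iInter fun _ =>
    isClosed_eq (continuous_coeff u) continuous_const

/-- The inverse of a principal unit. -/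
theorem exists_inverse_of_norm_sub_one_lt {d : ℕ} {x : LaurentRing p k d} (hx : ‖x - 1‖ < 1) :
    ∃ y, x * y = 1 ∧ ‖y‖ ≤ 1 ∧ ∀ J : Set (Fin d), x ∈ (nonnegOn p k J).toSubring →
      y ∈ (nonnegOn p k J).toSubring := by
  have h1 : ‖1 - x‖ < 1 := by rwa [norm_sub_rev]
  have hs : Summable fun n : ℕ => (1 - x) ^ n := summable_geometric_of_norm_lt_one h1
  have hle : ∀ n : ℕ, ‖(1 - x) ^ n‖ ≤ 1 := fun n => by
    rw [norm_pow]
    exact pow_le_one₀ (norm_nonneg _) h1.le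
  refine ⟨∑' n : ℕ, (1 - x) ^ n, ?_, ?_, fun J hJ => ?_⟩
  · have := mul_neg_geom_series (1 - x) h1
    rwa [sub_sub_cancel] at this
  · exact IsUltrametricDist.norm_tsum_le_of_forall_le_of_nonneg zero_le_one hle
  · refine (isClosed_nonnegOn J).mem_of_tendsto hs.hasSum.tendsto_sum_nat
      (Eventually.of_forall fun n => ?_)
    exact sum_mem fun i _ => pow_mem (sub_mem (one_mem _) hJ) i

/-- The estimate `-v_i |x_v|^r ≤ C` for all exponents `v` and all `i < n`. -/
def DecayBound {d : ℕ} (n : ℕ) (r C : ℝ) (x : LaurentRing p k d) : Prop :=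
  ∀ v, x.coeff v ≠ 0 → ∀ i : Fin d, (i : ℕ) < n → -((v i : ℤ) : ℝ) * ‖x.coeff v‖ ^ r ≤ C

/-- If |x_v| = p^(-j) then p^(rj) = |x_v|^(-r), so the condition on w_j becomes a single bound on
-v_i |x_v|^r. This form is adapted to products and to contraction arguments. -/
theorem hasLogDecay_iff {n m : ℕ} {r : ℝ} (hr : 0 ≤ r) {x : LaurentRing p k (n + m)} :
    HasLogDecay n m r x ↔ ∃ C, 0 ≤ C ∧ DecayBound n r C x := by
  have hp0 := cast_p_pos p
  constructor
  · rintro ⟨c, hc, h⟩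
    have hall : ∀ᶠ j : ℕ in atTop, ∀ i : Fin (n + m), (i : ℕ) < n →
        ((-(c * (p : ℝ) ^ (r * (j : ℝ))) : ℝ) : EReal) ≤ partialValuation i j x := by
      rw [Filter.eventually_all]
      intro i
      by_cases hi : (i : ℕ) < n
      · filter_upwards [h i hi] with j hj _ using hj
      · exact Eventually.of_forall fun j hi' => absurd hi' hi
    obtain ⟨N, hN⟩ := eventually_atTop.1 hall
    have e1 := p_rpow_pos p (r * N)
    have e2 : 0 ≤ ‖x‖ ^ r := Real.rpow_nonneg (norm_nonneg _) r
    -- The summand c serves coefficients with |x_v| = p^(-e), e ≥ N. The second one serves the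
    -- larger coefficients, for which the bound on w_N is used together with |x_v|^r ≤ ‖x‖^r.
    refine ⟨c + c * ((p : ℝ) ^ (r * (N : ℝ)) * ‖x‖ ^ r), by positivity, fun v hv i hi => ?_⟩
    have key : ∀ j : ℕ, N ≤ j → ((p : ℝ)⁻¹) ^ j ≤ ‖x.coeff v‖ →
        -((v i : ℤ) : ℝ) * ‖x.coeff v‖ ^ r ≤ c * ((p : ℝ) ^ (r * (j : ℝ)) * ‖x.coeff v‖ ^ r) := by
      intro j hj hjv
      have h1 := le_partialValuation_iff.1 (hN j hj i hi) v hjv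
      rw [← mul_assoc]
      exact mul_le_mul_of_nonneg_right (by linarith) (Real.rpow_nonneg (norm_nonneg _) r)
    obtain ⟨e, he⟩ := WittField.exists_norm_eq_zpow hv
    rw [norm_zpow, WittField.norm_p] at he
    by_cases hNe : (N : ℤ) ≤ e
    · lift e to ℕ using (Int.natCast_nonneg N).trans hNe
      rw [zpow_natCast] at he
      have h2 := key e (by exact_mod_cast hNe) he.ge
      have h3 : (p : ℝ) ^ (r * (e : ℝ)) * ‖x.coeff v‖ ^ r = 1 := by
        rw [he, ← Real.rpow_natCast, ← Real.rpow_mul (by positivity), Real.inv_rpow hp0.le,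
          mul_comm (e : ℝ) r]
        exact mul_inv_cancel₀ (p_rpow_pos p _).ne'
      rw [h3, mul_one] at h2
      have : 0 ≤ c * ((p : ℝ) ^ (r * (N : ℝ)) * ‖x‖ ^ r) := by positivity
      linarith
    · have h2 := key N le_rfl (by
        rw [he, ← zpow_natCast]
        exact zpow_le_zpow_right_of_le_one₀ (by positivity)
          (inv_le_one_of_one_le₀ (one_lt_cast_p p).le) (not_le.1 hNe).le)
      have h3 : ‖x.coeff v‖ ^ r ≤ ‖x‖ ^ r :=
        Real.rpow_le_rpow (norm_nonneg _) (norm_coeff_le _ _) hr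
      have h4 : c * ((p : ℝ) ^ (r * (N : ℝ)) * ‖x.coeff v‖ ^ r) ≤
          c * ((p : ℝ) ^ (r * (N : ℝ)) * ‖x‖ ^ r) := by gcongr
      linarith
  · rintro ⟨C, hC, h⟩
    -- C may be 0, whereas the constant in `HasLogDecay` has to be positive.
    refine ⟨C + 1, by positivity, fun i hi => Eventually.of_forall fun j =>
      le_partialValuation_iff.2 fun v hv => ?_⟩
    have h0 : x.coeff v ≠ 0 := norm_pos_iff.1 ((p_inv_pow_pos p j).trans_le hv)
    have h1 := h v h0 i hi
    have e1 := p_rpow_pos p (r * j)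
    rcases le_or_gt 0 (-((v i : ℤ) : ℝ)) with hneg | hpos
    · have h2 : (((p : ℝ)⁻¹) ^ j) ^ r ≤ ‖x.coeff v‖ ^ r := Real.rpow_le_rpow (by positivity) hv hr
      have h3 : (((p : ℝ)⁻¹) ^ j) ^ r = ((p : ℝ) ^ (r * (j : ℝ)))⁻¹ := by
        rw [← Real.rpow_natCast, ← Real.rpow_mul (by positivity), Real.inv_rpow hp0.le,
          mul_comm (j : ℝ) r]
      rw [h3] at h2
      have h4 := (mul_le_mul_of_nonneg_left h2 hneg).trans h1
      rw [← div_eq_mul_inv, div_le_iff₀ e1] at h4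
      linarith
    · have : 0 ≤ (C + 1) * (p : ℝ) ^ (r * (j : ℝ)) := by positivity
      linarith

/-- A bound for the decay of a series whose decay at any exponent is controlled, with a factor
`θ < 1`, by that at some exponent with a larger coefficient. -/
theorem decayBound_of_contraction {d n : ℕ} {r C θ : ℝ} (hC : 0 ≤ C) (hθ0 : 0 ≤ θ) (hθ : θ < 1)
    {y : LaurentRing p k d}
    (h : ∀ v, y.coeff v ≠ 0 → ∀ i : Fin d, (i : ℕ) < n → v i < 0 → ∃ v', y.coeff v' ≠ 0 ∧
      ‖y.coeff v‖ ≤ ‖y.coeff v'‖ ∧ -((v i : ℤ) : ℝ) * ‖y.coeff v‖ ^ r ≤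
        C + θ * max 0 (-((v' i : ℤ) : ℝ) * ‖y.coeff v'‖ ^ r)) :
    DecayBound n r (C / (1 - θ)) y := by
  intro v hv i hi
  -- Only finitely many exponents u have |y_u| ≥ |y_v|, and the passage to v' in the hypothesis
  -- stays among them. The maximum m of the decay over this finite set satisfies m ≤ C + θ m.
  have hfin := y.finite_le_norm (norm_pos_iff.2 hv)
  obtain ⟨u, hu, hmax⟩ := hfin.toFinset.exists_max_image
    (fun u => max 0 (-((u i : ℤ) : ℝ) * ‖y.coeff u‖ ^ r)) ⟨v, by simp⟩
  simp only [Set.Finite.mem_toFinset, Set.mem_ofPred_eq] at hu hmax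
  have h1 : 0 < 1 - θ := by linarith
  refine (le_max_right 0 _).trans ((hmax v le_rfl).trans ?_)
  rcases le_or_gt 0 (u i) with hui | hui
  · have h2 : -((u i : ℤ) : ℝ) * ‖y.coeff u‖ ^ r ≤ 0 :=
      mul_nonpos_of_nonpos_of_nonneg (by simpa using hui) (Real.rpow_nonneg (norm_nonneg _) r)
    rw [max_eq_left h2]
    positivity
  · have hu0 : y.coeff u ≠ 0 := norm_pos_iff.1 ((norm_pos_iff.2 hv).trans_le hu)
    obtain ⟨w, -, hw, hle⟩ := h u hu0 i hi hui
    have h3 := hmax w (hu.trans hw)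
    rw [le_div_iff₀ h1]
    have h4 := mul_le_mul_of_nonneg_left h3 hθ0
    have h5 : max 0 (-((u i : ℤ) : ℝ) * ‖y.coeff u‖ ^ r) ≤
        C + θ * max 0 (-((u i : ℤ) : ℝ) * ‖y.coeff u‖ ^ r) := by
      refine max_le ?_ (hle.trans (by linarith))
      have : 0 ≤ θ * max 0 (-((u i : ℤ) : ℝ) * ‖y.coeff u‖ ^ r) :=
        mul_nonneg hθ0 (le_max_left _ _)
      linarith
    linarith

/-- The decay of a product at one exponent. -/
theorem exists_decay_mul_le {d n : ℕ} {r C : ℝ} (hr : 0 ≤ r) (hC : 0 ≤ C)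
    {x y : LaurentRing p k d} (hx : DecayBound n r C x) (hx1 : ‖x‖ ≤ 1) {u : Fin d → ℤ}
    (hu : (x * y).coeff u ≠ 0) {i : Fin d} (hi : (i : ℕ) < n) (hui : u i < 0) :
    ∃ w, y.coeff w ≠ 0 ∧ ‖(x * y).coeff u‖ ≤ ‖y.coeff w‖ ∧
      -((u i : ℤ) : ℝ) * ‖(x * y).coeff u‖ ^ r ≤
        C * ‖y‖ ^ r + ‖x‖ ^ r * max 0 (-((w i : ℤ) : ℝ) * ‖y.coeff w‖ ^ r) := by
  obtain ⟨v, w, rfl, hv, hw, hle⟩ := exists_norm_coeff_mul_le hu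
  have hvx := norm_coeff_le x v
  refine ⟨w, hw, hle.trans (mul_le_of_le_one_left (norm_nonneg _) (hvx.trans hx1)), ?_⟩
  have e1 : 0 ≤ ‖x.coeff v‖ ^ r := Real.rpow_nonneg (norm_nonneg _) r
  have e2 : 0 ≤ ‖y.coeff w‖ ^ r := Real.rpow_nonneg (norm_nonneg _) r
  have e3 : ‖x.coeff v‖ ^ r ≤ ‖x‖ ^ r := Real.rpow_le_rpow (norm_nonneg _) hvx hr
  have e4 : ‖y.coeff w‖ ^ r ≤ ‖y‖ ^ r := Real.rpow_le_rpow (norm_nonneg _) (norm_coeff_le _ _) hr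
  have hneg : (0 : ℝ) ≤ -(((v + w) i : ℤ) : ℝ) := by
    have : (((v + w) i : ℤ) : ℝ) < 0 := by exact_mod_cast hui
    linarith
  calc -(((v + w) i : ℤ) : ℝ) * ‖(x * y).coeff (v + w)‖ ^ r
      ≤ -(((v + w) i : ℤ) : ℝ) * (‖x.coeff v‖ ^ r * ‖y.coeff w‖ ^ r) := by
        rw [← Real.mul_rpow (norm_nonneg _) (norm_nonneg _)]
        exact mul_le_mul_of_nonneg_left (Real.rpow_le_rpow (norm_nonneg _) hle hr) hneg
    _ = (-((v i : ℤ) : ℝ) * ‖x.coeff v‖ ^ r) * ‖y.coeff w‖ ^ r +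
          ‖x.coeff v‖ ^ r * (-((w i : ℤ) : ℝ) * ‖y.coeff w‖ ^ r) := by
        rw [Pi.add_apply]; push_cast; ring
    _ ≤ C * ‖y‖ ^ r + ‖x‖ ^ r * max 0 (-((w i : ℤ) : ℝ) * ‖y.coeff w‖ ^ r) := by
        have h1 : (-((v i : ℤ) : ℝ) * ‖x.coeff v‖ ^ r) * ‖y.coeff w‖ ^ r ≤ C * ‖y‖ ^ r :=
          (mul_le_mul_of_nonneg_right (hx v hv i hi) e2).trans
            (mul_le_mul_of_nonneg_left e4 hC)
        have h2 : ‖x.coeff v‖ ^ r * (-((w i : ℤ) : ℝ) * ‖y.coeff w‖ ^ r) ≤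
            ‖x‖ ^ r * max 0 (-((w i : ℤ) : ℝ) * ‖y.coeff w‖ ^ r) :=
          (mul_le_mul_of_nonneg_left (le_max_right _ _) e1).trans
            (mul_le_mul_of_nonneg_right e3 (le_max_left _ _))
        exact add_le_add h1 h2

/-- From y = 1 + (1 - x) y the decay of y is controlled by itself with the factor ‖1 - x‖^r. This is
below 1 because r > 0. -/
theorem hasLogDecay_inverse {n m : ℕ} {r : ℝ} (hr : 0 < r) {x y : LaurentRing p k (n + m)}
    (hx : HasLogDecay n m r x) (hx1 : ‖x - 1‖ < 1) (hxy : x * y = 1) :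
    HasLogDecay n m r y := by
  have h1 : HasLogDecay n m r (1 - x) := by
    rw [sub_eq_add_neg]
    exact (logDecayRing p k n m r).one_mem.2.add hx.neg
  have hx1' : ‖1 - x‖ < 1 := by rwa [norm_sub_rev]
  obtain ⟨C, hC, hb⟩ := (hasLogDecay_iff hr.le).1 h1
  rw [hasLogDecay_iff hr.le]
  have hy : y = 1 + (1 - x) * y := by rw [sub_mul, hxy]; ring
  have hθ : ‖1 - x‖ ^ r < 1 := Real.rpow_lt_one (norm_nonneg _) hx1' hr
  have hθ0 : 0 ≤ ‖1 - x‖ ^ r := Real.rpow_nonneg (norm_nonneg _) r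
  have hC' : 0 ≤ C * ‖y‖ ^ r := mul_nonneg hC (Real.rpow_nonneg (norm_nonneg _) r)
  refine ⟨C * ‖y‖ ^ r / (1 - ‖1 - x‖ ^ r), div_nonneg hC' (by linarith),
    decayBound_of_contraction hC' hθ0 hθ ?_⟩
  intro v hv i hi hvi
  have hc : y.coeff v = ((1 - x) * y).coeff v := by
    conv_lhs => rw [hy]
    rw [coeff_add, coeff_one, if_neg, zero_add]
    rintro rfl
    exact absurd hvi (lt_irrefl _)
  rw [hc] at hv ⊢
  exact exists_decay_mul_le hr.le hC hb hx1'.le hv hi hvi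

/-- Passing to σ^f(y) multiplies exponents by q and preserves absolute values. The product estimate
at q v thus bounds q times the decay of y at v, a contraction with factor 1/q. Unlike for inverses,
r = 0 is allowed. -/
theorem hasLogDecay_of_sigmaPow_eq {n m : ℕ} {r : ℝ} (hr : 0 ≤ r) {f : ℕ} (hf : 0 < f)
    {x y : LaurentRing p k (n + m)} (hx : HasLogDecay n m r x) (hx1 : ‖x‖ ≤ 1)
    (h : LaurentRing.sigmaPow p k (n + m) f y = x * y) : HasLogDecay n m r y := by
  obtain ⟨C, hC, hb⟩ := (hasLogDecay_iff hr).1 hx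
  rw [hasLogDecay_iff hr]
  have hq : (1 : ℝ) < ((p ^ f : ℕ) : ℝ) := by
    exact_mod_cast Nat.one_lt_pow hf.ne' (Fact.out : p.Prime).one_lt
  have hq0 : (0 : ℝ) < ((p ^ f : ℕ) : ℝ) := one_pos.trans hq
  have hC' : 0 ≤ (((p ^ f : ℕ) : ℝ))⁻¹ * (C * ‖y‖ ^ r) :=
    mul_nonneg (inv_nonneg.2 hq0.le) (mul_nonneg hC (Real.rpow_nonneg (norm_nonneg _) r))
  have hθ := inv_lt_one_of_one_lt₀ hq
  refine ⟨_, div_nonneg hC' (by linarith : 0 ≤ 1 - (((p ^ f : ℕ) : ℝ))⁻¹),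
    decayBound_of_contraction hC' (inv_nonneg.2 hq0.le) hθ ?_⟩
  intro v hv i hi hvi
  have hn : ‖(x * y).coeff (p ^ f • v)‖ = ‖y.coeff v‖ := by
    rw [← h, LaurentRing.coeff_sigmaPow, WittField.norm_frobenius_pow]
  have hqi : (p ^ f • v) i < 0 := by
    rw [LaurentRing.natSmul_apply]
    exact mul_neg_of_pos_of_neg (by exact_mod_cast pow_f_pos p f) hvi
  obtain ⟨w, hw, hle, hd⟩ := exists_decay_mul_le hr hC hb hx1 (u := p ^ f • v)
    (by rw [← norm_ne_zero_iff, hn]; exact norm_ne_zero_iff.2 hv) hi hqi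
  rw [hn] at hle hd
  refine ⟨w, hw, hle, ?_⟩
  have h1 : ‖x‖ ^ r * max 0 (-((w i : ℤ) : ℝ) * ‖y.coeff w‖ ^ r) ≤
      max 0 (-((w i : ℤ) : ℝ) * ‖y.coeff w‖ ^ r) :=
    mul_le_of_le_one_left (le_max_left _ _) (Real.rpow_le_one (norm_nonneg _) hx1 hr)
  rw [LaurentRing.natSmul_apply] at hd
  rw [← mul_add, inv_mul_eq_div, le_div_iff₀ hq0]
  push_cast at hd ⊢
  linarith

/-- Principal units of `𝒜^r` for `r > 0`. -/
theorem exists_inverse_mem_logDecayRing {n m : ℕ} {r : ℝ} (hr : 0 < r)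
    {x : LaurentRing p k (n + m)} (hx : x ∈ (logDecayRing p k n m r).toSubring)
    (hx1 : ‖x - 1‖ < 1) : ∃ y ∈ (logDecayRing p k n m r).toSubring, x * y = 1 ∧ ‖y‖ ≤ 1 := by
  obtain ⟨y, hxy, hy1, hy⟩ := exists_inverse_of_norm_sub_one_lt hx1
  exact ⟨y, ⟨hy _ hx.1, hasLogDecay_inverse hr hx.2 hx1 hxy⟩, hxy, hy1⟩

/-- For r < 0 the bound c p^(rj) tends to 0, so an integral exponent is eventually forced to be
greater than -1. -/
theorem nonneg_of_hasLogDecay_of_neg {n m : ℕ} {r : ℝ} (hr : r < 0)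
    {x : LaurentRing p k (n + m)} (hx : HasLogDecay n m r x) {u : Fin (n + m) → ℤ}
    (hu : x.coeff u ≠ 0) {i : Fin (n + m)} (hi : (i : ℕ) < n) : 0 ≤ u i := by
  obtain ⟨c, hc, h⟩ := hx
  have hp := one_lt_cast_p p
  have h0 : Tendsto (fun j : ℕ => c * (p : ℝ) ^ (r * (j : ℝ))) atTop (𝓝 0) := by
    have h1 : Tendsto (fun j : ℕ => r * (j : ℝ)) atTop atBot :=
      tendsto_natCast_atTop_atTop.const_mul_atTop_of_neg hr
    have h2 := (tendsto_rpow_atBot_of_base_gt_one (p : ℝ) hp).comp h1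
    simpa using h2.const_mul c
  have h3 : Tendsto (fun j : ℕ => ((p : ℝ)⁻¹) ^ j) atTop (𝓝 0) :=
    tendsto_pow_atTop_nhds_zero_of_lt_one (by positivity) (inv_lt_one_of_one_lt₀ hp)
  obtain ⟨j, hj, hj1, hj2⟩ := ((h i hi).and ((h0.eventually_lt_const one_pos).and
    (h3.eventually_lt_const (norm_pos_iff.2 hu)))).exists
  have h4 := le_partialValuation_iff.1 hj u hj2.le
  have h5 : (-1 : ℝ) < ((u i : ℤ) : ℝ) := by linarith
  have h6 : (-1 : ℤ) < u i := by exact_mod_cast h5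
  omega

end Decay

end

end LogDecay

namespace LogDecay

noncomputable section

set_option linter.unusedSectionVars false

/-! ### Rank one modules inside a domain -/

section RankOne

/-- A projective module of rank one over a domain embeds into the domain. -/
theorem exists_injective_of_finrank_eq_one {R M : Type*} [CommRing R] [IsDomain R]
    [AddCommGroup M] [Module R M] [Module.Finite R M] [Module.Projective R M]
    (h : Module.finrank R M = 1) : ∃ ι : M →ₗ[R] R, Function.Injective ι := by
  have hnt : Nontrivial M := by
    by_contra hn
    rw [not_nontrivial_iff_subsingleton] at hn
    rw [Module.finrank_zero_of_subsingleton] at h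
    exact zero_ne_one h
  obtain ⟨x, hx⟩ := exists_ne (0 : M)
  obtain ⟨ι, hιx⟩ : ∃ ι : M →ₗ[R] R, ι x ≠ 0 := by
    by_contra hcon
    push Not at hcon
    exact hx ((Module.forall_dual_apply_eq_zero_iff R x).1 hcon)
  refine ⟨ι, (injective_iff_map_eq_zero ι).2 fun y hy => ?_⟩
  by_contra hy0
  have hli : LinearIndependent R ![x, y] := by
    rw [LinearIndependent.pair_iff]
    intro s t hst
    have h1 := congrArg ι hst
    rw [map_add, map_smul, map_smul, hy, smul_zero, add_zero, map_zero, smul_eq_mul] at h1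
    have hs : s = 0 := (mul_eq_zero.1 h1).resolve_right hιx
    rw [hs, zero_smul, zero_add] at hst
    exact ⟨hs, (smul_eq_zero.1 hst).resolve_right hy0⟩
  have h2 := hli.fintype_card_le_finrank
  rw [h, Fintype.card_fin] at h2
  omega

theorem smul_eq_smul_of_injective {R M : Type*} [CommRing R] [AddCommGroup M] [Module R M]
    {ι : M →ₗ[R] R} (hι : Function.Injective ι) (x y : M) : ι x • y = ι y • x := by
  apply hι
  rw [map_smul, map_smul, smul_eq_mul, smul_eq_mul, mul_comm]

end RankOne

/-! ### The lattice of a rank one module with Frobenius -/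

section FrobeniusLattices

variable {p : ℕ} [Fact p.Prime] {k : Type*} [Field k] [CharP k p] [PerfectRing k p] {d : ℕ}

open RestrictedSeries

theorem FrobDiffSubring.coe_sigma_pow (S : FrobDiffSubring p k d) (f : ℕ) (s : S.ring) :
    (((S.sigma ^ f) s : S.ring) : LaurentRing p k d) = LaurentRing.sigmaPow p k d f s := by
  induction f with
  | zero => rfl
  | succ f ih =>
    rw [pow_succ', RingHom.mul_def, RingHom.comp_apply, LaurentRing.sigmaPow_succ, ← ih]
    rfl

variable (p k d) in
/-- The series of Gauss norm at most one. -/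
def unitBall : Subring (LaurentRing p k d) where
  carrier := {x | ‖x‖ ≤ 1}
  zero_mem' := by simp
  one_mem' := norm_one.le
  add_mem' hx hy := (IsUltrametricDist.norm_add_le_max _ _).trans (max_le hx hy)
  neg_mem' {x} hx := by
    change ‖-x‖ ≤ 1
    rwa [norm_neg]
  mul_mem' hx hy := LaurentRing.norm_mul_le_one hx hy

theorem isClosed_unitBall : IsClosed (unitBall p k d : Set (LaurentRing p k d)) :=
  isClosed_le continuous_norm continuous_const

theorem monomial_mem_nonnegOn {J : Set (Fin d)} {v : Fin d → ℤ} (hv : ∀ i ∈ J, 0 ≤ v i)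
    (c : WittField p k) : monomial v c ∈ (nonnegOn p k J).toSubring := by
  intro u hu i hi
  rw [coeff_monomial] at hu
  have : u = v := by
    by_contra hne
    exact hu (if_neg hne)
  exact this ▸ hv i hi

theorem smul_mem_nonnegOn {J : Set (Fin d)} (c : WittField p k) {x : LaurentRing p k d}
    (hx : x ∈ (nonnegOn p k J).toSubring) : c • x ∈ (nonnegOn p k J).toSubring := by
  rw [smul_def']
  exact mul_mem (monomial_mem_nonnegOn (fun _ _ => le_rfl) c) hx

theorem sigmaPow_mem_nonnegOn {J : Set (Fin d)} (f : ℕ) {x : LaurentRing p k d}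
    (hx : x ∈ (nonnegOn p k J).toSubring) :
    LaurentRing.sigmaPow p k d f x ∈ (nonnegOn p k J).toSubring := by
  have := ((nonnegOn p k J).sigma ^ f) ⟨x, hx⟩
  rw [← FrobDiffSubring.coe_sigma_pow (nonnegOn p k J) f ⟨x, hx⟩]
  exact Subtype.property _

/-- For 0 ≤ α < q one has q v + α ≥ 0 exactly if v ≥ 0, and the summands have disjoint supports. -/
theorem sum_mem_nonnegOn_iff {J : Set (Fin d)} {f : ℕ}
    {y : (Fin d → Fin (p ^ f)) → LaurentRing p k d} :
    ∑ α, monomial (LaurentRing.boxExp α) 1 * LaurentRing.sigmaPow p k d f (y α) ∈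
      (nonnegOn p k J).toSubring ↔ ∀ α, y α ∈ (nonnegOn p k J).toSubring := by
  constructor
  · intro h α v hv i hi
    have h2 := h (p ^ f • v + LaurentRing.boxExp α) (by
      rw [LaurentRing.coeff_sum_monomial_mul_sigmaPow]
      exact (map_ne_zero _).2 hv) i hi
    rw [Pi.add_apply, LaurentRing.natSmul_apply] at h2
    have h3 : LaurentRing.boxExp α i < (p ^ f : ℕ) := Int.ofNat_lt.2 (α i).2
    by_contra hneg
    have h4 : v i ≤ -1 := by omega
    have h5 : ((p ^ f : ℕ) : ℤ) * v i ≤ ((p ^ f : ℕ) : ℤ) * (-1) :=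
      mul_le_mul_of_nonneg_left h4 (Int.natCast_nonneg _)
    linarith
  · exact fun h => sum_mem fun α _ => mul_mem
      (monomial_mem_nonnegOn (fun _ _ => Int.natCast_nonneg _) _) (sigmaPow_mem_nonnegOn f (h α))

/-- The conditions on a ring of functions `S` and a set `J` of variables under which rank one
modules with Frobenius over `S` have lattices with exponents `≥ 0` on `J`. -/
structure IsLatticeRing (S : FrobDiffSubring p k d) (J : Set (Fin d)) : Prop where
  monomial_mem : ∀ (v : Fin d → ℤ) (c : WittField p k), (∀ i ∈ J, 0 ≤ v i) →
    monomial v c ∈ S.toSubring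
  frobPart_mem : ∀ (f : ℕ) (α : Fin d → Fin (p ^ f)), ∀ x ∈ S.toSubring,
    LaurentRing.frobPart f α x ∈ S.toSubring
  -- The unit makes x primitive: Gauss norm 1, exponents ≥ 0 on J, and no hidden factor T_i with i ∈
  -- J that could compensate a negative exponent of y.
  exists_normalizer : ∀ x ∈ S.toSubring, x ≠ 0 → ∃ u : S.ringˣ, ‖u.1.1 * x‖ = 1 ∧
    u.1.1 * x ∈ (nonnegOn p k J).toSubring ∧
    ∀ y ∈ S.toSubring, u.1.1 * x * y ∈ (nonnegOn p k J).toSubring →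
      y ∈ (nonnegOn p k J).toSubring

/-- The elements of Gauss norm at most one with exponents `≥ 0` on `J` in the image of `ι`. -/
def latticeOf {S : FrobDiffSubring p k d} {M : Type*} [AddCommGroup M] [Module S.ring M]
    (ι : M →ₗ[S.ring] S.ring) (J : Set (Fin d)) : AddSubgroup (LaurentRing p k d) where
  carrier := {z | (∃ x, (ι x : LaurentRing p k d) = z) ∧ ‖z‖ ≤ 1 ∧
    z ∈ (nonnegOn p k J).toSubring}
  zero_mem' := ⟨⟨0, by rw [map_zero]; rfl⟩, by simp, zero_mem _⟩
  add_mem' := by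
    rintro _ _ ⟨⟨x, rfl⟩, hx1, hxJ⟩ ⟨⟨y, rfl⟩, hy1, hyJ⟩
    exact ⟨⟨x + y, by rw [map_add]; rfl⟩, (unitBall p k d).add_mem hx1 hy1, add_mem hxJ hyJ⟩
  neg_mem' := by
    rintro _ ⟨⟨x, rfl⟩, hx1, hxJ⟩
    exact ⟨⟨-x, by rw [map_neg]; rfl⟩, (unitBall p k d).neg_mem hx1, neg_mem hxJ⟩

/-- The elements of `S` of Gauss norm at most one with exponents `≥ 0` on `J`. -/
def latticeRing (S : FrobDiffSubring p k d) (J : Set (Fin d)) : Subring (LaurentRing p k d) :=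
  S.toSubring ⊓ unitBall p k d ⊓ (nonnegOn p k J).toSubring

namespace IsLatticeRing

variable {S : FrobDiffSubring p k d} {J : Set (Fin d)}
variable {M : Type*} [AddCommGroup M] [Module S.ring M] {f : ℕ}

/-- Scalars from S are combinations of the T^α with coefficients in σ^f(S), and these coefficients
can be moved inside φ. -/
theorem exists_eq_sum (hS : IsLatticeRing S J) {φ : M →ₛₗ[S.sigma ^ f] M}
    (hspan : Submodule.span S.ring (Set.range φ) = ⊤) (x : M) :
    ∃ y : (Fin d → Fin (p ^ f)) → M,
      x = ∑ α, (⟨monomial (LaurentRing.boxExp α) 1,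
        hS.monomial_mem _ _ fun _ _ => Int.natCast_nonneg _⟩ : S.ring) • φ (y α) := by
  set B : (Fin d → Fin (p ^ f)) → S.ring := fun α => ⟨monomial (LaurentRing.boxExp α) 1,
    hS.monomial_mem _ _ fun _ _ => Int.natCast_nonneg _⟩ with hB
  set P : (Fin d → Fin (p ^ f)) → S.ring → S.ring := fun α t =>
    ⟨LaurentRing.frobPart f α t, hS.frobPart_mem f α t t.2⟩ with hP
  have key : ∀ t : S.ring, t = ∑ α, B α * (S.sigma ^ f) (P α t) := by
    intro t
    refine Subtype.ext ?_
    change _ = S.toSubring.subtype _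
    rw [map_sum]
    refine (LaurentRing.sum_frobPart f t.1).symm.trans (Finset.sum_congr rfl fun α _ => ?_)
    rw [map_mul]
    change _ = B α * (((S.sigma ^ f) (P α t) : S.ring) : LaurentRing p k d)
    rw [FrobDiffSubring.coe_sigma_pow]
  have hx : x ∈ Submodule.span S.ring (Set.range φ) := hspan ▸ Submodule.mem_top
  change ∃ y : (Fin d → Fin (p ^ f)) → M, x = ∑ α, B α • φ (y α)
  induction hx using Submodule.span_induction with
  | zero => exact ⟨0, by simp⟩
  | add x x' _ _ h h' =>
    obtain ⟨y, rfl⟩ := h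
    obtain ⟨y', rfl⟩ := h'
    exact ⟨y + y', by simp [smul_add, Finset.sum_add_distrib]⟩
  | smul s x _ h =>
    obtain ⟨y, rfl⟩ := h
    refine ⟨fun α => ∑ β, P α (s * B β) • y β, ?_⟩
    rw [Finset.smul_sum]
    simp only [map_sum, LinearMap.map_smulₛₗ, Finset.smul_sum]
    rw [Finset.sum_comm]
    refine Finset.sum_congr rfl fun β _ => ?_
    rw [smul_smul]
    conv_lhs => rw [key (s * B β), Finset.sum_smul]
    exact Finset.sum_congr rfl fun α _ => mul_smul _ _ _
  | mem x hx =>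
    obtain ⟨z, rfl⟩ := hx
    refine ⟨fun α => P α 1 • z, ?_⟩
    conv_lhs => rw [← one_smul S.ring (φ z), key 1, Finset.sum_smul]
    refine Finset.sum_congr rfl fun α _ => ?_
    rw [LinearMap.map_smulₛₗ, mul_smul]

/-- Apply φ and then ι to ι(x) y = ι(y) x. In other words, Frobenius on the image of ι is σ^f times
the fixed fraction ι(φ x) / σ^f(ι x). -/
theorem sigma_mul_eq {φ : M →ₛₗ[S.sigma ^ f] M} {ι : M →ₗ[S.ring] S.ring}
    (hι : Function.Injective ι) (x y : M) :
    LaurentRing.sigmaPow p k d f (ι x) * (ι (φ y) : LaurentRing p k d) =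
      (ι (φ x) : LaurentRing p k d) * LaurentRing.sigmaPow p k d f (ι y) := by
  have h := congrArg (fun z => ι (φ z)) (smul_eq_smul_of_injective hι x y)
  simp only [LinearMap.map_smulₛₗ, map_smul, smul_eq_mul] at h
  have h' := congrArg Subtype.val h
  rw [Subring.coe_mul, Subring.coe_mul, FrobDiffSubring.coe_sigma_pow,
    FrobDiffSubring.coe_sigma_pow] at h'
  rw [h', mul_comm]

/-- With a = ι(φ x₀) and b = σ^f(ι x₀) both of norm 1, the fraction a/b preserves norms. The
hypotheses `hdiv₀` and `hdiv` ensure that it also preserves nonnegativity of exponents on J, so the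
lattice and its Frobenius pullback are proportional. -/
theorem exists_lattice_generator_aux (hS : IsLatticeRing S J) {φ : M →ₛₗ[S.sigma ^ f] M}
    (hf : 0 < f) (hspan : Submodule.span S.ring (Set.range φ) = ⊤) {ι : M →ₗ[S.ring] S.ring}
    (hι : Function.Injective ι) {x₀ : M} (h1 : ‖(ι x₀ : LaurentRing p k d)‖ = 1)
    (hJ : (ι x₀ : LaurentRing p k d) ∈ (nonnegOn p k J).toSubring)
    (h1' : ‖(ι (φ x₀) : LaurentRing p k d)‖ = 1)
    (hJ' : (ι (φ x₀) : LaurentRing p k d) ∈ (nonnegOn p k J).toSubring)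
    (hdiv₀ : ∀ y ∈ S.toSubring, (ι x₀ : LaurentRing p k d) * y ∈ (nonnegOn p k J).toSubring →
      y ∈ (nonnegOn p k J).toSubring)
    (hdiv : ∀ y ∈ S.toSubring, (ι (φ x₀) : LaurentRing p k d) * y ∈ (nonnegOn p k J).toSubring →
      y ∈ (nonnegOn p k J).toSubring) :
    ∃ e ∈ latticeOf ι J, ∀ x ∈ latticeOf ι J, ∃ s ∈ latticeRing S J, ∃ x' ∈ latticeOf ι J,
      x = s * e + (p : WittField p k) • x' := by
  have hb1 : ‖LaurentRing.sigmaPow p k d f (ι x₀)‖ = 1 := by rw [LaurentRing.norm_sigmaPow, h1]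
  refine LaurentRing.exists_generator_mod_p (J := J) (f := f) (a := ι (φ x₀))
    (b := LaurentRing.sigmaPow p k d f (ι x₀)) ?_ (fun z hz => hz.2.1) (fun z hz => hz.2.2) ?_ ?_ hf
    h1' hb1 hJ' (sigmaPow_mem_nonnegOn f hJ) ?_ ?_
  · intro v c hv hc
    refine ⟨⟨hS.monomial_mem v c hv, ?_⟩, monomial_mem_nonnegOn hv c⟩
    change ‖_‖ ≤ 1
    rwa [norm_monomial]
  · rintro s ⟨⟨hs, hs1⟩, hsJ⟩ _ ⟨⟨x, rfl⟩, hx1, hxJ⟩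
    exact ⟨⟨(⟨s, hs⟩ : S.ring) • x, by rw [map_smul]; rfl⟩, (unitBall p k d).mul_mem hs1 hx1,
      mul_mem hsJ hxJ⟩
  · rintro _ ⟨⟨x, rfl⟩, hx1, hxJ⟩ hlt
    refine ⟨⟨(⟨monomial 0 (p : WittField p k)⁻¹, hS.monomial_mem _ _ fun _ _ => le_rfl⟩ : S.ring)
      • x, by rw [map_smul]; rfl⟩, LaurentRing.norm_inv_p_smul_le hlt, smul_mem_nonnegOn _ hxJ⟩
  · rintro _ ⟨⟨x, rfl⟩, hx1, hxJ⟩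
    obtain ⟨y, hy⟩ := hS.exists_eq_sum hspan x
    have heq : LaurentRing.sigmaPow p k d f (ι x₀) * (ι x : LaurentRing p k d) =
        (ι (φ x₀) : LaurentRing p k d) * ∑ α, monomial (LaurentRing.boxExp α) 1 *
          LaurentRing.sigmaPow p k d f (ι (y α)) := by
      have h := congrArg (fun z => S.toSubring.subtype (ι z)) hy
      simp only [map_sum, map_smul, smul_eq_mul, map_mul] at h
      change (ι x : LaurentRing p k d) = ∑ α, monomial (LaurentRing.boxExp α) 1 *
        (ι (φ (y α)) : LaurentRing p k d) at h
      rw [h, Finset.mul_sum, Finset.mul_sum]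
      refine Finset.sum_congr rfl fun α _ => ?_
      rw [mul_left_comm, sigma_mul_eq hι]
      ring
    -- Here z stands for (b/a) ι(x). It has norm at most 1 and, by `hdiv`, exponents ≥ 0 on J. Both
    -- properties pass to the components ι(y_α).
    set z : LaurentRing p k d := ∑ α, monomial (LaurentRing.boxExp α) 1 *
      LaurentRing.sigmaPow p k d f (ι (y α)) with hz
    have hzS : z ∈ S.toSubring := sum_mem fun α _ => mul_mem
      (hS.monomial_mem _ _ fun _ _ => Int.natCast_nonneg _)
      (by rw [← FrobDiffSubring.coe_sigma_pow]; exact Subtype.property _)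
    have hzJ : z ∈ (nonnegOn p k J).toSubring := hdiv z hzS (by
      rw [← heq]
      exact mul_mem (sigmaPow_mem_nonnegOn f hJ) hxJ)
    have hz1 : ‖z‖ ≤ 1 := by
      have h := congrArg norm heq
      rw [norm_mul, norm_mul, hb1, h1', one_mul, one_mul] at h
      exact h ▸ hx1
    have hcoe : ∀ α v, (WittField.frobenius p k ^ f) ((ι (y α) : LaurentRing p k d).coeff v) =
        z.coeff (p ^ f • v + LaurentRing.boxExp α) := fun α v =>
      (LaurentRing.coeff_sum_monomial_mul_sigmaPow f
        (fun α => (ι (y α) : LaurentRing p k d)) v α).symm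
    refine ⟨fun α => ι (y α), fun α => ⟨⟨y α, rfl⟩, ?_, ?_⟩, heq⟩
    · refine (norm_le_iff zero_le_one).2 fun v => ?_
      rw [← WittField.norm_frobenius_pow p k f, hcoe]
      exact (norm_coeff_le _ _).trans hz1
    · exact sum_mem_nonnegOn_iff.1 hzJ α
  · rintro _ ⟨⟨y, rfl⟩, hy1, hyJ⟩
    have heq := sigma_mul_eq (φ := φ) hι x₀ y
    refine ⟨ι (φ y), ⟨⟨φ y, rfl⟩, ?_, ?_⟩, heq⟩
    · have h := congrArg norm heq
      rw [norm_mul, norm_mul, hb1, h1', one_mul, one_mul, LaurentRing.norm_sigmaPow] at h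
      exact h.trans_le hy1
    -- The hypothesis `hdiv₀` concerns ι(x₀) and not σ^f(ι x₀). Expanding ι(φ y) in the monomials
    -- T^α over the image of σ^f allows it to be applied to each component.
    · have hmem : ∀ α, LaurentRing.frobPart f α (ι (φ y) : LaurentRing p k d) ∈ S.toSubring :=
        fun α => hS.frobPart_mem f α _ (ι (φ y)).2
      have h2 : LaurentRing.sigmaPow p k d f (ι x₀) * (ι (φ y) : LaurentRing p k d) ∈
          (nonnegOn p k J).toSubring := by
        rw [heq]
        exact mul_mem hJ' (sigmaPow_mem_nonnegOn f hyJ)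
      rw [← LaurentRing.sum_frobPart f (ι (φ y) : LaurentRing p k d)] at h2 ⊢
      rw [Finset.mul_sum] at h2
      have h3 : ∑ α, LaurentRing.sigmaPow p k d f (ι x₀) * (monomial (LaurentRing.boxExp α) 1 *
          LaurentRing.sigmaPow p k d f (LaurentRing.frobPart f α (ι (φ y)))) =
          ∑ α, monomial (LaurentRing.boxExp α) 1 * LaurentRing.sigmaPow p k d f
            ((ι x₀ : LaurentRing p k d) * LaurentRing.frobPart f α (ι (φ y))) := by
        refine Finset.sum_congr rfl fun α _ => ?_
        rw [map_mul]
        ring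
      rw [h3, sum_mem_nonnegOn_iff] at h2
      exact sum_mem_nonnegOn_iff.2 fun α => hdiv₀ _ (hmem α) (h2 α)

/-- A nonzero vector and afterwards φ itself are rescaled by units so that ι(x₀) and ι(φ x₀) become
primitive. A unit multiple of φ has the same span. -/
theorem exists_lattice_generator (hS : IsLatticeRing S J) [Nontrivial M]
    {φ : M →ₛₗ[S.sigma ^ f] M}
    (hf : 0 < f) (hspan : Submodule.span S.ring (Set.range φ) = ⊤) {ι : M →ₗ[S.ring] S.ring}
    (hι : Function.Injective ι) :
    ∃ e ∈ latticeOf ι J, ∀ x ∈ latticeOf ι J, ∃ s ∈ latticeRing S J, ∃ x' ∈ latticeOf ι J,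
      x = s * e + (p : WittField p k) • x' := by
  have hne : ∀ x : M, x ≠ 0 → (ι x : LaurentRing p k d) ≠ 0 := fun x hx h =>
    hx ((injective_iff_map_eq_zero ι).1 hι x (Subtype.ext h))
  have hcoe : ∀ (u : S.ring) (x : M), (ι (u • x) : LaurentRing p k d) = u.1 * ι x := fun u x => by
    rw [map_smul]; rfl
  obtain ⟨x₁, hx₁⟩ := exists_ne (0 : M)
  obtain ⟨u, hu1, huJ, hudiv⟩ := hS.exists_normalizer _ (ι x₁).2 (hne x₁ hx₁)
  rw [← hcoe] at hu1 huJ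
  simp only [← hcoe] at hudiv
  set x₀ := u.1 • x₁ with hx₀
  -- If φ vanished at x₀, then `sigma_mul_eq` would make it vanish everywhere, against `hspan`.
  have hφ0 : φ x₀ ≠ 0 := by
    intro h0
    have hall : ∀ y, φ y = 0 := by
      intro y
      by_contra hy
      have h1 := sigma_mul_eq (φ := φ) hι x₀ y
      rw [h0, map_zero, ZeroMemClass.coe_zero, zero_mul, mul_eq_zero,
        or_iff_left (hne _ hy), ← norm_eq_zero, LaurentRing.norm_sigmaPow, hu1] at h1
      exact one_ne_zero h1
    have hbot : Submodule.span S.ring (Set.range φ) = ⊥ := by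
      rw [Submodule.span_eq_bot]
      rintro _ ⟨y, rfl⟩
      exact hall y
    exact bot_ne_top (hbot.symm.trans hspan)
  obtain ⟨w, hw1, hwJ, hwdiv⟩ := hS.exists_normalizer _ (ι (φ x₀)).2 (hne _ hφ0)
  rw [← hcoe] at hw1 hwJ
  simp only [← hcoe] at hwdiv
  refine hS.exists_lattice_generator_aux (φ := w.1 • φ) hf ?_ hι hu1 huJ hw1 hwJ hudiv hwdiv
  rw [eq_top_iff, ← hspan, Submodule.span_le]
  rintro _ ⟨y, rfl⟩
  have : φ y = w⁻¹.1 • (w.1 • φ) y := by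
    rw [LinearMap.smul_apply, smul_smul, Units.inv_mul, one_smul]
  rw [this]
  exact Submodule.smul_mem _ _ (Submodule.subset_span ⟨y, rfl⟩)

end IsLatticeRing

end FrobeniusLattices

end

end LogDecay

namespace LogDecay

noncomputable section

set_option linter.unusedSectionVars false

/-! ### The rings 𝒜^r as lattice rings, by the sign of r -/

section Freeness

variable {p : ℕ} [Fact p.Prime] {k : Type*} [Field k] [CharP k p] [PerfectRing k p]

open RestrictedSeries

theorem frobPart_mem_nonnegOn {d : ℕ} {J : Set (Fin d)} (f : ℕ) (α : Fin d → Fin (p ^ f))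
    {x : LaurentRing p k d} (hx : x ∈ (nonnegOn p k J).toSubring) :
    LaurentRing.frobPart f α x ∈ (nonnegOn p k J).toSubring :=
  sum_mem_nonnegOn_iff (y := fun α => LaurentRing.frobPart f α x) |>.1
    (by rwa [LaurentRing.sum_frobPart]) α

/-- For u_i < 0 and α_i ≤ q - 1 one has q u_i + α_i ≤ u_i, so the bound is inherited with the same
constant. -/
theorem HasLogDecay.frobPart {n m : ℕ} {r : ℝ} {x : LaurentRing p k (n + m)}
    (hx : HasLogDecay n m r x) (f : ℕ) (α : Fin (n + m) → Fin (p ^ f)) :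
    HasLogDecay n m r (LaurentRing.frobPart f α x) := by
  obtain ⟨c, hc, hx⟩ := hx
  refine ⟨c, hc, fun i hi => ?_⟩
  filter_upwards [hx i hi] with j h1
  rw [le_partialValuation_iff] at h1 ⊢
  intro u hu
  rw [LaurentRing.norm_coeff_frobPart] at hu
  have h2 := h1 _ hu
  rcases le_or_gt 0 (u i) with h0 | h0
  · have h3 : (0 : ℝ) ≤ ((u i : ℤ) : ℝ) := by exact_mod_cast h0
    have := mul_pos hc (p_rpow_pos p (r * j))
    linarith
  · refine h2.trans ?_
    rw [Pi.add_apply, LaurentRing.natSmul_apply]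
    have h3 : LaurentRing.boxExp α i + 1 ≤ (p ^ f : ℕ) := Int.add_one_le_of_lt
      (Int.ofNat_lt.2 (α i).2)
    have h4 : (1 : ℤ) ≤ (p ^ f : ℕ) := by exact_mod_cast pow_f_pos p f
    have h5 : ((p ^ f : ℕ) : ℤ) * u i + LaurentRing.boxExp α i ≤ u i := by nlinarith
    exact_mod_cast h5

theorem frobPart_mem_logDecayRing {n m : ℕ} {r : ℝ} (f : ℕ) (α : Fin (n + m) → Fin (p ^ f))
    {x : LaurentRing p k (n + m)} (hx : x ∈ (logDecayRing p k n m r).toSubring) :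
    LaurentRing.frobPart f α x ∈ (logDecayRing p k n m r).toSubring :=
  ⟨frobPart_mem_nonnegOn f α hx.1, hx.2.frobPart f α⟩

theorem monomial_mem_logDecayRing {n m : ℕ} {r : ℝ} (hr : 0 ≤ r) {v : Fin (n + m) → ℤ}
    (hv : ∀ i : Fin (n + m), n ≤ (i : ℕ) → 0 ≤ v i) (c : WittField p k) :
    monomial v c ∈ (logDecayRing p k n m r).toSubring := by
  refine ⟨monomial_mem_nonnegOn hv c, (hasLogDecay_iff hr).2
    ⟨(∑ i, |((v i : ℤ) : ℝ)|) * ‖c‖ ^ r, ?_, ?_⟩⟩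
  · exact mul_nonneg (Finset.sum_nonneg fun _ _ => abs_nonneg _) (Real.rpow_nonneg (norm_nonneg _) r)
  · intro u hu i _
    rw [coeff_monomial] at hu ⊢
    have huv : u = v := by
      by_contra hne
      exact hu (if_neg hne)
    rw [if_pos huv, huv]
    refine mul_le_mul_of_nonneg_right ((neg_le_abs _).trans ?_) (Real.rpow_nonneg (norm_nonneg _) r)
    exact Finset.single_le_sum (f := fun i => |((v i : ℤ) : ℝ)|) (fun _ _ => abs_nonneg _)
      (Finset.mem_univ i)

/-- If all of S has exponents ≥ 0 on J, then divisibility by T_i plays no role and a power of p is a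
sufficient normalizer. -/
theorem isLatticeRing_of_le {d : ℕ} {S : FrobDiffSubring p k d} {J : Set (Fin d)}
    (hJ : S.toSubring ≤ (nonnegOn p k J).toSubring)
    (hm : ∀ (v : Fin d → ℤ) (c : WittField p k), (∀ i ∈ J, 0 ≤ v i) →
      monomial v c ∈ S.toSubring)
    (hp : ∀ (f : ℕ) (α : Fin d → Fin (p ^ f)), ∀ x ∈ S.toSubring,
      LaurentRing.frobPart f α x ∈ S.toSubring) : IsLatticeRing S J where
  monomial_mem := hm
  frobPart_mem := hp
  exists_normalizer x hx hx0 := by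
    obtain ⟨c, -, hc⟩ := LaurentRing.exists_norm_smul_eq_one hx0
    have hinv : ∀ e : ℤ, (monomial 0 ((p : WittField p k) ^ e) : LaurentRing p k d) *
        monomial 0 ((p : WittField p k) ^ (-e)) = 1 := fun e => by
      rw [monomial_mul_monomial, add_zero, ← zpow_add₀ (WittField.p_ne_zero p k), add_neg_cancel,
        zpow_zero]
      rfl
    have hmem : ∀ e : ℤ, (monomial 0 ((p : WittField p k) ^ e) : LaurentRing p k d) ∈
        S.toSubring := fun e => hm _ _ fun _ _ => le_rfl
    refine ⟨⟨⟨_, hmem (-c)⟩, ⟨_, hmem c⟩, Subtype.ext ?_, Subtype.ext ?_⟩, ?_, ?_, ?_⟩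
    · simpa using hinv (-c)
    · exact hinv c
    · rwa [smul_def'] at hc
    · exact mul_mem (hJ (hmem (-c))) (hJ hx)
    · exact fun y hy _ => hJ hy

theorem isLatticeRing_of_pos {n m : ℕ} {r : ℝ} (hr : 0 < r) :
    IsLatticeRing (logDecayRing p k n m r) {i | n ≤ (i : ℕ)} :=
  isLatticeRing_of_le (fun _ hx => hx.1) (fun _ c hv => monomial_mem_logDecayRing hr.le hv c)
    fun f α _ hx => frobPart_mem_logDecayRing f α hx

theorem mem_tateAlgebra_of_neg {n m : ℕ} {r : ℝ} (hr : r < 0) {x : LaurentRing p k (n + m)}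
    (hx : x ∈ (logDecayRing p k n m r).toSubring) :
    x ∈ (tateAlgebra p k (n + m)).toSubring := by
  intro u hu i _
  rcases lt_or_ge (i : ℕ) n with hi | hi
  · exact nonneg_of_hasLogDecay_of_neg hr hx.2 hu hi
  · exact hx.1 u hu i hi

theorem isLatticeRing_of_neg {n m : ℕ} {r : ℝ} (hr : r < 0) :
    IsLatticeRing (logDecayRing p k n m r) Set.univ :=
  isLatticeRing_of_le (fun _ hx => mem_tateAlgebra_of_neg hr hx)
    (fun _ c hv => tateAlgebra_le_logDecayRing p k n m r (monomial_mem_nonnegOn hv c))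
    fun f α _ hx => frobPart_mem_logDecayRing f α hx

/-- The part of a series with a given exponent of `T_i`. -/
def coordPart {d : ℕ} (i : Fin d) (e : ℤ) (x : LaurentRing p k d) : LaurentRing p k d :=
  RestrictedSeries.mk (fun v => if v i = e then x.coeff v else 0) (by
    refine tendsto_of_finite fun ε hε => (x.finite_le_norm hε).subset fun u hu => ?_
    simp only [Set.mem_ofPred_eq] at hu ⊢
    split_ifs at hu with h
    · exact hu
    · rw [norm_zero] at hu
      exact absurd hu (not_le.2 hε))

theorem coeff_coordPart {d : ℕ} (i : Fin d) (e : ℤ) (x : LaurentRing p k d) (v : Fin d → ℤ) :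
    (coordPart i e x).coeff v = if v i = e then x.coeff v else 0 := rfl

/-- The lowest part of a product with respect to the exponent of `T_i`. -/
theorem coordPart_mul_coordPart {d : ℕ} {i : Fin d} {e e' : ℤ} {x y : LaurentRing p k d}
    (hx : ∀ v, x.coeff v ≠ 0 → e ≤ v i) (hy : ∀ v, y.coeff v ≠ 0 → e' ≤ v i) :
    coordPart i e x * coordPart i e' y = coordPart i (e + e') (x * y) := by
  ext u
  rw [coeff_coordPart, coeff_mul, coeff_mul]
  split_ifs with h
  · refine tsum_congr fun v => ?_
    rw [coeff_coordPart, coeff_coordPart]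
    by_cases hxv : x.coeff v = 0
    · simp [hxv]
    by_cases hyv : y.coeff (u - v) = 0
    · simp [hyv]
    have h1 := hx v hxv
    have h2 := hy _ hyv
    rw [Pi.sub_apply] at h2 ⊢
    rw [if_pos (by omega), if_pos (by omega)]
  · refine (tsum_congr fun v => ?_).trans tsum_zero
    rw [coeff_coordPart, coeff_coordPart, Pi.sub_apply]
    by_cases h1 : v i = e
    · rw [if_neg (show ¬ u i - v i = e' by omega), mul_zero]
    · rw [if_neg h1, zero_mul]

/-- The minimal exponent of `T_i` in a nonzero series whose exponents are bounded below. -/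
theorem exists_min_exponent {d : ℕ} (i : Fin d) {x : LaurentRing p k d} (hx0 : x ≠ 0)
    (hb : ∃ C : ℝ, ∀ v, x.coeff v ≠ 0 → -((v i : ℤ) : ℝ) ≤ C) :
    ∃ e, (∀ v, x.coeff v ≠ 0 → e ≤ v i) ∧ ∃ v, x.coeff v ≠ 0 ∧ v i = e := by
  obtain ⟨C, hC⟩ := hb
  obtain ⟨v₀, hv₀⟩ : ∃ v, x.coeff v ≠ 0 := by
    by_contra h
    push Not at h
    exact hx0 (RestrictedSeries.ext h)
  obtain ⟨e, ⟨v, hv, rfl⟩, hmin⟩ := Int.exists_least_of_bdd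
    (P := fun e => ∃ v, x.coeff v ≠ 0 ∧ v i = e) ⟨-⌈C⌉, by
      rintro _ ⟨v, hv, rfl⟩
      have h1 : ((-(v i) : ℤ) : ℝ) ≤ ⌈C⌉ := by push_cast; exact (hC v hv).trans (Int.le_ceil C)
      have h2 : -(v i) ≤ ⌈C⌉ := by exact_mod_cast h1
      omega⟩ ⟨_, v₀, hv₀, rfl⟩
  exact ⟨v i, fun w hw => hmin _ ⟨w, hw, rfl⟩, v, hv, rfl⟩

/-- For r = 0 the factor |x_v|^r is 1, so log-decay is a lower bound for the exponents. -/
theorem exponent_bound_of_mem {n m : ℕ} {x : LaurentRing p k (n + m)}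
    (hx : x ∈ (logDecayRing p k n m 0).toSubring) (i : Fin (n + m)) :
    ∃ C : ℝ, ∀ v, x.coeff v ≠ 0 → -((v i : ℤ) : ℝ) ≤ C := by
  obtain ⟨C, hC, hb⟩ := (hasLogDecay_iff le_rfl).1 hx.2
  refine ⟨C, fun v hv => ?_⟩
  rcases lt_or_ge (i : ℕ) n with hi | hi
  · simpa using hb v hv i hi
  · have h1 : (0 : ℝ) ≤ ((v i : ℤ) : ℝ) := by exact_mod_cast hx.1 v hv i hi
    linarith

/-- Exponents in 𝒜^0 are bounded below, so a monomial shifts the lowest exponent of each T_i, i < n,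
to 0. The lowest T_i-part of a product is the product of the lowest parts and does not vanish in a
domain, so a negative exponent of y persists in the product. Taking all variables for J makes the
lattice ring the unit ball of the Tate algebra, which is complete. -/
theorem isLatticeRing_zero {n m : ℕ} : IsLatticeRing (logDecayRing p k n m 0) Set.univ where
  monomial_mem _ c hv :=
    tateAlgebra_le_logDecayRing p k n m 0 (monomial_mem_nonnegOn hv c)
  frobPart_mem f α _ hx := frobPart_mem_logDecayRing f α hx
  exists_normalizer x hx hx0 := by
    obtain ⟨c, -, hc⟩ := LaurentRing.exists_norm_smul_eq_one hx0
    choose e he hatt using fun i => exists_min_exponent i hx0 (exponent_bound_of_mem hx i)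
    classical
    -- Only the first n variables are invertible. The others have exponents ≥ 0 anyway.
    set w : Fin (n + m) → ℤ := fun i => if (i : ℕ) < n then -e i else 0 with hw
    have hmem : ∀ (s : ℤ) (t : ℤ), (monomial (s • w) ((p : WittField p k) ^ t)) ∈
        (logDecayRing p k n m 0).toSubring := fun s t => monomial_mem_logDecayRing le_rfl
      (fun i hi => by simp [hw, not_lt.2 hi]) _
    have hinv : (monomial ((1 : ℤ) • w) ((p : WittField p k) ^ (-c)) : LaurentRing p k (n + m)) *
        monomial ((-1 : ℤ) • w) ((p : WittField p k) ^ c) = 1 := by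
      rw [monomial_mul_monomial, ← add_smul, add_neg_cancel, zero_smul,
        ← zpow_add₀ (WittField.p_ne_zero p k), neg_add_cancel, zpow_zero]
      rfl
    have heq : (monomial ((1 : ℤ) • w) ((p : WittField p k) ^ (-c)) : LaurentRing p k (n + m)) * x
        = (monomial w 1 : LaurentRing p k (n + m)) * ((p : WittField p k) ^ (-c) • x) := by
      rw [smul_def', ← mul_assoc, monomial_mul_monomial, one_smul, one_mul, add_zero]
    have hcoef : ∀ v, ((monomial ((1 : ℤ) • w) ((p : WittField p k) ^ (-c)) :
        LaurentRing p k (n + m)) * x).coeff (w + v) = (p : WittField p k) ^ (-c) * x.coeff v := by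
      intro v
      rw [heq, coeff_monomial_mul, one_mul, add_sub_cancel_left, coeff_smul]
    have hpc : (p : WittField p k) ^ (-c) ≠ 0 := zpow_ne_zero _ (WittField.p_ne_zero p k)
    set a := (monomial ((1 : ℤ) • w) ((p : WittField p k) ^ (-c)) : LaurentRing p k (n + m)) * x
      with ha
    have hanonneg : a ∈ (nonnegOn p k Set.univ).toSubring := by
      intro v hv i _
      have h1 := hcoef (v - w)
      rw [add_sub_cancel] at h1
      rw [h1] at hv
      have h2 := right_ne_zero_of_mul hv
      rcases lt_or_ge (i : ℕ) n with hi | hi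
      · have h3 := he i _ h2
        simp only [Pi.sub_apply, hw, if_pos hi] at h3
        omega
      · have h3 := hx.1 _ h2 i hi
        simpa [hw, not_lt.2 hi] using h3
    refine ⟨⟨⟨_, hmem 1 (-c)⟩, ⟨_, hmem (-1) c⟩, Subtype.ext hinv,
      Subtype.ext ((mul_comm _ _).trans hinv)⟩, ?_, hanonneg, ?_⟩
    · change ‖a‖ = 1
      rw [heq, norm_mul, norm_monomial, norm_one, one_mul, hc]
    · intro y hy hay u hu i _
      rcases lt_or_ge (i : ℕ) n with hi | hi
      swap
      · exact hy.1 u hu i hi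
      have hy0 : y ≠ 0 := by
        rintro rfl
        exact hu rfl
      obtain ⟨e', he', v', hv', hv'e⟩ := exists_min_exponent i hy0 (exponent_bound_of_mem hy i)
      refine le_trans ?_ (he' u hu)
      by_contra hneg
      -- If e' < 0, the product of the part of a at exponent 0 and of y at exponent e' must vanish,
      -- as a y has exponents ≥ 0. But both factors are nonzero.
      have h1 := coordPart_mul_coordPart (fun v hv => hanonneg v hv i trivial) he'
      have h2 : coordPart i (0 + e') (a * y) = 0 := by
        ext v
        rw [coeff_coordPart]
        split_ifs with h
        · by_contra h0
          exact hneg (by simpa [h] using hay v h0 i trivial)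
        · rfl
      rw [h2, mul_eq_zero] at h1
      rcases h1 with h1 | h1
      · obtain ⟨v, hv, hve⟩ := hatt i
        have h3 := congrArg (fun z => RestrictedSeries.coeff z (w + v)) h1
        simp only [coeff_coordPart, coeff_zero] at h3
        rw [if_pos (by simp [hw, hi, hve]), hcoef] at h3
        exact mul_ne_zero hpc hv h3
      · have h3 := congrArg (fun z => RestrictedSeries.coeff z v') h1
        simp only [coeff_coordPart, coeff_zero] at h3
        rw [if_pos hv'e] at h3
        exact hv' h3

end Freeness

end

end LogDecay

namespace LogDecay

noncomputable section

set_option linter.unusedSectionVars false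

/-! ### Rank one modules with Frobenius over 𝒜^r are free -/

section Generators

variable {p : ℕ} [Fact p.Prime] {k : Type*} [Field k] [CharP k p] [PerfectRing k p]

open RestrictedSeries

variable {d : ℕ} {S : FrobDiffSubring p k d} {J : Set (Fin d)}
variable {M : Type*} [AddCommGroup M] [Module S.ring M] {f : ℕ}

theorem coe_map_smul (ι : M →ₗ[S.ring] S.ring) (s : S.ring) (x : M) :
    (ι (s • x) : LaurentRing p k d) = s.1 * ι x := by
  rw [map_smul]
  rfl

theorem exists_norm_pow_smul_le (x : LaurentRing p k d) {ε : ℝ} (hε : 0 < ε) :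
    ∃ N : ℕ, ∀ N', N ≤ N' → ‖(p : WittField p k) ^ N' • x‖ ≤ ε := by
  have h1 := tendsto_pow_atTop_nhds_zero_of_lt_one (norm_nonneg (p : WittField p k))
    WittField.norm_p_lt_one
  have h2 := h1.mul_const ‖x‖
  rw [zero_mul] at h2
  obtain ⟨N, hN⟩ := eventually_atTop.1 (h2.eventually_le_const hε)
  refine ⟨N, fun N' h => ?_⟩
  rw [norm_smul', norm_pow]
  exact hN N' h

namespace IsLatticeRing

theorem exists_smul_mem_latticeOf (hS : IsLatticeRing S J) (ι : M →ₗ[S.ring] S.ring) (x : M) :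
    ∃ u : S.ringˣ, (ι (u.1 • x) : LaurentRing p k d) ∈ latticeOf ι J := by
  by_cases h0 : (ι x : LaurentRing p k d) = 0
  · refine ⟨1, ⟨_, rfl⟩, ?_, ?_⟩
    · rw [coe_map_smul, h0, mul_zero, norm_zero]
      exact zero_le_one
    · rw [coe_map_smul, h0, mul_zero]
      exact zero_mem _
  · obtain ⟨u, hu1, huJ, -⟩ := hS.exists_normalizer _ (ι x).2 h0
    rw [← coe_map_smul] at hu1 huJ
    exact ⟨u, ⟨_, rfl⟩, hu1.le, huJ⟩

/-- A generator of the lattice is a generator of the module. -/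
theorem exists_generator (hS : IsLatticeRing S J) {ι : M →ₗ[S.ring] S.ring}
    (hι : Function.Injective ι)
    (h : ∃ e ∈ latticeOf ι J, ∀ x ∈ latticeOf ι J, ∃ s ∈ S.toSubring, x = s * e) :
    ∃ e : M, ∀ x, ∃ s : S.ring, x = s • e := by
  obtain ⟨_, ⟨⟨e, rfl⟩, -, -⟩, he⟩ := h
  refine ⟨e, fun x => ?_⟩
  obtain ⟨u, hu⟩ := hS.exists_smul_mem_latticeOf ι x
  obtain ⟨s, hs, hsx⟩ := he _ hu
  have h1 : u.1 • x = (⟨s, hs⟩ : S.ring) • e := hι (Subtype.ext (by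
    rw [hsx, coe_map_smul]))
  refine ⟨u⁻¹.1 * ⟨s, hs⟩, ?_⟩
  rw [mul_smul, ← h1, smul_smul, Units.inv_mul, one_smul]

theorem exists_generator_of_isClosed (hS : IsLatticeRing S J)
    (hQc : IsClosed (latticeRing S J : Set (LaurentRing p k d)))
    {ι : M →ₗ[S.ring] S.ring} (hι : Function.Injective ι)
    (h : ∃ e ∈ latticeOf ι J, ∀ x ∈ latticeOf ι J, ∃ s ∈ latticeRing S J, ∃ x' ∈ latticeOf ι J,
      x = s * e + (p : WittField p k) • x') :
    ∃ e : M, ∀ x, ∃ s : S.ring, x = s • e := by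
  obtain ⟨e, he, hL⟩ := h
  refine hS.exists_generator hι ⟨e, he, fun x hx => ?_⟩
  obtain ⟨s, hs, h1⟩ := LaurentRing.exists_mul_eq_of_isClosed (Q := latticeRing S J)
    (L := latticeOf ι J)    (fun s hs => hs.1.2) hQc (fun x hx => hx.2.1) hL hx
  exact ⟨s, hs.1.1, h1⟩

/-- The elements of the lattice are uniformly bounded combinations of finitely many of them. -/
theorem exists_finite_almost_span (hS : IsLatticeRing S J) [Module.Finite S.ring M]
    [Module.Projective S.ring M] (hSJ : S.toSubring ≤ (nonnegOn p k J).toSubring)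
    {ι : M →ₗ[S.ring] S.ring} (hι : Function.Injective ι) :
    ∃ (l : ℕ) (z : Fin l → LaurentRing p k d) (c : ℕ), (∀ j, z j ∈ latticeOf ι J) ∧
      ∀ x ∈ latticeOf ι J, ∃ s : Fin l → LaurentRing p k d, (∀ j, s j ∈ latticeRing S J) ∧
        (p : WittField p k) ^ c • x = ∑ j, s j * z j := by
  by_cases hM : Subsingleton M
  · refine ⟨0, Fin.elim0, 0, fun j => j.elim0, ?_⟩
    rintro _ ⟨⟨x, rfl⟩, -, -⟩
    refine ⟨Fin.elim0, fun j => j.elim0, ?_⟩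
    rw [Subsingleton.elim x 0, map_zero]
    simp
  rw [not_subsingleton_iff_nontrivial] at hM
  obtain ⟨x₀, hx₀⟩ := exists_ne (0 : M)
  have hx₀' : (ι x₀ : LaurentRing p k d) ≠ 0 := fun h =>
    hx₀ ((injective_iff_map_eq_zero ι).1 hι x₀ (Subtype.ext h))
  -- M is a direct summand of a finite free module. N₁ scales the generators F(e_j) into the
  -- lattice. The relation ι(x₀) G(x)_j = ι(x) G(x₀)_j bounds the coordinates uniformly for x in the
  -- lattice, and N₂ absorbs that bound.
  obtain ⟨l, F, G, -, -, hFG⟩ := Module.Finite.exists_comp_eq_id_of_projective S.ring M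
  have hp0 : ∀ N : ℕ, (p : WittField p k) ^ N ≠ 0 := fun N =>
    pow_ne_zero _ (WittField.p_ne_zero p k)
  choose N₁ hN₁ using fun j : Fin l => exists_norm_pow_smul_le
    (ι (F (Pi.single j 1)) : LaurentRing p k d) one_pos
  choose N₂ hN₂ using fun j : Fin l => exists_norm_pow_smul_le
    (((p : WittField p k) ^ N₁ j)⁻¹ • (G x₀ j : LaurentRing p k d)) (norm_pos_iff.2 hx₀')
  have hsmul : ∀ (c : WittField p k), ∀ s ∈ S.toSubring, c • s ∈ S.toSubring := fun c s hs => by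
    rw [smul_def']
    exact mul_mem (hS.monomial_mem _ _ fun _ _ => le_rfl) hs
  have hle : ∀ j, N₂ j ≤ ∑ j, N₂ j := fun j =>
    Finset.single_le_sum (fun _ _ => Nat.zero_le _) (Finset.mem_univ j)
  set N₃ := ∑ j, N₂ j
  refine ⟨l, fun j => (p : WittField p k) ^ N₁ j • (ι (F (Pi.single j 1)) : LaurentRing p k d),
    N₃, fun j => ⟨⟨(⟨monomial 0 ((p : WittField p k) ^ N₁ j),
      hS.monomial_mem _ _ fun _ _ => le_rfl⟩ : S.ring) • F (Pi.single j 1), ?_⟩, hN₁ j _ le_rfl,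
      smul_mem_nonnegOn _ (hSJ (Subtype.property _))⟩, ?_⟩
  · exact coe_map_smul _ _ _
  · rintro _ ⟨⟨x, rfl⟩, hx1, hxJ⟩
    have hmem : ∀ j, (p : WittField p k) ^ N₃ • ((p : WittField p k) ^ N₁ j)⁻¹ •
        (G x j : LaurentRing p k d) ∈ S.toSubring := fun j =>
      hsmul _ _ (hsmul _ _ (Subtype.property _))
    refine ⟨fun j => (p : WittField p k) ^ N₃ • ((p : WittField p k) ^ N₁ j)⁻¹ •
      (G x j : LaurentRing p k d), fun j => ⟨⟨hmem j, ?_⟩, hSJ (hmem j)⟩, ?_⟩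
    · change ‖_‖ ≤ 1
      have h1 : (ι x₀ : LaurentRing p k d) * (G x j : LaurentRing p k d) =
          (ι x : LaurentRing p k d) * (G x₀ j : LaurentRing p k d) := by
        have h2 := congrFun (congrArg G (smul_eq_smul_of_injective hι x₀ x)) j
        rw [map_smul, map_smul] at h2
        exact congrArg Subtype.val h2
      have h3 : ‖(ι x₀ : LaurentRing p k d)‖ * ‖(p : WittField p k) ^ N₃ •
          ((p : WittField p k) ^ N₁ j)⁻¹ • (G x j : LaurentRing p k d)‖ ≤
          ‖(ι x₀ : LaurentRing p k d)‖ := by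
        rw [← norm_mul, mul_smul_comm, mul_smul_comm, h1, ← mul_smul_comm, ← mul_smul_comm,
          norm_mul]
        exact (mul_le_mul hx1 (hN₂ j _ (hle j)) (norm_nonneg _) zero_le_one).trans_eq (one_mul _)
      exact le_of_mul_le_mul_left (h3.trans_eq (mul_one _).symm) (norm_pos_iff.2 hx₀')
    · have h1 : x = ∑ j, (G x j) • F (Pi.single j 1) := by
        have h2 := LinearMap.congr_fun hFG x
        rw [LinearMap.comp_apply, LinearMap.id_apply] at h2
        conv_lhs => rw [← h2, pi_eq_sum_univ' (G x), map_sum]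
        refine Finset.sum_congr rfl fun j _ => ?_
        rw [map_smul]
      have h3 : (ι x : LaurentRing p k d) = ∑ j, (G x j : LaurentRing p k d) *
          (ι (F (Pi.single j 1)) : LaurentRing p k d) := by
        conv_lhs => rw [h1]
        rw [map_sum]
        refine (map_sum S.toSubring.subtype _ _).trans (Finset.sum_congr rfl fun j _ => ?_)
        exact coe_map_smul _ _ _
      rw [h3, Finset.smul_sum]
      refine Finset.sum_congr rfl fun j _ => ?_
      rw [smul_mul_assoc, smul_mul_smul_comm, inv_mul_cancel₀ (hp0 _), one_smul]

/-- Nakayama's lemma replaces completeness. The lattice need not be finitely generated over Q, so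
the lemma is applied to the span N of the z_j, which contains p^c times the lattice. Multiplication
by p^c is harmless in the end because p is invertible in S. -/
theorem exists_generator_of_jacobson (hS : IsLatticeRing S J) [Module.Finite S.ring M]
    [Module.Projective S.ring M] (hSJ : S.toSubring ≤ (nonnegOn p k J).toSubring)
    (hjac : ∀ x ∈ S.toSubring, ‖x - 1‖ < 1 → ∃ y ∈ S.toSubring, x * y = 1 ∧ ‖y‖ ≤ 1)
    {ι : M →ₗ[S.ring] S.ring} (hι : Function.Injective ι)
    (h : ∃ e ∈ latticeOf ι J, ∀ x ∈ latticeOf ι J, ∃ s ∈ latticeRing S J, ∃ x' ∈ latticeOf ι J,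
      x = s * e + (p : WittField p k) • x') :
    ∃ e : M, ∀ x, ∃ s : S.ring, x = s • e := by
  obtain ⟨e, he, hL⟩ := h
  obtain ⟨l, z, c, hz, hspan⟩ := hS.exists_finite_almost_span hSJ hι
  set Q := latticeRing S J with hQ
  have hQp : (monomial 0 (p : WittField p k) : LaurentRing p k d) ∈ Q :=
    ⟨⟨hS.monomial_mem _ _ fun _ _ => le_rfl, by
      change ‖_‖ ≤ 1
      rw [norm_monomial]
      exact (WittField.norm_p_lt_one).le⟩, monomial_mem_nonnegOn (fun _ _ => le_rfl) _⟩
  have hiter : ∀ N : ℕ, ∀ x ∈ latticeOf ι J, ∃ s ∈ Q, ∃ x' ∈ latticeOf ι J,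
      x = s * e + (p : WittField p k) ^ N • x' := by
    intro N
    induction N with
    | zero => exact fun x hx => ⟨0, zero_mem _, x, hx, by simp⟩
    | succ N ih =>
      intro x hx
      obtain ⟨s, hs, x', hx', rfl⟩ := ih x hx
      obtain ⟨s', hs', x'', hx'', rfl⟩ := hL x' hx'
      refine ⟨s + monomial 0 (p : WittField p k) ^ N * s', add_mem hs
        (mul_mem (pow_mem hQp _) hs'), x'', hx'', ?_⟩
      have h5 : (monomial 0 ((p : WittField p k) ^ N) : LaurentRing p k d) =
        monomial 0 (p : WittField p k) ^ N := map_pow (RestrictedSeries.const) _ _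
      rw [smul_add, ← mul_smul, ← pow_succ, smul_def' _ (s' * e), h5]
      ring
  let E : Submodule Q (LaurentRing p k d) := Submodule.span Q {e}
  let N : Submodule Q (LaurentRing p k d) := Submodule.span Q (Set.range z)
  let I : Ideal Q := Ideal.span {⟨_, hQp⟩}
  -- Elements 1 + p y are principal units, which `hjac` inverts within the unit ball.
  have hI : I ≤ Ideal.jacobson ⊥ := by
    rw [Ideal.span_singleton_le_iff_mem, Ideal.mem_jacobson_bot]
    intro y
    have hy1 : ‖(monomial 0 (p : WittField p k) * y.1 + 1 : LaurentRing p k d) - 1‖ < 1 := by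
      rw [add_sub_cancel_right, norm_mul, norm_monomial]
      exact (mul_le_of_le_one_right (norm_nonneg _) y.2.1.2).trans_lt (WittField.norm_p_lt_one)
    obtain ⟨w, hw, hyw, hw1⟩ := hjac _ (add_mem (mul_mem hQp.1.1 y.2.1.1) (one_mem _)) hy1
    exact IsUnit.of_mul_eq_one ⟨w, ⟨hw, hw1⟩, hSJ hw⟩ (Subtype.ext hyw)
  have hle : N ≤ E ⊔ I • N := by
    rw [Submodule.span_le]
    rintro _ ⟨j, rfl⟩
    -- Of the factor p^(1+c), the part p^c carries x' into N and one p remains for the ideal I.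
    obtain ⟨s, hs, x', hx', hx⟩ := hiter (1 + c) (z j) (hz j)
    obtain ⟨t, ht, htx⟩ := hspan x' hx'
    rw [hx, pow_add, pow_one, mul_smul, htx]
    refine add_mem (Submodule.mem_sup_left (Submodule.mem_span_singleton.2 ⟨⟨s, hs⟩, rfl⟩))
      (Submodule.mem_sup_right ?_)
    rw [smul_def']
    exact Submodule.smul_mem_smul (r := (⟨_, hQp⟩ : Q)) (Ideal.mem_span_singleton_self _)
      (sum_mem fun j _ => Submodule.smul_mem N (⟨t j, ht j⟩ : Q) (Submodule.subset_span ⟨j, rfl⟩))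
  have hNE : N ≤ E := Submodule.le_of_le_smul_of_le_jacobson_bot
    (Submodule.fg_span (Set.finite_range z)) hI hle
  refine hS.exists_generator hι ⟨e, he, fun x hx => ?_⟩
  obtain ⟨t, ht, htx⟩ := hspan x hx
  have h1 : (p : WittField p k) ^ c • x ∈ E := htx ▸ hNE
    (sum_mem fun j _ => Submodule.smul_mem N (⟨t j, ht j⟩ : Q) (Submodule.subset_span ⟨j, rfl⟩))
  obtain ⟨s, hs⟩ := Submodule.mem_span_singleton.1 h1
  refine ⟨monomial 0 ((p : WittField p k) ^ c)⁻¹ * s.1, mul_mem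
    (hS.monomial_mem _ _ fun _ _ => le_rfl) s.2.1.1, ?_⟩
  change s.1 * e = _ at hs
  rw [mul_assoc, hs, ← smul_def', smul_smul, inv_mul_cancel₀
    (pow_ne_zero _ (WittField.p_ne_zero p k)), one_smul]

end IsLatticeRing

/-- Every module of rank one with Frobenius over `𝒜^r` is generated by one element. -/
theorem exists_generator_of_rank_one {n m : ℕ} {r : ℝ} {f : ℕ} (hf : 0 < f) {M : Type*}
    [AddCommGroup M] [Module (logDecayRing p k n m r).ring M]
    [Module.Finite (logDecayRing p k n m r).ring M]
    [Module.Projective (logDecayRing p k n m r).ring M]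
    (hrank : Module.finrank (logDecayRing p k n m r).ring M = 1)
    {φ : M →ₛₗ[(logDecayRing p k n m r).sigma ^ f] M}
    (hspan : Submodule.span (logDecayRing p k n m r).ring (Set.range φ) = ⊤) :
    ∃ e : M, ∀ x, ∃ s : (logDecayRing p k n m r).ring, x = s • e := by
  have : IsDomain (logDecayRing p k n m r).ring :=
    inferInstanceAs (IsDomain (logDecayRing p k n m r).toSubring)
  obtain ⟨ι, hι⟩ := exists_injective_of_finrank_eq_one hrank
  have : Nontrivial M := Module.nontrivial_of_finrank_pos (R := (logDecayRing p k n m r).ring)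
    (by rw [hrank]; exact one_pos)
  -- When J consists of all variables, the lattice ring is the unit ball of the Tate algebra,
  -- whatever r is.
  have hclosed : IsClosed (latticeRing (logDecayRing p k n m r) Set.univ :
      Set (LaurentRing p k (n + m))) := by
    have : (latticeRing (logDecayRing p k n m r) Set.univ : Set (LaurentRing p k (n + m))) =
        (unitBall p k (n + m) : Set (LaurentRing p k (n + m))) ∩
          ((nonnegOn p k (d := n + m) Set.univ).toSubring : Set (LaurentRing p k (n + m))) := by
      ext x
      exact ⟨fun h => ⟨h.1.2, h.2⟩, fun h => ⟨⟨tateAlgebra_le_logDecayRing p k n m r h.2, h.1⟩, h.2⟩⟩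
    rw [this]
    exact isClosed_unitBall.inter (isClosed_nonnegOn _)
  rcases lt_trichotomy r 0 with hr | rfl | hr
  · have hS := isLatticeRing_of_neg (p := p) (k := k) (n := n) (m := m) hr
    exact hS.exists_generator_of_isClosed hclosed hι (hS.exists_lattice_generator hf hspan hι)
  · have hS := isLatticeRing_zero (p := p) (k := k) (n := n) (m := m)
    exact hS.exists_generator_of_isClosed hclosed hι (hS.exists_lattice_generator hf hspan hι)
  · have hS := isLatticeRing_of_pos (p := p) (k := k) (n := n) (m := m) hr
    exact hS.exists_generator_of_jacobson (fun x hx => hx.1)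
      (fun x hx h1 => exists_inverse_mem_logDecayRing hr hx h1) hι
      (hS.exists_lattice_generator hf hspan hι)

end Generators

end

end LogDecay

namespace LogDecay

noncomputable section

set_option linter.unusedSectionVars false

/-! ### Linearizations of semilinear maps -/

section Linearization

variable {R S : Type*} [CommRing R] [CommRing S] {σ : R →+* S} {M N : Type*}
    [AddCommGroup M] [Module R M] [AddCommGroup N] [Module S N]

theorem IsLinearizationIso.span_range_eq_top {φ : M →ₛₗ[σ] N} (h : IsLinearizationIso φ) :
    Submodule.span S (Set.range φ) = ⊤ := by
  let _ : Algebra R S := σ.toAlgebra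
  let _ : Module R N := Module.compHom N σ
  have : IsScalarTower R S N := ⟨fun a b c => mul_smul (σ a) b c⟩
  refine eq_top_iff.2 fun x _ => ?_
  unfold IsLinearizationIso at h
  refine IsBaseChange.inductionOn h x _ ?_ ?_ ?_ ?_
  · exact zero_mem _
  · exact fun m => Submodule.subset_span ⟨m, rfl⟩
  · exact fun s n hn => Submodule.smul_mem _ s hn
  · exact fun n n' hn hn' => add_mem hn hn'

/-- A semilinear map between free modules of rank one that sends a basis to a basis. -/
theorem isLinearizationIso_of_bijective {φ : M →ₛₗ[σ] N} {e : M}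
    (he : Function.Bijective fun r : R => r • e)
    (he' : Function.Bijective fun s : S => s • φ e) : IsLinearizationIso φ := by
  let _ : Algebra R S := σ.toAlgebra
  let _ : Module R N := Module.compHom N σ
  have : IsScalarTower R S N := ⟨fun a b c => mul_smul (σ a) b c⟩
  let eM : R ≃ₗ[R] M := LinearEquiv.ofBijective (LinearMap.toSpanSingleton R M e) he
  let eN : S ≃ₗ[S] N := LinearEquiv.ofBijective (LinearMap.toSpanSingleton S N (φ e)) he'
  unfold IsLinearizationIso
  refine (IsBaseChange.iff_of_equiv_comm eM eN ?_).1 (IsBaseChange.linearMap R S)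
  refine LinearMap.ext fun r => ?_
  change φ (r • e) = σ r • φ e
  rw [LinearMap.map_smulₛₗ]

theorem bijective_units_smul {e : M} (he : Function.Bijective fun r : R => r • e) (u : Rˣ) :
    Function.Bijective fun r : R => r • u.1 • e := by
  have : (fun r : R => r • u.1 • e) = (fun r : R => r • e) ∘ (fun r => r * u.1) := by
    ext r
    exact (mul_smul r u.1 e).symm
  rw [this]
  exact he.comp (Units.mulRight_bijective u)

end Linearization

/-! ### Rank one modules in terms of a basis -/

section Frames

variable {p : ℕ} [Fact p.Prime] {k : Type u} [Field k] [CharP k p] [PerfectRing k p] {d : ℕ}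

open RestrictedSeries

theorem LaurentRing.T_pow (i : Fin d) (c : ℕ) :
    LaurentRing.T p k i ^ c = monomial (c • Pi.single i 1) 1 := by
  induction c with
  | zero => rw [pow_zero, zero_smul]; rfl
  | succ c ih => rw [pow_succ, ih, LaurentRing.T, monomial_mul_monomial, mul_one, succ_nsmul]

theorem natCast_mul_eq_smul (c : ℕ) (x : LaurentRing p k d) :
    (c : LaurentRing p k d) * x = (c : WittField p k) • x := by
  rw [Algebra.smul_def, map_natCast]

/-- The derivative of `σ^f(x)`. -/
theorem LaurentRing.pderiv_sigmaPow (f : ℕ) (i : Fin d) (x : LaurentRing p k d) :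
    pderiv i (sigmaPow p k d f x) =
      ((p ^ f : ℕ) : LaurentRing p k d) * LaurentRing.T p k i ^ (p ^ f - 1) *
        sigmaPow p k d f (pderiv i x) := by
  have hq : 1 ≤ p ^ f := pow_f_pos p f
  ext u
  rw [mul_assoc, natCast_mul_eq_smul, LaurentRing.T_pow, coeff_smul, coeff_monomial_mul, one_mul,
    coeff_pderiv]
  have hs : u - (p ^ f - 1) • Pi.single i 1 = u + Pi.single i 1 - p ^ f • Pi.single i 1 := by
    conv_rhs => rw [← Nat.sub_add_cancel hq, add_smul, one_smul]
    abel
  rw [hs]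
  by_cases h : ∃ v, p ^ f • v = u + Pi.single i 1
  · obtain ⟨v, hv⟩ := h
    have hvi := congrFun hv i
    rw [natSmul_apply, Pi.add_apply, Pi.single_eq_same] at hvi
    rw [← hvi, ← hv, ← smul_sub, coeff_sigmaPow, coeff_sigmaPow, coeff_pderiv, sub_add_cancel,
      map_mul, map_intCast, Pi.sub_apply, Pi.single_eq_same, sub_add_cancel]
    push_cast
    ring
  · rw [coeff_sigmaPow_of_ne f x fun v hv => h ⟨v, hv⟩, coeff_sigmaPow_of_ne, mul_zero, mul_zero]
    intro v hv
    exact h ⟨v + Pi.single i 1, by rw [smul_add, hv, sub_add_cancel]⟩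

theorem FrobDiffSubring.pderiv_sigma_pow (S : FrobDiffSubring p k d) (f : ℕ) (i : Fin d)
    (x : S.ring) : S.pderiv i ((S.sigma ^ f) x) =
      ((p ^ f : ℕ) : S.ring) * S.T i ^ (p ^ f - 1) * (S.sigma ^ f) (S.pderiv i x) := by
  refine Subtype.ext ?_
  have h := LaurentRing.pderiv_sigmaPow f i x.1
  rw [← FrobDiffSubring.coe_sigma_pow] at h
  refine h.trans ?_
  rw [Subring.coe_mul, FrobDiffSubring.coe_sigma_pow]
  rfl

/-- The compatibility of the Frobenius `e ↦ a e` with the connection `∇_i(e) = b_i e`. -/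
def IsCompatible (S : FrobDiffSubring p k d) (f : ℕ) (a : S.ring) (b : Fin d → S.ring) : Prop :=
  ∀ i, S.pderiv i a + a * b i =
    ((p ^ f : ℕ) : S.ring) * S.T i ^ (p ^ f - 1) * (S.sigma ^ f) (b i) * a

variable {S : FrobDiffSubring p k d} {f : ℕ}

/-- Divided by a, the condition is linear in b and the logarithmic derivative of a, both of which
are multiplied by t + 1. -/
theorem IsCompatible.pow {a : S.ring} {b : Fin d → S.ring} (h : IsCompatible S f a b) (t : ℕ) :
    IsCompatible S f (a ^ (t + 1)) fun i => ((t + 1 : ℕ) : S.ring) * b i := by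
  intro i
  have h1 := h i
  rw [Derivation.leibniz_pow, map_mul, map_natCast, Nat.add_sub_cancel, smul_eq_mul, nsmul_eq_mul]
  linear_combination ((t + 1 : ℕ) : S.ring) * a ^ t * h1

/-- The effect of a change of the basis element by a unit `g`. -/
theorem IsCompatible.gauge {a a' : S.ring} {b b' : Fin d → S.ring} (h : IsCompatible S f a b)
    (g : S.ringˣ) (ha : a' * g = (S.sigma ^ f) g * a)
    (hb : ∀ i, b' i * g = S.pderiv i g + g * b i) : IsCompatible S f a' b' := by
  intro i
  have h1 := h i
  have h2 := congrArg (S.pderiv i) ha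
  have h3 := congrArg (S.sigma ^ f) (hb i)
  rw [Derivation.leibniz, Derivation.leibniz, S.pderiv_sigma_pow] at h2
  simp only [smul_eq_mul, map_mul, map_add] at h2 h3
  -- The identity is verified after multiplication by g σ^f(g), which avoids inverses.
  have hg : IsUnit (g.1 * (S.sigma ^ f) g.1) := g.isUnit.mul (g.isUnit.map _)
  refine hg.mul_left_cancel ?_
  have h4 := hb i
  linear_combination (S.sigma ^ f) g.1 * h2 + (S.sigma ^ f) g.1 * a' * h4 +
    (S.sigma ^ f) g.1 ^ 2 * h1 + (S.sigma ^ f) g.1 * b i * ha -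
    ((p ^ f : ℕ) : S.ring) * S.T i ^ (p ^ f - 1) * (g.1 * a' * h3 +
      ((S.sigma ^ f) (S.pderiv i g.1) + (S.sigma ^ f) g.1 * (S.sigma ^ f) (b i)) * ha)

/-- `S` with the Frobenius `x ↦ u σ^f(x)` and the connection `x ↦ ∂x/∂T_i + b_i x`. -/
def rankOneModule (S : FrobDiffSubring p k d) (f : ℕ) (a : S.ring) (b : Fin d → S.ring) :
    PreSigmaNablaModule.{u, u} S f where
  carrier := S.ring
  frob :=
    { toFun := fun x => a * (S.sigma ^ f) x
      map_add' := fun x y => by rw [map_add, mul_add]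
      map_smul' := fun s x => by
        simp only [smul_eq_mul, map_mul]
        ring }
  conn i := AddMonoidHom.mk' (fun x => S.pderiv i x + b i * x) fun x y => by
    rw [map_add]
    ring
  leibniz i s x := by
    simp only [AddMonoidHom.mk'_apply, smul_eq_mul, Derivation.leibniz]
    ring

theorem rankOneModule_frob (a : S.ring) (b : Fin d → S.ring) (x : S.ring) :
    (rankOneModule S f a b).frob x = a * (S.sigma ^ f) x := rfl

theorem isSigmaNablaModule_rankOneModule {a : S.ring} (ha : IsUnit a) {b : Fin d → S.ring}
    (h : IsCompatible S f a b) : (rankOneModule S f a b).IsSigmaNablaModule where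
  finite := inferInstanceAs (Module.Finite S.ring S.ring)
  projective := inferInstanceAs (Module.Projective S.ring S.ring)
  linearization := by
    obtain ⟨u, rfl⟩ := ha
    have h1 : Function.Bijective fun r : S.ring => r • (1 : S.ring) := by
      have h2 : (fun r : S.ring => r • (1 : S.ring)) = id := funext mul_one
      rw [h2]
      exact Function.bijective_id
    refine isLinearizationIso_of_bijective (e := (1 : S.ring)) h1 ?_
    have h2 := bijective_units_smul h1 u
    have h3 : (rankOneModule S f u b).frob (1 : S.ring) = u.1 • (1 : S.ring) := by
      rw [rankOneModule_frob, map_one]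
      rfl
    rw [h3]
    exact h2
  compat i := by
    change ∀ x : S.ring, S.pderiv i (a * (S.sigma ^ f) x) + b i * (a * (S.sigma ^ f) x) =
      (((p ^ f : ℕ) : S.ring) * S.T i ^ (p ^ f - 1)) *
        (a * (S.sigma ^ f) (S.pderiv i x + b i * x))
    intro x
    have h1 := h i
    rw [Derivation.leibniz, S.pderiv_sigma_pow, map_add, map_mul, smul_eq_mul, smul_eq_mul]
    linear_combination (S.sigma ^ f) x * h1

namespace PreSigmaNablaModule

/-- The element `e` is a basis of `M`, with `φ(e) = a e` and `∇_i(e) = b_i e`. -/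
structure IsFrame (M : PreSigmaNablaModule.{u, v} S f) (e : M.carrier) (a : S.ring)
    (b : Fin d → S.ring) : Prop where
  bijective : Function.Bijective fun s : S.ring => s • e
  frob_eq : M.frob e = a • e
  conn_eq : ∀ i, M.conn i e = b i • e

theorem IsFrame.tensor {M N : PreSigmaNablaModule.{u, v} S f} {e : M.carrier} {e' : N.carrier}
    {a a' : S.ring} {b b' : Fin d → S.ring} (h : M.IsFrame e a b) (h' : N.IsFrame e' a' b') :
    (M.tensor N).IsFrame (e ⊗ₜ[S.ring] e') (a * a') (fun i => b i + b' i) where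
  bijective := by
    let E : S.ring ≃ₗ[S.ring] M.carrier :=
      LinearEquiv.ofBijective (LinearMap.toSpanSingleton S.ring _ e) h.bijective
    let E' : S.ring ≃ₗ[S.ring] N.carrier :=
      LinearEquiv.ofBijective (LinearMap.toSpanSingleton S.ring _ e') h'.bijective
    have h1 := ((TensorProduct.lid S.ring S.ring).symm.trans
      (TensorProduct.congr E E')).bijective
    have h2 : (fun s : S.ring => s • (e ⊗ₜ[S.ring] e')) =
        (TensorProduct.lid S.ring S.ring).symm.trans (TensorProduct.congr E E') := by
      funext s
      change s • (e ⊗ₜ[S.ring] e') = ((1 : S.ring) • e) ⊗ₜ (s • e')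
      rw [one_smul, TensorProduct.tmul_smul]
    rw [← h2] at h1
    exact h1
  frob_eq := by
    change M.frob e ⊗ₜ[S.ring] N.frob e' = (a * a') • (e ⊗ₜ[S.ring] e')
    rw [h.frob_eq, h'.frob_eq, TensorProduct.smul_tmul_smul]
  conn_eq i := by
    change M.conn i e ⊗ₜ[S.ring] e' + e ⊗ₜ[S.ring] N.conn i e' =
      (b i + b' i) • (e ⊗ₜ[S.ring] e')
    rw [h.conn_eq, h'.conn_eq, TensorProduct.tmul_smul, add_smul, TensorProduct.smul_tmul',
      TensorProduct.smul_tmul']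

theorem IsFrame.tensorPowSucc {M : PreSigmaNablaModule.{u, v} S f} {e : M.carrier} {a : S.ring}
    {b : Fin d → S.ring} (h : M.IsFrame e a b) (t : ℕ) :
    ∃ e', (M.tensorPowSucc t).IsFrame e' (a ^ (t + 1)) fun i => ((t + 1 : ℕ) : S.ring) * b i := by
  induction t with
  | zero =>
    refine ⟨e, ?_⟩
    have h1 : (fun i => ((0 + 1 : ℕ) : S.ring) * b i) = b := funext fun i => by simp
    rw [h1, zero_add, pow_one]
    exact h
  | succ t ih =>
    obtain ⟨e', he'⟩ := ih
    refine ⟨(e' ⊗ₜ[S.ring] e : (M.tensorPowSucc t).carrier ⊗[S.ring] M.carrier), ?_⟩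
    have h1 : (fun i => ((t + 1 + 1 : ℕ) : S.ring) * b i) =
        fun i => ((t + 1 : ℕ) : S.ring) * b i + b i := by
      funext i
      push_cast
      ring
    rw [h1, pow_succ]
    exact he'.tensor h

theorem IsFrame.gauge {M : PreSigmaNablaModule.{u, v} S f} {e : M.carrier} {a a' : S.ring}
    {b b' : Fin d → S.ring} (h : M.IsFrame e a b) (g : S.ringˣ)
    (ha : a' * g = (S.sigma ^ f) g * a) (hb : ∀ i, b' i * g = S.pderiv i g + g * b i) :
    M.IsFrame (g.1 • e) a' b' where
  bijective := bijective_units_smul h.bijective g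
  frob_eq := by rw [LinearMap.map_smulₛₗ, h.frob_eq, smul_smul, smul_smul, ha]
  conn_eq i := by rw [M.leibniz, h.conn_eq, smul_smul, smul_smul, ← add_smul, hb]

theorem IsFrame.isCompatible {M : PreSigmaNablaModule.{u, v} S f} {e : M.carrier} {a : S.ring}
    {b : Fin d → S.ring} (h : M.IsFrame e a b) (hM : M.IsSigmaNablaModule) :
    IsCompatible S f a b := by
  intro i
  apply h.bijective.1
  have h1 := hM.compat i e
  rw [h.frob_eq, h.conn_eq, M.leibniz, h.conn_eq, LinearMap.map_smulₛₗ, h.frob_eq] at h1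
  simp only [smul_smul, ← add_smul] at h1
  simp only
  rw [h1]
  congr 1
  ring

/-- The image of φ spans M and lies in the span of a e, so e is a multiple of a e. -/
theorem IsFrame.isUnit {M : PreSigmaNablaModule.{u, v} S f} {e : M.carrier} {a : S.ring}
    {b : Fin d → S.ring} (h : M.IsFrame e a b) (hM : M.IsSigmaNablaModule) : IsUnit a := by
  have h1 : e ∈ Submodule.span S.ring (Set.range M.frob) :=
    hM.linearization.span_range_eq_top ▸ Submodule.mem_top
  have h2 : Submodule.span S.ring (Set.range M.frob) ≤ Submodule.span S.ring {a • e} := by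
    rw [Submodule.span_le]
    rintro _ ⟨x, rfl⟩
    obtain ⟨s, rfl⟩ := h.bijective.2 x
    rw [LinearMap.map_smulₛₗ, h.frob_eq]
    exact Submodule.smul_mem _ _ (Submodule.mem_span_singleton_self _)
  obtain ⟨s, hs⟩ := Submodule.mem_span_singleton.1 (h2 h1)
  rw [smul_smul] at hs
  refine IsUnit.of_mul_eq_one s (h.bijective.1 ?_)
  simp only
  rw [mul_comm, hs, one_smul]

theorem exists_isFrame {n m f : ℕ} {r : ℝ} (hf : 0 < f)
    {M : PreSigmaNablaModule.{u, v} (logDecayRing p k n m r) f} (hM : M.IsSigmaNablaModule)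
    (hrank : M.IsRankOne) : ∃ e a b, M.IsFrame e a b := by
  have : IsDomain (logDecayRing p k n m r).ring :=
    inferInstanceAs (IsDomain (logDecayRing p k n m r).toSubring)
  have := hM.finite
  have := hM.projective
  -- Over a domain the rank is read off at the generic point.
  have h1 : Module.finrank (logDecayRing p k n m r).ring M.carrier = 1 := by
    rw [← Ideal.finrank_fiber_eq_finrank (⊥ : Ideal (logDecayRing p k n m r).ring),
      Ideal.finrank_fiber_eq_rankAtStalk]
    exact hrank _
  obtain ⟨e, he⟩ := exists_generator_of_rank_one hf h1 hM.linearization.span_range_eq_top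
  obtain ⟨ι, hι⟩ := exists_injective_of_finrank_eq_one h1
  have : Nontrivial M.carrier := Module.nontrivial_of_finrank_pos
    (R := (logDecayRing p k n m r).ring) (by rw [h1]; exact one_pos)
  have he0 : e ≠ 0 := by
    rintro rfl
    obtain ⟨x, hx⟩ := exists_ne (0 : M.carrier)
    obtain ⟨s, hs⟩ := he x
    exact hx (by rw [hs, smul_zero])
  choose s hs using he
  refine ⟨e, s (M.frob e), fun i => s (M.conn i e), ⟨fun a b hab => ?_, fun x => ⟨s x, (hs x).symm⟩⟩,
    hs _, fun i => hs _⟩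
  exact smul_left_injective _ he0 hab

end PreSigmaNablaModule

end Frames

end

end LogDecay

namespace LogDecay

noncomputable section

set_option linter.unusedSectionVars false

/-! ### Descent to the Tate algebra -/

section Descent

variable {p : ℕ} [Fact p.Prime] {k : Type u} [Field k] [CharP k p] [PerfectRing k p] {d : ℕ}

open RestrictedSeries

/-- Coefficients that are always exceeded by others vanish. -/
theorem coeff_eq_zero_of_contraction {y : LaurentRing p k d} {s : Set (Fin d → ℤ)}
    (h : ∀ v ∈ s, y.coeff v ≠ 0 → ∃ v' ∈ s, ‖y.coeff v‖ < ‖y.coeff v'‖) {v : Fin d → ℤ}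
    (hv : v ∈ s) : y.coeff v = 0 := by
  by_contra h0
  have hfin := (y.finite_le_norm (norm_pos_iff.2 h0)).inter_of_left s
  obtain ⟨u, hu, hmax⟩ := hfin.toFinset.exists_max_image (fun u => ‖y.coeff u‖) ⟨v, by simp [hv]⟩
  simp only [Set.Finite.mem_toFinset, Set.mem_inter_iff, Set.mem_ofPred_eq] at hu hmax
  obtain ⟨w, hws, hw⟩ := h u hu.2 (norm_pos_iff.1 ((norm_pos_iff.2 h0).trans_le hu.1))
  exact absurd (hmax w ⟨hu.1.trans hw.le, hws⟩) (not_le.2 hw)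

theorem norm_natCast_pow_lt_one {f : ℕ} (hf : 0 < f) :
    ‖((p ^ f : ℕ) : WittField p k)‖ < 1 := by
  rw [Nat.cast_pow, norm_pow]
  exact pow_lt_one₀ (norm_nonneg _) WittField.norm_p_lt_one hf.ne'

/-- If the Frobenius is given by a unit of the Tate algebra, then the connection is defined over
the Tate algebra. -/
theorem mem_tateAlgebra_of_compatible {f : ℕ} (hf : 0 < f) {a c b : LaurentRing p k d}
    (ha : a ∈ (tateAlgebra p k d).toSubring) (hc : c ∈ (tateAlgebra p k d).toSubring)
    (hac : a * c = 1) {i : Fin d}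
    (h : pderiv i a + a * b = ((p ^ f : ℕ) : LaurentRing p k d) *
      LaurentRing.T p k i ^ (p ^ f - 1) * LaurentRing.sigmaPow p k d f b * a) :
    b ∈ (tateAlgebra p k d).toSubring := by
  -- The last term lies in the Tate algebra. At an exponent v with a negative entry, b_v is
  -- therefore 0 or q times a conjugate of b_w with q w = v - (q-1) e_i. Then w has a negative entry
  -- too, and |b_w| > |b_v| because |q| < 1.
  have hb : b = ((p ^ f : ℕ) : LaurentRing p k d) *
      (LaurentRing.T p k i ^ (p ^ f - 1) * LaurentRing.sigmaPow p k d f b) - c * pderiv i a := by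
    linear_combination c * h - (b - ((p ^ f : ℕ) : LaurentRing p k d) *
      LaurentRing.T p k i ^ (p ^ f - 1) * LaurentRing.sigmaPow p k d f b) * hac
  have hd : c * pderiv i a ∈ (tateAlgebra p k d).toSubring :=
    mul_mem hc ((tateAlgebra p k d).pderiv_mem i a ha)
  intro v hv
  by_contra hneg
  refine hv (coeff_eq_zero_of_contraction (s := {v | ¬ ∀ i ∈ Set.univ, 0 ≤ v i}) ?_ hneg)
  intro v hv hbv
  have hq : (1 : ℤ) ≤ (p ^ f : ℕ) := by exact_mod_cast pow_f_pos p f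
  have h1 : b.coeff v = ((p ^ f : ℕ) : WittField p k) *
      (LaurentRing.sigmaPow p k d f b).coeff (v - (p ^ f - 1) • Pi.single i 1) := by
    conv_lhs => rw [hb]
    rw [coeff_sub, natCast_mul_eq_smul, LaurentRing.T_pow, coeff_smul, coeff_monomial_mul, one_mul,
      sub_eq_self]
    by_contra h0
    exact hv (hd v h0)
  rw [h1] at hbv
  have h2 := right_ne_zero_of_mul hbv
  obtain ⟨w, hw⟩ : ∃ w, p ^ f • w = v - (p ^ f - 1) • Pi.single i 1 := by
    by_contra hcon
    push Not at hcon
    exact h2 (LaurentRing.coeff_sigmaPow_of_ne f b hcon)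
  rw [← hw, LaurentRing.coeff_sigmaPow] at h1 h2
  refine ⟨w, fun hpos => hv fun l _ => ?_, ?_⟩
  · have h3 := congrFun hw l
    rw [LaurentRing.natSmul_apply, Pi.sub_apply, LaurentRing.natSmul_apply] at h3
    have h4 : (0 : ℤ) ≤ (p ^ f : ℕ) * w l := mul_nonneg (by omega) (hpos l trivial)
    have h5 : (0 : ℤ) ≤ (p ^ f - 1 : ℕ) * (Pi.single i 1 : Fin d → ℤ) l := by
      refine mul_nonneg (Int.natCast_nonneg _) ?_
      rw [Pi.single_apply]
      split_ifs <;> simp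
    omega
  · rw [h1, norm_mul, WittField.norm_frobenius_pow]
    refine mul_lt_of_lt_one_left (norm_pos_iff.2 ?_) (norm_natCast_pow_lt_one hf)
    rintro h0
    exact h2 (by rw [h0, map_zero])

theorem IsCompatible.coe {S : FrobDiffSubring p k d} {f : ℕ} {a : S.ring} {b : Fin d → S.ring}
    (h : IsCompatible S f a b) (i : Fin d) :
    pderiv i a.1 + a.1 * (b i).1 = ((p ^ f : ℕ) : LaurentRing p k d) *
      LaurentRing.T p k i ^ (p ^ f - 1) * LaurentRing.sigmaPow p k d f (b i) * a.1 := by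
  have h1 := congrArg Subtype.val (h i)
  rw [Subring.coe_add, Subring.coe_mul, Subring.coe_mul, Subring.coe_mul,
    FrobDiffSubring.coe_sigma_pow] at h1
  exact h1

namespace PreSigmaNablaModule

/-- Descent of a free module of rank one to a subring over which its Frobenius and its connection
are defined. -/
theorem IsFrame.exists_isBaseChangeOf {S S' : FrobDiffSubring p k d} {f : ℕ}
    (h : S.toSubring ≤ S'.toSubring) {M : PreSigmaNablaModule.{u, v} S' f} {e : M.carrier}
    {a : S'.ring} {b : Fin d → S'.ring} (hM : M.IsFrame e a b) (hc : IsCompatible S' f a b)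
    (a₀ : S.ringˣ) (ha : a₀.1.1 = a) (hb : ∀ i, (b i : LaurentRing p k d) ∈ S.toSubring) :
    ∃ N : PreSigmaNablaModule.{u, u} S f, N.IsSigmaNablaModule ∧ IsBaseChangeOf h M N := by
  let b₀ : Fin d → S.ring := fun i => ⟨b i, hb i⟩
  have hai : Subring.inclusion h a₀.1 = a := Subtype.ext ha
  have hσ : ∀ x : S.ring, Subring.inclusion h ((S.sigma ^ f) x) =
      (S'.sigma ^ f) (Subring.inclusion h x) := fun x => Subtype.ext (by
    rw [FrobDiffSubring.coe_sigma_pow]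
    exact FrobDiffSubring.coe_sigma_pow S f x)
  have hcomp : IsCompatible S f a₀.1 b₀ := by
    intro i
    have h1 := hc.coe i
    refine Subtype.ext ?_
    rw [Subring.coe_add, Subring.coe_mul, Subring.coe_mul, Subring.coe_mul,
      FrobDiffSubring.coe_sigma_pow]
    rw [← ha] at h1
    exact h1
  refine ⟨rankOneModule S f a₀.1 b₀, isSigmaNablaModule_rankOneModule a₀.isUnit hcomp, ?_⟩
  let j : S.ring →ₛₗ[Subring.inclusion h] M.carrier :=
    { toFun := fun x => Subring.inclusion h x • e
      map_add' := fun x y => by rw [map_add, add_smul]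
      map_smul' := fun s x => by rw [smul_eq_mul, map_mul, mul_smul] }
  refine ⟨j, ?_, ?_, ?_⟩
  · change ∀ x : S.ring, Subring.inclusion h (a₀.1 * (S.sigma ^ f) x) • e =
      M.frob (Subring.inclusion h x • e)
    intro x
    rw [LinearMap.map_smulₛₗ, hM.frob_eq, smul_smul, map_mul, hai, hσ, mul_comm]
  · change ∀ (i : Fin d) (x : S.ring), Subring.inclusion h (S.pderiv i x + b₀ i * x) • e =
      M.conn i (Subring.inclusion h x • e)
    intro i x
    rw [M.leibniz, hM.conn_eq, smul_smul, ← add_smul]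
    congr 1
    refine Subtype.ext ?_
    change _ + (b i : LaurentRing p k d) * x.1 = _ + x.1 * (b i : LaurentRing p k d)
    rw [mul_comm]
    rfl
  · have h1 : Function.Bijective fun r : S.ring => r • (1 : S.ring) := by
      have h2 : (fun r : S.ring => r • (1 : S.ring)) = id := funext mul_one
      rw [h2]
      exact Function.bijective_id
    refine isLinearizationIso_of_bijective (e := (1 : S.ring)) h1 ?_
    change Function.Bijective fun s : S'.ring => s • Subring.inclusion h (1 : S.ring) • e
    rw [map_one, one_smul]
    exact hM.bijective

/-- A tensor power of a module of rank one is defined over the Tate algebra if the corresponding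
power of its Frobenius matrix is equivalent to a unit of the Tate algebra. -/
theorem IsFrame.exists_tate_model {S : FrobDiffSubring p k d} {f : ℕ} (hf : 0 < f)
    (h : (tateAlgebra p k d).toSubring ≤ S.toSubring)
    {M : PreSigmaNablaModule.{u, v} S f} {e : M.carrier}
    {a : S.ring} {b : Fin d → S.ring}
    (hM : M.IsFrame e a b) (hc : IsCompatible S f a b) (t : ℕ)
    (g : S.ringˣ) (u : (tateAlgebra p k d).ringˣ)
    (hu : u.1.1 * g.1.1 = LaurentRing.sigmaPow p k d f g.1.1 * a.1 ^ (t + 1)) :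
    ∃ N : PreSigmaNablaModule.{u, u} (tateAlgebra p k d) f, N.IsSigmaNablaModule ∧
      IsBaseChangeOf h (M.tensorPowSucc t) N := by
  obtain ⟨e', he'⟩ := hM.tensorPowSucc t
  let a' : S.ring := Subring.inclusion h u.1
  let b' : Fin d → S.ring := fun i =>
    g⁻¹.1 * (S.pderiv i g.1 + g.1 * (((t + 1 : ℕ) : S.ring) * b i))
  have ha : a' * g.1 = (S.sigma ^ f) g.1 * a ^ (t + 1) := Subtype.ext (by
    rw [Subring.coe_mul, Subring.coe_mul, FrobDiffSubring.coe_sigma_pow]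
    exact hu)
  have hb : ∀ i, b' i * g.1 =
      S.pderiv i g.1 + g.1 * (((t + 1 : ℕ) : S.ring) * b i) := fun i => by
    change g⁻¹.1 * _ * g.1 = _
    rw [mul_comm, ← mul_assoc, Units.mul_inv, one_mul]
  have hframe := he'.gauge g ha hb
  have hcomp := (hc.pow t).gauge g ha hb
  refine hframe.exists_isBaseChangeOf _ hcomp u rfl fun i => ?_
  exact mem_tateAlgebra_of_compatible hf u.1.2 u⁻¹.1.2 (congrArg Subtype.val u.mul_inv)
    (hcomp.coe i)

end PreSigmaNablaModule

end Descent

end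

end LogDecay

namespace LogDecay

noncomputable section

set_option linter.unusedSectionVars false

/-! ### The exponential on small series -/

section Exponential

variable {p : ℕ} [Fact p.Prime] {k : Type*} [Field k] [CharP k p] [PerfectRing k p]

open RestrictedSeries NormedSpace
open scoped Nat

instance : NontriviallyNormedField (WittField p k) where
  __ := (inferInstance : NormedField (WittField p k))
  non_trivial := ⟨(p : WittField p k)⁻¹, by
    rw [norm_inv]
    exact (one_lt_inv₀ WittField.norm_p_pos).2 WittField.norm_p_lt_one⟩

theorem WittField.norm_natCast_eq_one {m : ℕ} (hm : ¬ p ∣ m) : ‖(m : WittField p k)‖ = 1 := by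
  refine le_antisymm (IsUltrametricDist.norm_natCast_le_one _ m) (not_lt.1 fun hlt => ?_)
  have hco : IsCoprime (m : ℤ) (p : ℤ) := Nat.isCoprime_iff_coprime.2
    ((Nat.Prime.coprime_iff_not_dvd Fact.out).2 hm).symm
  obtain ⟨a, b, hab⟩ := hco
  have h1 : (a : WittField p k) * m + b * p = 1 := by exact_mod_cast congrArg (Int.cast) hab
  have h2 : ‖(a : WittField p k) * m + b * p‖ < 1 := by
    refine (IsUltrametricDist.norm_add_le_max _ _).trans_lt (max_lt ?_ ?_)
    · rw [norm_mul]
      exact (mul_le_of_le_one_left (norm_nonneg _)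
        (IsUltrametricDist.norm_intCast_le_one _ a)).trans_lt hlt
    · rw [norm_mul]
      exact (mul_le_of_le_one_left (norm_nonneg _)
        (IsUltrametricDist.norm_intCast_le_one _ b)).trans_lt WittField.norm_p_lt_one
  rw [h1, norm_one] at h2
  exact lt_irrefl _ h2

/-- The p-adic valuation of n! is at most n - 1 for n > 0, and truncated subtraction covers n = 0.
This crude bound holds for all p alike, including p = 2. -/
theorem WittField.norm_factorial_inv_le (n : ℕ) :
    ‖((n ! : ℕ) : WittField p k)⁻¹‖ * ‖(p : WittField p k)‖ ^ (n - 1) ≤ 1 := by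
  rcases Nat.eq_zero_or_pos n with rfl | hn
  · simp
  have h0 : n ! ≠ 0 := n.factorial_ne_zero
  have h1 := padicValNat_factorial_lt_of_ne_zero p hn.ne'
  obtain ⟨a, m, hm, ha⟩ := Nat.exists_eq_pow_mul_and_not_dvd h0 p (Fact.out : p.Prime).ne_one
  have h2 : padicValNat p n ! = a := by
    have hm0 : m ≠ 0 := fun h => hm (h ▸ dvd_zero p)
    rw [ha, padicValNat.mul (pow_ne_zero _ (Fact.out : p.Prime).ne_zero) hm0,
      padicValNat.prime_pow, padicValNat.eq_zero_of_not_dvd hm, add_zero]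
  rw [ha, Nat.cast_mul, Nat.cast_pow, norm_inv, norm_mul, norm_pow, norm_natCast_eq_one hm, mul_one,
    inv_mul_le_iff₀ (pow_pos norm_p_pos _), mul_one]
  exact pow_le_pow_of_le_one (norm_nonneg _) norm_p_lt_one.le (by omega)

theorem le_radius_expSeries {d : ℕ} :
    ((‖(p : WittField p k)‖₊ : ℝ≥0) : ENNReal) ≤
      (expSeries (WittField p k) (LaurentRing p k d)).radius := by
  refine FormalMultilinearSeries.le_radius_of_bound _ 1 fun n => ?_
  have h1 : ‖expSeries (WittField p k) (LaurentRing p k d) n‖ ≤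
      ‖((n ! : ℕ) : WittField p k)⁻¹‖ := by
    rw [expSeries, norm_smul]
    exact mul_le_of_le_one_right (norm_nonneg _)
      (ContinuousMultilinearMap.norm_mkPiAlgebraFin).le
  refine (mul_le_mul_of_nonneg_right h1 (by positivity)).trans ?_
  refine le_trans ?_ (WittField.norm_factorial_inv_le (p := p) (k := k) n)
  exact mul_le_mul_of_nonneg_left (pow_le_pow_of_le_one (norm_nonneg _)
    WittField.norm_p_lt_one.le (Nat.sub_le n 1)) (norm_nonneg _)

variable {d : ℕ} {x y : LaurentRing p k d}

/-- The radius of convergence is at least |p|, and |p|² is the next smaller value of the norm. -/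
theorem mem_eball_radius (hx : ‖x‖ ≤ ‖(p : WittField p k)‖ ^ 2) :
    x ∈ Metric.eball (0 : LaurentRing p k d)
      (expSeries (WittField p k) (LaurentRing p k d)).radius := by
  refine Metric.mem_eball.2 (lt_of_lt_of_le ?_ le_radius_expSeries)
  rw [edist_zero_right, enorm_eq_nnnorm]
  refine ENNReal.coe_lt_coe.2 (NNReal.coe_lt_coe.1 (hx.trans_lt ?_))
  rw [pow_two]
  exact mul_lt_of_lt_one_left WittField.norm_p_pos WittField.norm_p_lt_one

theorem hasSum_exp (hx : ‖x‖ ≤ ‖(p : WittField p k)‖ ^ 2) :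
    HasSum (fun n : ℕ => ((n ! : ℕ) : WittField p k)⁻¹ • x ^ n) (exp x) :=
  expSeries_hasSum_exp_of_mem_ball' x (mem_eball_radius hx)

theorem exp_add_of_norm_le (hx : ‖x‖ ≤ ‖(p : WittField p k)‖ ^ 2)
    (hy : ‖y‖ ≤ ‖(p : WittField p k)‖ ^ 2) : exp (x + y) = exp x * exp y :=
  exp_add_of_mem_ball (𝕂 := WittField p k) (mem_eball_radius hx) (mem_eball_radius hy)

theorem exp_mul_exp_neg (hx : ‖x‖ ≤ ‖(p : WittField p k)‖ ^ 2) : exp x * exp (-x) = 1 := by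
  rw [← exp_add_of_norm_le hx (by rwa [norm_neg]), add_neg_cancel, exp_zero]

/-- Although σ^f is only semilinear over K, it is a continuous ring homomorphism and fixes the
rational coefficients 1/n!. -/
theorem sigmaPow_exp (f : ℕ) (hx : ‖x‖ ≤ ‖(p : WittField p k)‖ ^ 2) :
    LaurentRing.sigmaPow p k d f (exp x) = exp (LaurentRing.sigmaPow p k d f x) :=
  map_exp_of_mem_ball (𝕂 := WittField p k) _ (LaurentRing.continuous_sigmaPow f) x
    (mem_eball_radius hx)

theorem exp_mem_nonnegOn {J : Set (Fin d)} (hx : ‖x‖ ≤ ‖(p : WittField p k)‖ ^ 2)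
    (hJ : x ∈ (nonnegOn p k J).toSubring) : exp x ∈ (nonnegOn p k J).toSubring :=
  (isClosed_nonnegOn J).mem_of_tendsto (hasSum_exp hx).tendsto_sum_nat
    (Eventually.of_forall fun _ => sum_mem fun n _ => smul_mem_nonnegOn _ (pow_mem hJ n))

/-- For n ≥ 2 and |x| ≤ |p|² one has |x|^(n-1) ≤ |p|^n, while |1/n!| ≤ |p|^(1-n), so each remaining
term is at most |p| |x|. Up to a factor |p|, exp is thus a translation. -/
theorem norm_exp_sub_one_sub_le (hx : ‖x‖ ≤ ‖(p : WittField p k)‖ ^ 2) :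
    ‖exp x - 1 - x‖ ≤ ‖(p : WittField p k)‖ * ‖x‖ := by
  have h1 := (hasSum_nat_add_iff' 2).2 (hasSum_exp hx)
  have h2 : ∑ i ∈ Finset.range 2, ((i ! : ℕ) : WittField p k)⁻¹ • x ^ i = 1 + x := by
    simp [Finset.sum_range_succ]
  rw [h2, ← sub_sub] at h1
  rw [← h1.tsum_eq]
  have hρ := WittField.norm_p_lt_one (p := p) (k := k)
  have hρ0 := WittField.norm_p_pos (p := p) (k := k)
  refine IsUltrametricDist.norm_tsum_le_of_forall_le_of_nonneg (by positivity) fun n => ?_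
  rw [norm_smul, norm_pow]
  have h3 : ‖x‖ ^ (n + 2) ≤ ‖x‖ * (‖(p : WittField p k)‖ * ‖(p : WittField p k)‖ ^ (n + 2 - 1)) := by
    have h4 : ‖x‖ ^ (n + 1) ≤ (‖(p : WittField p k)‖ ^ 2) ^ (n + 1) :=
      pow_le_pow_left₀ (norm_nonneg _) hx _
    have h5 : (‖(p : WittField p k)‖ ^ 2) ^ (n + 1) ≤
        ‖(p : WittField p k)‖ * ‖(p : WittField p k)‖ ^ (n + 2 - 1) := by
      rw [← pow_mul, ← pow_succ']
      exact pow_le_pow_of_le_one hρ0.le hρ.le (by omega)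
    rw [pow_succ' ‖x‖ (n + 1)]
    exact mul_le_mul_of_nonneg_left (h4.trans h5) (norm_nonneg _)
  have h6 := WittField.norm_factorial_inv_le (p := p) (k := k) (n + 2)
  calc _ ≤ ‖(((n + 2)! : ℕ) : WittField p k)⁻¹‖ *
        (‖x‖ * (‖(p : WittField p k)‖ * ‖(p : WittField p k)‖ ^ (n + 2 - 1))) :=
        mul_le_mul_of_nonneg_left h3 (norm_nonneg _)
    _ = ‖(p : WittField p k)‖ * ‖x‖ * (‖(((n + 2)! : ℕ) : WittField p k)⁻¹‖ *
        ‖(p : WittField p k)‖ ^ (n + 2 - 1)) := by ring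
    _ ≤ ‖(p : WittField p k)‖ * ‖x‖ := mul_le_of_le_one_right (by positivity) h6

theorem norm_exp_sub_one_le (hx : ‖x‖ ≤ ‖(p : WittField p k)‖ ^ 2) :
    ‖exp x - 1‖ ≤ ‖x‖ := by
  have h1 : exp x - 1 = (exp x - 1 - x) + x := by ring
  rw [h1]
  refine (IsUltrametricDist.norm_add_le_max _ _).trans (max_le
    ((norm_exp_sub_one_sub_le hx).trans ?_) le_rfl)
  exact mul_le_of_le_one_left (norm_nonneg _) WittField.norm_p_lt_one.le

theorem norm_p_sq_le : ‖(p : WittField p k)‖ ^ 2 ≤ ‖(p : WittField p k)‖ :=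
  pow_le_of_le_one (norm_nonneg _) WittField.norm_p_lt_one.le two_ne_zero

theorem norm_exp_le_one (hx : ‖x‖ ≤ ‖(p : WittField p k)‖ ^ 2) : ‖exp x‖ ≤ 1 := by
  have h1 : exp x = (exp x - 1) + 1 := by ring
  rw [h1]
  refine (IsUltrametricDist.norm_add_le_max _ _).trans (max_le
    ((norm_exp_sub_one_le hx).trans (hx.trans ?_)) norm_one.le)
  exact norm_p_sq_le.trans WittField.norm_p_lt_one.le

theorem norm_sub_le_max (x y : LaurentRing p k d) : ‖x - y‖ ≤ max ‖x‖ ‖y‖ := by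
  rw [sub_eq_add_neg, ← norm_neg y]
  exact IsUltrametricDist.norm_add_le_max _ _

/-- The exponential maps the ball of radius `p⁻²` onto the ball of that radius around `1`. -/
theorem exists_exp_eq (hy : ‖y - 1‖ ≤ ‖(p : WittField p k)‖ ^ 2) :
    ∃ h : LaurentRing p k d, ‖h‖ ≤ ‖(p : WittField p k)‖ ^ 2 ∧ exp h = y := by
  -- The fixed points of F are the solutions of exp(h) = y, and F contracts with the factor |p|.
  -- This takes the place of the logarithm series.
  let F : LaurentRing p k d → LaurentRing p k d := fun h => h + (y - exp h)
  let s : Set (LaurentRing p k d) := Metric.closedBall 0 (‖(p : WittField p k)‖ ^ 2)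
  have hs : ∀ {h}, h ∈ s ↔ ‖h‖ ≤ ‖(p : WittField p k)‖ ^ 2 := mem_closedBall_zero_iff
  have hmaps : Set.MapsTo F s s := by
    intro h hh
    rw [hs] at hh ⊢
    have h1 : F h = (y - 1) - (exp h - 1 - h) := by simp only [F]; ring
    rw [h1]
    refine (norm_sub_le_max _ _).trans (max_le hy ?_)
    exact (norm_exp_sub_one_sub_le hh).trans ((mul_le_of_le_one_left (norm_nonneg _)
      WittField.norm_p_lt_one.le).trans hh)
  have hcontr : ContractingWith ‖(p : WittField p k)‖₊ (hmaps.restrict F s s) := by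
    refine ⟨WittField.norm_p_lt_one, LipschitzWith.of_dist_le_mul ?_⟩
    rintro ⟨h, hh⟩ ⟨h', hh'⟩
    rw [hs] at hh hh'
    change dist (F h) (F h') ≤ ‖(p : WittField p k)‖ * dist h h'
    rw [dist_eq_norm, dist_eq_norm]
    have hδ : ‖h - h'‖ ≤ ‖(p : WittField p k)‖ ^ 2 :=
      (norm_sub_le_max _ _).trans (max_le hh hh')
    have h1 : exp h = exp h' * exp (h - h') := by
      rw [← exp_add_of_norm_le hh' hδ, add_sub_cancel]
    have h2 : F h - F h' = -(exp h' * (exp (h - h') - 1 - (h - h')) +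
        (exp h' - 1) * (h - h')) := by
      simp only [F]
      rw [h1]
      ring
    rw [h2, norm_neg]
    refine (IsUltrametricDist.norm_add_le_max _ _).trans (max_le ?_ ?_)
    · rw [norm_mul]
      exact (mul_le_of_le_one_left (norm_nonneg _) (norm_exp_le_one hh')).trans
        (norm_exp_sub_one_sub_le hδ)
    · rw [norm_mul]
      exact mul_le_mul_of_nonneg_right ((norm_exp_sub_one_le hh').trans (hh'.trans norm_p_sq_le))
        (norm_nonneg _)
  obtain ⟨h, hh, hfix, -⟩ := ContractingWith.exists_fixedPoint' Metric.isClosed_closedBall.isComplete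
    hmaps hcontr (x := 0) (hs.2 (by rw [norm_zero]; positivity)) (edist_ne_top _ _)
  refine ⟨h, hs.1 hh, ?_⟩
  have h1 : h + (y - exp h) = h := hfix
  rw [add_eq_left, sub_eq_zero] at h1
  exact h1.symm

theorem norm_pderiv_le (i : Fin d) (x : LaurentRing p k d) : ‖pderiv i x‖ ≤ ‖x‖ :=
  (norm_le_iff (norm_nonneg _)).2 fun u =>
    (LaurentRing.norm_coeff_pderiv_le i x u).trans (norm_coeff_le _ _)

theorem continuous_pderiv (i : Fin d) :
    Continuous (pderiv i : LaurentRing p k d → LaurentRing p k d) :=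
  AddMonoidHomClass.continuous_of_bound (pderiv i) 1 fun x => by
    rw [one_mul]
    exact norm_pderiv_le i x

theorem pderiv_smul (i : Fin d) (c : WittField p k) (x : LaurentRing p k d) :
    pderiv i (c • x) = c • pderiv i x := by
  ext u
  rw [coeff_smul, coeff_pderiv, coeff_pderiv, coeff_smul]
  ring

theorem pderiv_exp (i : Fin d) (hx : ‖x‖ ≤ ‖(p : WittField p k)‖ ^ 2) :
    pderiv i (exp x) = exp x * pderiv i x := by
  have h1 := (hasSum_exp hx).map (pderiv i) (continuous_pderiv i)
  have h2 := (hasSum_nat_add_iff' 1).2 h1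
  have h3 := (hasSum_exp hx).mul_right (pderiv i x)
  rw [Finset.sum_range_one] at h2
  have h4 : ∀ n : ℕ, pderiv i (((n ! : ℕ) : WittField p k)⁻¹ • x ^ n) =
      ((n ! : ℕ) : WittField p k)⁻¹ • (n : WittField p k) • (x ^ (n - 1) * pderiv i x) := by
    intro n
    rw [pderiv_smul, Derivation.leibniz_pow, smul_eq_mul, Nat.cast_smul_eq_nsmul]
  simp only [Function.comp_def, h4] at h2
  rw [Nat.cast_zero, zero_smul, smul_zero, sub_zero] at h2
  have h5 : (fun n : ℕ => (((n + 1)! : ℕ) : WittField p k)⁻¹ • ((n + 1 : ℕ) : WittField p k) •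
      (x ^ (n + 1 - 1) * pderiv i x)) =
      fun n : ℕ => ((n ! : ℕ) : WittField p k)⁻¹ • x ^ n * pderiv i x := by
    funext n
    rw [smul_smul, Nat.factorial_succ, Nat.cast_mul, mul_inv_rev, mul_assoc, inv_mul_cancel₀,
      mul_one, Nat.add_sub_cancel, smul_mul_assoc]
    exact Nat.cast_ne_zero.2 n.succ_ne_zero
  rw [h5] at h2
  exact h2.unique h3

end Exponential

end

end LogDecay

namespace LogDecay

noncomputable section

set_option linter.unusedSectionVars false

/-! ### Integration of closed forms, and units of 𝒜^r -/

section Potentials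

variable {p : ℕ} [Fact p.Prime] {k : Type*} [Field k] [CharP k p] [PerfectRing k p]

open RestrictedSeries

variable {d : ℕ}

/-- The derivation `T_i ∂/∂T_i`. -/
def euler (i : Fin d) : Derivation ℤ (LaurentRing p k d) (LaurentRing p k d) :=
  LaurentRing.T p k i • pderiv i

theorem euler_apply (i : Fin d) (x : LaurentRing p k d) :
    euler i x = LaurentRing.T p k i * pderiv i x := rfl

theorem coeff_euler (i : Fin d) (x : LaurentRing p k d) (v : Fin d → ℤ) :
    (euler i x).coeff v = (v i : WittField p k) * x.coeff v := by
  rw [euler_apply, LaurentRing.T, coeff_monomial_mul, one_mul, coeff_pderiv, sub_add_cancel,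
    Pi.sub_apply, Pi.single_eq_same, sub_add_cancel]

theorem euler_sigmaPow (f : ℕ) (i : Fin d) (x : LaurentRing p k d) :
    euler i (LaurentRing.sigmaPow p k d f x) =
      ((p ^ f : ℕ) : LaurentRing p k d) * LaurentRing.sigmaPow p k d f (euler i x) := by
  have h1 : LaurentRing.sigmaPow p k d f (LaurentRing.T p k i) =
      LaurentRing.T p k i * LaurentRing.T p k i ^ (p ^ f - 1) := by
    rw [← pow_succ', Nat.sub_add_cancel (pow_f_pos p f), LaurentRing.T_pow, LaurentRing.T,
      LaurentRing.sigmaPow_monomial, map_one]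
  rw [euler_apply, euler_apply, LaurentRing.pderiv_sigmaPow, map_mul, h1]
  ring

theorem euler_comm (i j : Fin d) (x : LaurentRing p k d) :
    euler i (euler j x) = euler j (euler i x) := by
  ext v
  simp only [coeff_euler]
  ring

theorem euler_smul (i : Fin d) (c : WittField p k) (x : LaurentRing p k d) :
    euler i (c • x) = c • euler i x := by
  ext v
  simp only [coeff_euler, coeff_smul]
  ring

theorem euler_mem_nonnegOn {J : Set (Fin d)} (i : Fin d) {x : LaurentRing p k d}
    (hx : x ∈ (nonnegOn p k J).toSubring) : euler i x ∈ (nonnegOn p k J).toSubring :=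
  mul_mem ((nonnegOn p k J).T_mem i) ((nonnegOn p k J).pderiv_mem i x hx)

/-- At an exponent v with v_i < 0 the derivation multiplies the coefficient by v_i, which is nonzero
in K. -/
theorem mem_tateAlgebra_of_euler_mem {x : LaurentRing p k d}
    (h : ∀ i, euler i x ∈ (tateAlgebra p k d).toSubring) : x ∈ (tateAlgebra p k d).toSubring := by
  intro v hv i _
  by_contra hneg
  refine hneg (h i v ?_ i trivial)
  rw [coeff_euler]
  refine mul_ne_zero (Int.cast_ne_zero.2 ?_) hv
  rintro h0
  exact hneg h0.ge

/-- The inverse of |c| is the p-part of c, which is at most c. Division by c hence enlarges norms by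
at most the factor c. -/
theorem one_le_norm_natCast_mul {c : ℕ} (hc : c ≠ 0) : 1 ≤ ‖(c : WittField p k)‖ * c := by
  obtain ⟨a, m, hm, rfl⟩ := Nat.exists_eq_pow_mul_and_not_dvd hc p (Fact.out : p.Prime).ne_one
  have hm1 : (1 : ℝ) ≤ m := by
    exact_mod_cast Nat.one_le_iff_ne_zero.2 fun h : m = 0 =>
      hm (by rw [h]; exact dvd_zero p)
  have hp := cast_p_pos p
  rw [Nat.cast_mul, norm_mul, WittField.norm_natCast_eq_one hm, mul_one, Nat.cast_pow, norm_pow,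
    WittField.norm_p, Nat.cast_mul, Nat.cast_pow, ← mul_assoc, ← mul_pow, inv_mul_cancel₀ hp.ne',
    one_pow, one_mul]
  exact hm1

/-- A division by `v_i` is bounded in terms of the decay. -/
theorem norm_div_le_of_decay {r C : ℝ} {x : WittField p k} {c : ℤ} (hc : c < 0)
    (h : -(c : ℝ) * ‖x‖ ^ r ≤ C) (hr : r < 1) : ‖x / c‖ ≤ C * ‖x‖ ^ (1 - r) := by
  rcases eq_or_ne x 0 with rfl | hx
  · rw [zero_div, norm_zero, Real.zero_rpow (by linarith), mul_zero]
  obtain ⟨m, rfl⟩ : ∃ m : ℕ, c = -m := ⟨c.natAbs, by omega⟩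
  have hm : m ≠ 0 := by omega
  have h1 := one_le_norm_natCast_mul (p := p) (k := k) hm
  have hm0 : 0 < ‖(m : WittField p k)‖ := norm_pos_iff.2 (Nat.cast_ne_zero.2 hm)
  have hx0 := norm_pos_iff.2 hx
  have h2 : ‖x‖ = ‖x‖ ^ r * ‖x‖ ^ (1 - r) := by
    rw [← Real.rpow_add hx0, add_sub_cancel, Real.rpow_one]
  push_cast at h ⊢
  rw [neg_neg] at h
  rw [norm_div, norm_neg, div_le_iff₀ hm0]
  have h3 : 0 ≤ ‖x‖ ^ (1 - r) := Real.rpow_nonneg hx0.le _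
  calc ‖x‖ ≤ ‖x‖ * (‖(m : WittField p k)‖ * m) := le_mul_of_one_le_right hx0.le h1
    _ = (m * ‖x‖ ^ r) * ‖x‖ ^ (1 - r) * ‖(m : WittField p k)‖ := by
      nth_rewrite 1 [h2]
      ring
    _ ≤ C * ‖x‖ ^ (1 - r) * ‖(m : WittField p k)‖ := by gcongr

/-- For `r < 1` the part with negative exponents of a closed form with `r`-log-decay can be
integrated. -/
theorem exists_potential {n m : ℕ} {r : ℝ} (hr0 : 0 ≤ r) (hr : r < 1)
    {β : Fin (n + m) → LaurentRing p k (n + m)}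
    (hβ : ∀ i, β i ∈ (logDecayRing p k n m r).toSubring)
    (hclosed : ∀ i j, euler j (β i) = euler i (β j)) :
    ∃ G ∈ (annulusRing p k n m).toSubring,
      ∀ i, β i + euler i G ∈ (tateAlgebra p k (n + m)).toSubring := by
  classical
  choose C hC0 hC using fun i => (hasLogDecay_iff hr0).1 (hβ i).2
  set D := 1 + ∑ i, C i with hD
  have hCD : ∀ i, C i ≤ D := fun i => by
    have := Finset.single_le_sum (fun i _ => hC0 i) (Finset.mem_univ i)
    linarith
  have hD0 : 0 < D := by
    have := Finset.sum_nonneg fun i (_ : i ∈ Finset.univ) => hC0 i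
    linarith
  let P : (Fin (n + m) → ℤ) → Prop := fun v => ∃ i : Fin (n + m), (i : ℕ) < n ∧ v i < 0
  -- The index i < n with v_i < 0 is chosen arbitrarily. Closedness gives v_j β_{i,v} = v_i β_{j,v},
  -- so the single choice yields θ_j(G)_v = -β_{j,v} for all j.
  let c : (Fin (n + m) → ℤ) → WittField p k := fun v =>
    if h : P v then -((β h.choose).coeff v / (v h.choose : WittField p k)) else 0
  have hc : ∀ v, ¬ P v → c v = 0 := fun v h => dif_neg h
  have hc' : ∀ v, P v → ∃ i : Fin (n + m), (i : ℕ) < n ∧ v i < 0 ∧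
      c v = -((β i).coeff v / (v i : WittField p k)) := fun v h =>
    ⟨h.choose, h.choose_spec.1, h.choose_spec.2, dif_pos h⟩
  let G : LaurentRing p k (n + m) := RestrictedSeries.mk c (by
    refine tendsto_of_finite fun ε hε => ?_
    -- Since |β_{i,v} / v_i| ≤ D |β_{i,v}|^(1-r), a coefficient of G of norm at least ε forces
    -- |β_{i,v}| ≥ (ε/D)^(1/(1-r)). This is where r < 1 enters.
    set δ := (ε / D) ^ (1 - r)⁻¹ with hδ
    have hδ0 : 0 < δ := Real.rpow_pos_of_pos (div_pos hε hD0) _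
    refine (Set.finite_iUnion fun i => (β i).finite_le_norm hδ0).subset fun v hv => ?_
    have hP : P v := by
      by_contra h
      rw [Set.mem_ofPred_eq, hc v h, norm_zero] at hv
      exact absurd hv (not_le.2 hε)
    obtain ⟨i, hi, hvi, hcv⟩ := hc' v hP
    rw [Set.mem_ofPred_eq, hcv, norm_neg] at hv
    refine Set.mem_iUnion.2 ⟨i, ?_⟩
    change δ ≤ ‖(β i).coeff v‖
    have h0 : (β i).coeff v ≠ 0 := by
      rintro h0
      rw [h0, zero_div, norm_zero] at hv
      exact absurd hv (not_le.2 hε)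
    have h1 := hv.trans (norm_div_le_of_decay hvi ((hC i v h0 i hi).trans (hCD i)) hr)
    rw [mul_comm, ← div_le_iff₀ hD0] at h1
    have h2 := Real.rpow_le_rpow (by positivity) h1 (by rw [inv_nonneg]; linarith :
      0 ≤ (1 - r)⁻¹)
    rwa [← Real.rpow_mul (norm_nonneg _), mul_inv_cancel₀ (by linarith), Real.rpow_one] at h2)
  have hG : ∀ v, P v → ∀ j, (euler j G).coeff v = -(β j).coeff v := by
    intro v hv j
    obtain ⟨i, hi, hvi, hcv⟩ := hc' v hv
    have h1 := congrArg (fun z => RestrictedSeries.coeff z v) (hclosed i j)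
    simp only [coeff_euler] at h1
    have hvi0 : (v i : WittField p k) ≠ 0 := Int.cast_ne_zero.2 hvi.ne
    rw [coeff_euler]
    change _ * c v = _
    rw [hcv, mul_neg, mul_div_assoc', h1, mul_div_cancel_left₀ _ hvi0]
  have hGmem : G ∈ (annulusRing p k n m).toSubring := by
    intro v hv l hl
    change c v ≠ 0 at hv
    have hP : P v := by
      by_contra h
      exact hv (hc v h)
    obtain ⟨i, hi, hvi, hcv⟩ := hc' v hP
    refine (hβ i).1 v (fun h0 => hv ?_) l hl
    rw [hcv, h0, zero_div, neg_zero]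
  refine ⟨G, hGmem, fun i v hv l _ => ?_⟩
  rcases lt_or_ge (l : ℕ) n with hl | hl
  · by_contra hneg
    refine hv ?_
    rw [coeff_add, hG v ⟨l, hl, not_le.1 hneg⟩, add_neg_cancel]
  · exact add_mem (hβ i).1 (euler_mem_nonnegOn i hGmem) v hv l hl

/-- The structure of the units of `𝒜^r`. -/
theorem exists_eq_monomial_mul {n m : ℕ} {r : ℝ} (hr0 : 0 ≤ r) {a a' : LaurentRing p k (n + m)}
    (ha : a ∈ (logDecayRing p k n m r).toSubring) (ha' : a' ∈ (logDecayRing p k n m r).toSubring)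
    (haa' : a * a' = 1) :
    ∃ (w : Fin (n + m) → ℤ) (c : WittField p k), c ≠ 0 ∧
      (∀ i : Fin (n + m), n ≤ (i : ℕ) → w i = 0) ∧
      ∃ u ∈ (logDecayRing p k n m r).toSubring, ∃ u' ∈ (logDecayRing p k n m r).toSubring,
        u * u' = 1 ∧ ‖u - 1‖ < 1 ∧ a = monomial w c * u := by
  have ha0 : a ≠ 0 := by
    rintro rfl
    rw [zero_mul] at haa'
    exact zero_ne_one haa'
  obtain ⟨e, -, he⟩ := LaurentRing.exists_norm_smul_eq_one ha0
  have hpe : (p : WittField p k) ^ (-e) ≠ 0 := zpow_ne_zero _ (WittField.p_ne_zero p k)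
  set γ := (p : WittField p k) ^ (-e) with hγ
  have h1 : (γ • a) * (γ⁻¹ • a') = 1 := by
    rw [smul_mul_smul_comm, mul_inv_cancel₀ hpe, one_smul, haa']
  have he' : ‖γ⁻¹ • a'‖ = 1 := by
    have h2 := congrArg norm h1
    rwa [norm_mul, he, one_mul, norm_one] at h2
  -- The reduction of the normalised a is invertible among Laurent polynomials, hence a monomial.
  -- Its exponent is w.
  have h2 : LaurentRing.reduction (γ • a) * LaurentRing.reduction (γ⁻¹ • a') = 1 := by
    rw [← LaurentRing.reduction_mul he.le he'.le, h1]
    exact (LaurentRing.reduction_monomial 0 1).trans (by rw [WittField.residue_one]; rfl)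
  obtain ⟨w, z, hz, hw, hw'⟩ := exists_eq_single_of_mul_eq_one h2
  have hcoeff : ∀ v, WittField.residue ((γ • a).coeff v) =
      (AddMonoidAlgebra.single w z : AddMonoidAlgebra k (Fin (n + m) → ℤ)).coeff v := fun v => by
    rw [← hw, LaurentRing.coeff_reduction]
  have hcoeff' : ∀ v, WittField.residue ((γ⁻¹ • a').coeff v) =
      (AddMonoidAlgebra.single (-w) z⁻¹ : AddMonoidAlgebra k (Fin (n + m) → ℤ)).coeff v := by
    intro v
    rw [← hw', LaurentRing.coeff_reduction]
  have hle : ∀ v, ‖(γ • a).coeff v‖ ≤ 1 := fun v => (norm_coeff_le _ _).trans he.le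
  have hne : (γ • a).coeff w ≠ 0 := by
    intro h0
    have h3 := hcoeff w
    rw [h0, WittField.residue_zero] at h3
    exact hz (by simpa using h3.symm)
  have hne' : (γ⁻¹ • a').coeff (-w) ≠ 0 := by
    intro h0
    have h3 := hcoeff' (-w)
    rw [h0, WittField.residue_zero] at h3
    exact inv_ne_zero hz (by simpa using h3.symm)
  have hnorm : ‖(γ • a).coeff w‖ = 1 := by
    refine le_antisymm (hle w) (not_lt.1 fun hlt => ?_)
    have h3 := hcoeff w
    rw [(WittField.residue_eq_zero_iff (hle w)).2 hlt] at h3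
    exact hz (by simpa using h3.symm)
  -- Both w and -w occur as exponents of elements of 𝒜, so the entries for the non-invertible
  -- variables vanish.
  have hw0 : ∀ i : Fin (n + m), n ≤ (i : ℕ) → w i = 0 := by
    intro i hi
    have h3 := smul_mem_nonnegOn γ ha.1 w hne i hi
    have h4 := smul_mem_nonnegOn γ⁻¹ ha'.1 (-w) hne' i hi
    rw [Pi.neg_apply] at h4
    omega
  set c := (γ • a).coeff w with hc
  have hmono : ∀ (s : ℤ) (x : WittField p k), monomial (s • w) x ∈
      (logDecayRing p k n m r).toSubring := fun s x =>
    monomial_mem_logDecayRing hr0 (fun i hi => by simp [hw0 i hi]) x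
  have hinv : (monomial w (γ⁻¹ * c) : LaurentRing p k (n + m)) * monomial (-w) (c⁻¹ * γ) = 1 := by
    rw [monomial_mul_monomial, add_neg_cancel]
    have : γ⁻¹ * c * (c⁻¹ * γ) = 1 := by field_simp
    rw [this]
    rfl
  refine ⟨w, γ⁻¹ * c, mul_ne_zero (inv_ne_zero hpe) hne, hw0, monomial (-w) (c⁻¹ * γ) * a, ?_,
    monomial w (γ⁻¹ * c) * a', ?_, ?_, ?_, ?_⟩
  · refine mul_mem ?_ ha
    simpa using hmono (-1) (c⁻¹ * γ)
  · refine mul_mem ?_ ha'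
    simpa using hmono 1 (γ⁻¹ * c)
  · linear_combination a * a' * hinv + haa'
  · rw [norm_lt_iff]
    intro v
    have h3 : (monomial (-w) (c⁻¹ * γ) * a : LaurentRing p k (n + m)).coeff v =
        c⁻¹ * (γ • a).coeff (v + w) := by
      rw [coeff_monomial_mul, coeff_smul, sub_neg_eq_add, mul_assoc]
    classical
    rw [coeff_sub, h3, coeff_one]
    split_ifs with hv
    · rw [hv, zero_add, ← hc, inv_mul_cancel₀ hne, sub_self, norm_zero]
      exact one_pos
    · rw [sub_zero, norm_mul, norm_inv, hnorm, inv_one, one_mul]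
      refine (WittField.residue_eq_zero_iff (hle _)).1 ?_
      rw [hcoeff]
      have : w ≠ v + w := fun h => hv (by simpa using h.symm)
      simp [AddMonoidAlgebra.coeff_single, this]
  · linear_combination -a * hinv

end Potentials

end

end LogDecay

namespace LogDecay

noncomputable section

set_option linter.unusedSectionVars false

/-! ### Principal units and the logarithmic form of compatibility -/

section Gauge

variable {p : ℕ} [Fact p.Prime] {k : Type*} [Field k] [CharP k p] [PerfectRing k p] {d : ℕ}

open RestrictedSeries NormedSpace

theorem norm_eq_one_of_norm_sub_one_lt {u : LaurentRing p k d} (hu : ‖u - 1‖ < 1) : ‖u‖ = 1 := by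
  have h1 : u = (u - 1) + 1 := by ring
  rw [h1, IsUltrametricDist.norm_add_eq_max_of_norm_ne_norm (by rw [norm_one]; exact hu.ne),
    norm_one, max_eq_right hu.le]

theorem norm_pow_sub_one_le {u : LaurentRing p k d} (hu : ‖u - 1‖ < 1) (c : ℕ) :
    ‖u ^ c - 1‖ ≤ ‖u - 1‖ := by
  induction c with
  | zero => simp
  | succ c ih =>
    have h1 : u ^ (c + 1) - 1 = u * (u ^ c - 1) + (u - 1) := by ring
    rw [h1]
    refine (IsUltrametricDist.norm_add_le_max _ _).trans (max_le ?_ le_rfl)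
    rwa [norm_mul, norm_eq_one_of_norm_sub_one_lt hu, one_mul]

/-- In u^p - 1 = (u - 1)(1 + u + … + u^(p-1)) the first factor has norm at most |p|, and the second
is p plus terms u^i - 1 of norm at most |p|. Hence u^p lies in the image of the exponential. -/
theorem norm_pow_p_sub_one_le {u : LaurentRing p k d} (hu : ‖u - 1‖ < 1) :
    ‖u ^ p - 1‖ ≤ ‖(p : WittField p k)‖ ^ 2 := by
  have hu' := LaurentRing.norm_le_norm_p_of_lt hu
  rw [← mul_geom_sum, norm_mul, pow_two]
  refine mul_le_mul hu' ?_ (norm_nonneg _) (norm_nonneg _)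
  have h1 : ∑ i ∈ Finset.range p, u ^ i =
      ∑ i ∈ Finset.range p, (u ^ i - 1) + (p : LaurentRing p k d) * 1 := by
    rw [Finset.sum_sub_distrib]
    simp
  rw [h1]
  refine (IsUltrametricDist.norm_add_le_max _ _).trans (max_le ?_ ?_)
  · exact IsUltrametricDist.norm_sum_le_of_forall_le_of_nonneg (norm_nonneg _) fun i _ =>
      (norm_pow_sub_one_le hu i).trans hu'
  · rw [natCast_mul_eq_smul, norm_smul, norm_one, mul_one]

theorem exp_nsmul_of_norm_le {x : LaurentRing p k d} (hx : ‖x‖ ≤ ‖(p : WittField p k)‖ ^ 2) (c : ℕ) :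
    exp ((c : WittField p k) • x) = exp x ^ c := by
  induction c with
  | zero => rw [Nat.cast_zero, zero_smul, exp_zero, pow_zero]
  | succ c ih =>
    have h1 : ‖(c : WittField p k) • x‖ ≤ ‖(p : WittField p k)‖ ^ 2 := by
      rw [norm_smul]
      exact (mul_le_of_le_one_left (norm_nonneg _)
        (IsUltrametricDist.norm_natCast_le_one _ c)).trans hx
    rw [Nat.cast_succ, add_smul, one_smul, exp_add_of_norm_le h1 hx, ih, pow_succ]

theorem euler_exp (i : Fin d) {x : LaurentRing p k d} (hx : ‖x‖ ≤ ‖(p : WittField p k)‖ ^ 2) :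
    euler i (exp x) = exp x * euler i x := by
  rw [euler_apply, euler_apply, pderiv_exp i hx]
  ring

/-- A series that is divided by `σ^f` and a number `c` of absolute value `< 1` vanishes. -/
theorem eq_zero_of_eq_smul_sigmaPow {f : ℕ} {c : WittField p k} (hc : ‖c‖ < 1)
    {x : LaurentRing p k d} (h : x = c • LaurentRing.sigmaPow p k d f x) : x = 0 := by
  have h1 := congrArg norm h
  rw [norm_smul, LaurentRing.norm_sigmaPow] at h1
  rw [← norm_eq_zero]
  nlinarith [norm_nonneg x]

/-- The logarithmic form of the compatibility of the connection with the Frobenius. -/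
theorem euler_eq_of_compatible {f : ℕ} {w : Fin d → ℤ} {c : WittField p k} (hc : c ≠ 0)
    {a u u' : LaurentRing p k d} (huu' : u * u' = 1) (ha : a = monomial w c * u)
    {b : Fin d → LaurentRing p k d} (i : Fin d)
    (h : pderiv i a + a * b i = ((p ^ f : ℕ) : LaurentRing p k d) *
      LaurentRing.T p k i ^ (p ^ f - 1) * LaurentRing.sigmaPow p k d f (b i) * a) :
    u' * euler i u = ((p ^ f : ℕ) : WittField p k) •
      LaurentRing.sigmaPow p k d f (LaurentRing.T p k i * b i) - LaurentRing.T p k i * b i -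
        monomial 0 (w i : WittField p k) := by
  have h1 : LaurentRing.sigmaPow p k d f (LaurentRing.T p k i) =
      LaurentRing.T p k i * LaurentRing.T p k i ^ (p ^ f - 1) := by
    rw [← pow_succ', Nat.sub_add_cancel (pow_f_pos p f), LaurentRing.T_pow, LaurentRing.T,
      LaurentRing.sigmaPow_monomial, map_one]
  have h2 : (monomial (-w) c⁻¹ : LaurentRing p k d) * monomial w c = 1 := by
    rw [monomial_mul_monomial, neg_add_cancel, inv_mul_cancel₀ hc]
    rfl
  have h3 : euler i (monomial w c : LaurentRing p k d) =
      monomial 0 (w i : WittField p k) * monomial w c := by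
    classical
    ext v
    rw [coeff_euler, ← smul_def', coeff_smul, coeff_monomial]
    split_ifs with hv
    · rw [hv]
    · simp
  have h4 : euler i a = euler i (monomial w c : LaurentRing p k d) * u +
      monomial w c * euler i u := by
    rw [ha, Derivation.leibniz, smul_eq_mul, smul_eq_mul]
    ring
  rw [euler_apply i a, h3] at h4
  rw [← natCast_mul_eq_smul, map_mul, h1]
  rw [ha] at h h4
  set Z := LaurentRing.T p k i * b i - ((p ^ f : ℕ) : LaurentRing p k d) *
    (LaurentRing.T p k i * LaurentRing.T p k i ^ (p ^ f - 1) *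
      LaurentRing.sigmaPow p k d f (b i)) + monomial 0 (w i : WittField p k) with hZ
  linear_combination (monomial (-w) c⁻¹ : LaurentRing p k d) * u' *
    (LaurentRing.T p k i * h - h4) - (u' * euler i u + u * u' * Z) * h2 - Z * huu'

/-- The differences of the mixed derivatives of the connection form are divided by `σ^f`. -/
theorem euler_comm_of_log {f : ℕ} (hf : 0 < f) {u u' : LaurentRing p k d} (huu' : u * u' = 1)
    {w : Fin d → ℤ} {β : Fin d → LaurentRing p k d}
    (h : ∀ i, u' * euler i u = ((p ^ f : ℕ) : WittField p k) •
      LaurentRing.sigmaPow p k d f (β i) - β i - monomial 0 (w i : WittField p k))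
    (i j : Fin d) : euler j (β i) = euler i (β j) := by
  have hinv : ∀ i, euler i u' = -(u' * u' * euler i u) := by
    intro i
    have h1 := congrArg (euler i) huu'
    rw [Derivation.leibniz, Derivation.map_one_eq_zero, smul_eq_mul, smul_eq_mul] at h1
    linear_combination u' * h1 - euler i u' * huu'
  have hsymm : ∀ i j, euler j (u' * euler i u) = u' * euler j (euler i u) -
      u' * u' * euler i u * euler j u := by
    intro i j
    rw [Derivation.leibniz, hinv, smul_eq_mul, smul_eq_mul]
    ring
  have hconst : ∀ (i : Fin d) (c : WittField p k),
      euler i (monomial 0 c : LaurentRing p k d) = 0 := by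
    classical
    intro i c
    ext v
    rw [coeff_euler, coeff_monomial]
    split_ifs with hv
    · rw [hv]
      simp
    · simp
  -- Moving θ_j past σ^f produces a second factor q, and the constant w_i disappears.
  have hder : ∀ i j, euler j (u' * euler i u) = (((p ^ f : ℕ) : WittField p k) *
      ((p ^ f : ℕ) : WittField p k)) • LaurentRing.sigmaPow p k d f (euler j (β i)) -
        euler j (β i) := by
    intro i j
    rw [h i, map_sub, map_sub, hconst, sub_zero, euler_smul, euler_sigmaPow, natCast_mul_eq_smul,
      smul_smul]
  rw [← sub_eq_zero]
  have hq : ‖((p ^ f : ℕ) : WittField p k) * ((p ^ f : ℕ) : WittField p k)‖ < 1 := by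
    rw [norm_mul]
    exact mul_lt_one_of_nonneg_of_lt_one_left (norm_nonneg _) (norm_natCast_pow_lt_one hf)
      (norm_natCast_pow_lt_one hf).le
  refine eq_zero_of_eq_smul_sigmaPow (f := f) hq ?_
  -- Logarithmic derivatives are closed, so the difference D = θ_j(β_i) - θ_i(β_j) satisfies D = q²
  -- σ^f(D), which forces D = 0.
  have h1 : euler j (u' * euler i u) = euler i (u' * euler j u) := by
    rw [hsymm, hsymm, euler_comm i j]
    ring
  rw [hder, hder] at h1
  rw [map_sub, smul_sub]
  linear_combination -h1

end Gauge

end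

end LogDecay

namespace LogDecay

noncomputable section

set_option linter.unusedSectionVars false

/-! ### Trivializing the Frobenius up to a unit of the Tate algebra -/

section FrobeniusGauge

open RestrictedSeries NormedSpace

variable {p : ℕ} [Fact p.Prime] {k : Type*} [Field k] [CharP k p] [PerfectRing k p]

/-- A one-unit whose logarithmic derivatives come from a connection form becomes, after raising it
to a power of `p`, a power series in the `T_i` up to a Frobenius coboundary of an exponential. -/
theorem exists_exp_gauge {n m f : ℕ} {r : ℝ} (hf : 0 < f) (hr0 : 0 ≤ r) (hr : r < 1)
    {u u' : LaurentRing p k (n + m)} (huu' : u * u' = 1) (hu : ‖u - 1‖ < 1)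
    {w : Fin (n + m) → ℤ} {β : Fin (n + m) → LaurentRing p k (n + m)}
    (hβ : ∀ i, β i ∈ (logDecayRing p k n m r).toSubring)
    (h : ∀ i, u' * euler i u = ((p ^ f : ℕ) : WittField p k) •
      LaurentRing.sigmaPow p k (n + m) f (β i) - β i - monomial 0 (w i : WittField p k)) :
    ∃ (N : ℕ) (H E : LaurentRing p k (n + m)), H ∈ (tateAlgebra p k (n + m)).toSubring ∧
      E ∈ (annulusRing p k n m).toSubring ∧ ‖H‖ ≤ ‖(p : WittField p k)‖ ^ 2 ∧
      ‖E‖ ≤ ‖(p : WittField p k)‖ ^ 2 ∧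
      u ^ p ^ (N + 1) * LaurentRing.sigmaPow p k (n + m) f (exp E) = exp H * exp E := by
  obtain ⟨G, hG, hGβ⟩ := exists_potential hr0 hr hβ (euler_comm_of_log hf huu' h)
  -- Here l plays the role of p log(u).
  obtain ⟨l, hl, hlu⟩ := exists_exp_eq (norm_pow_p_sub_one_le hu)
  have hp2 : 0 < ‖(p : WittField p k)‖ ^ 2 := pow_pos WittField.norm_p_pos 2
  -- G may be large. A power of p brings it into the domain of the exponential, at the cost of
  -- raising u to the power p^(N+1).
  obtain ⟨N, hN⟩ := exists_norm_pow_smul_le G hp2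
  have hE := hN (N + 1) N.le_succ
  set E := (p : WittField p k) ^ (N + 1) • G with hEdef
  have hσE : ‖LaurentRing.sigmaPow p k (n + m) f E‖ ≤ ‖(p : WittField p k)‖ ^ 2 := by
    rwa [LaurentRing.norm_sigmaPow]
  have hlN : ‖((p ^ N : ℕ) : WittField p k) • l‖ ≤ ‖(p : WittField p k)‖ ^ 2 := by
    rw [norm_smul]
    exact (mul_le_of_le_one_left (norm_nonneg _) (IsUltrametricDist.norm_natCast_le_one _ _)).trans hl
  have hH : ‖((p ^ N : ℕ) : WittField p k) • l + LaurentRing.sigmaPow p k (n + m) f E - E‖ ≤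
      ‖(p : WittField p k)‖ ^ 2 :=
    (norm_sub_le_max _ _).trans (max_le ((IsUltrametricDist.norm_add_le_max _ _).trans
      (max_le hlN hσE)) hE)
  have hup : u ^ p * u' ^ p = 1 := by rw [← mul_pow, huu', one_pow]
  have hel : ∀ i, euler i l = (p : WittField p k) • (u' * euler i u) := by
    intro i
    have h1 := euler_exp i hl
    rw [hlu, Derivation.leibniz_pow] at h1
    have h2 : u ^ (p - 1) = u ^ p * u' := by
      rw [← pow_sub_one_mul (Fact.out : p.Prime).ne_zero u, mul_assoc, huu', mul_one]
    rw [h2, nsmul_eq_mul, smul_eq_mul] at h1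
    rw [← natCast_mul_eq_smul]
    linear_combination -u' ^ p * h1 +
      ((p : LaurentRing p k (n + m)) * u' * euler i u - euler i l) * hup
  refine ⟨N, _, E, mem_tateAlgebra_of_euler_mem fun i => ?_, smul_mem_nonnegOn _ hG, hH, hE, ?_⟩
  -- The terms in l and in G combine, so that β_i enters only through β_i + θ_i(G), which lies in
  -- the Tate algebra.
  · have h1 : euler i (((p ^ N : ℕ) : WittField p k) • l + LaurentRing.sigmaPow p k (n + m) f E - E)
        = (p : WittField p k) ^ (N + 1) • (((p ^ f : ℕ) : WittField p k) •
          LaurentRing.sigmaPow p k (n + m) f (β i + euler i G) - (β i + euler i G) -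
            monomial 0 (w i : WittField p k)) := by
      rw [map_sub, map_add, euler_smul, hel, h, euler_sigmaPow, hEdef, euler_smul,
        natCast_mul_eq_smul, LaurentRing.sigmaPow_smul, map_add, map_pow,
        map_natCast]
      simp only [Nat.cast_pow, smul_sub, smul_add, smul_smul, ← pow_succ, ← pow_add]
      rw [← mul_assoc, ← pow_succ, ← pow_add]
      abel_nf
    rw [h1]
    refine smul_mem_nonnegOn _ (sub_mem (sub_mem (smul_mem_nonnegOn _
      (sigmaPow_mem_nonnegOn f (hGβ i))) (hGβ i)) (monomial_mem_nonnegOn (fun _ _ => le_rfl) _))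
  · rw [sigmaPow_exp f hE, ← exp_add_of_norm_le hH hE, sub_add_cancel, exp_add_of_norm_le hlN hσE,
      exp_nsmul_of_norm_le hl, hlu, ← pow_mul, pow_succ']

/-- A solution `E` of the equation of `exists_exp_gauge` has log-decay, and so has its inverse. -/
theorem exp_mem_logDecayRing {n m f : ℕ} {r : ℝ} (hf : 0 < f) (hr0 : 0 ≤ r)
    {v v' H E : LaurentRing p k (n + m)} (hv : v ∈ (logDecayRing p k n m r).toSubring)
    (hv' : v' ∈ (logDecayRing p k n m r).toSubring) (hvv' : v * v' = 1) (hv1 : ‖v‖ = 1)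
    (hHt : H ∈ (tateAlgebra p k (n + m)).toSubring) (hEa : E ∈ (annulusRing p k n m).toSubring)
    (hH : ‖H‖ ≤ ‖(p : WittField p k)‖ ^ 2) (hE : ‖E‖ ≤ ‖(p : WittField p k)‖ ^ 2)
    (h : v * LaurentRing.sigmaPow p k (n + m) f (exp E) = exp H * exp E) :
    exp E ∈ (logDecayRing p k n m r).toSubring ∧
      exp (-E) ∈ (logDecayRing p k n m r).toSubring := by
  have hle := tateAlgebra_le_logDecayRing p k n m r
  have hH' : ‖-H‖ ≤ ‖(p : WittField p k)‖ ^ 2 := by rwa [norm_neg]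
  have hE' : ‖-E‖ ≤ ‖(p : WittField p k)‖ ^ 2 := by rwa [norm_neg]
  have hv'1 : ‖v'‖ = 1 := by
    have h1 := congrArg norm hvv'
    rwa [norm_mul, hv1, one_mul, norm_one] at h1
  have hEE := exp_mul_exp_neg hE
  have hHH := exp_mul_exp_neg hH
  have hσ := congrArg (LaurentRing.sigmaPow p k (n + m) f) hEE
  rw [map_mul, map_one] at hσ
  -- The series exp(E) and exp(-E) solve σ^f(y) = x y with x = exp(H) v⁻¹ and x = exp(-H) v
  -- respectively. Both factors have log-decay and norm at most 1.
  refine ⟨⟨exp_mem_nonnegOn hE hEa, hasLogDecay_of_sigmaPow_eq hr0 hf (x := exp H * v')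
    (mul_mem (hle (exp_mem_nonnegOn hH hHt)) hv').2 ?_ ?_⟩,
    ⟨exp_mem_nonnegOn hE' (neg_mem hEa), hasLogDecay_of_sigmaPow_eq hr0 hf (x := exp (-H) * v)
      (mul_mem (hle (exp_mem_nonnegOn hH' (neg_mem hHt))) hv).2 ?_ ?_⟩⟩
  · rw [norm_mul, hv'1, mul_one]
    exact norm_exp_le_one hH
  · linear_combination v' * h - LaurentRing.sigmaPow p k (n + m) f (exp E) * hvv'
  · rw [norm_mul, hv1, mul_one]
    exact norm_exp_le_one hH'
  · set s := LaurentRing.sigmaPow p k (n + m) f (exp (-E))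
    set t := LaurentRing.sigmaPow p k (n + m) f (exp E)
    linear_combination (-(exp (-H) * exp (-E) * s)) * h - s * hHH * exp E * exp (-E) -
      s * hEE + exp (-H) * exp (-E) * v * hσ

/-- A compatible pair `(a, b)` over `𝒜^r` becomes defined over the Tate algebra after passing to a
power and changing the basis. -/
theorem exists_tate_gauge {n m f : ℕ} {r : ℝ} (hf : 0 < f) (hr0 : 0 ≤ r) (hr : r < 1)
    {a : (logDecayRing p k n m r).ring} {b : Fin (n + m) → (logDecayRing p k n m r).ring}
    (ha : IsUnit a) (hc : IsCompatible (logDecayRing p k n m r) f a b) :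
    ∃ (t : ℕ) (g : (logDecayRing p k n m r).ringˣ) (u : (tateAlgebra p k (n + m)).ringˣ),
      u.1.1 * g.1.1 = LaurentRing.sigmaPow p k (n + m) f g.1.1 * a.1 ^ (t + 1) := by
  obtain ⟨⟨a, a', haa', _⟩, rfl⟩ := ha
  obtain ⟨w, c, hc0, hw, u, hu, u', hu', huu', hu1, hau⟩ :=
    exists_eq_monomial_mul hr0 a.2 a'.2 (congrArg Subtype.val haa')
  obtain ⟨N, H, E, hHt, hEa, hH, hE, heq⟩ := exists_exp_gauge hf hr0 hr huu' hu1
    (fun i => mul_mem ((logDecayRing p k n m r).T_mem i) (b i).2)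
    fun i => euler_eq_of_compatible (b := fun i => (b i).1) hc0 huu' hau i (hc.coe i)
  set P := p ^ (N + 1) with hP
  obtain ⟨hEr, hEr'⟩ := exp_mem_logDecayRing hf hr0 (pow_mem hu P) (pow_mem hu' P)
    (by rw [← mul_pow, huu', one_pow])
    (by rw [norm_pow, norm_eq_one_of_norm_sub_one_lt hu1, one_pow]) hHt hEa hH hE heq
  have hEE := exp_mul_exp_neg hE
  have hHH := exp_mul_exp_neg hH
  have hH' : ‖-H‖ ≤ ‖(p : WittField p k)‖ ^ 2 := by rwa [norm_neg]
  -- Here q denotes p^f - 2, so that the exponent p^f - 1 is q + 1 without truncated subtraction.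
  obtain ⟨q, hq⟩ : ∃ q, p ^ f = q + 1 + 1 :=
    Nat.exists_eq_add_of_le' (Nat.one_lt_pow hf.ne' (Fact.out : p.Prime).one_lt)
  obtain ⟨t, ht⟩ : ∃ t, P * (q + 1) = t + 1 :=
    Nat.exists_eq_add_of_le' (Nat.mul_pos (pow_pos (Fact.out : p.Prime).pos _) q.succ_pos)
  have hmon : ∀ s : ℤ, (monomial (s • w) 1 : LaurentRing p k (n + m)) ∈
      (logDecayRing p k n m r).toSubring := fun s =>
    monomial_mem_logDecayRing hr0 (fun i hi => by simp [hw i hi]) 1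
  have hconst : ∀ s : WittField p k, (monomial 0 s : LaurentRing p k (n + m)) ∈
      (tateAlgebra p k (n + m)).toSubring := fun s =>
    monomial_mem_nonnegOn (fun _ _ => le_rfl) s
  have hmm : (monomial (-(P : ℤ) • w) 1 : LaurentRing p k (n + m)) * monomial ((P : ℤ) • w) 1 =
      1 := by
    rw [monomial_mul_monomial, ← add_smul, neg_add_cancel, zero_smul, mul_one]
    rfl
  have hcc : (monomial 0 (c ^ (t + 1)) : LaurentRing p k (n + m)) * monomial 0 (c ^ (t + 1))⁻¹ =
      1 := by
    rw [monomial_mul_monomial, zero_add, mul_inv_cancel₀ (pow_ne_zero _ hc0)]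
    rfl
  have hgg : (monomial (-(P : ℤ) • w) 1 * exp E ^ (q + 1)) *
      (monomial ((P : ℤ) • w) 1 * exp (-E) ^ (q + 1)) = 1 := by
    rw [mul_mul_mul_comm, hmm, ← mul_pow, hEE, one_pow, one_mul]
  have hvv : (monomial 0 (c ^ (t + 1)) * exp H ^ (q + 1)) *
      (monomial 0 (c ^ (t + 1))⁻¹ * exp (-H) ^ (q + 1)) = 1 := by
    rw [mul_mul_mul_comm, hcc, ← mul_pow, hHH, one_pow, one_mul]
  -- The change of basis is g = T^(-P w) exp(E)^(q+1), and the new Frobenius is c^(t+1)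
  -- exp(H)^(q+1). The monomial cancels because t + 1 = P (p^f - 1), so that σ^f(T^(-P w)) T^((t+1)
  -- w) = T^(-P w).
  refine ⟨t, ⟨⟨_, mul_mem (hmon _) (pow_mem hEr _)⟩, ⟨_, mul_mem (hmon _) (pow_mem hEr' _)⟩,
      Subtype.ext hgg, Subtype.ext ((mul_comm _ _).trans hgg)⟩,
    ⟨⟨_, mul_mem (hconst _) (pow_mem (exp_mem_nonnegOn hH hHt) _)⟩,
      ⟨_, mul_mem (hconst _) (pow_mem (exp_mem_nonnegOn hH' (neg_mem hHt)) _)⟩,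
      Subtype.ext hvv, Subtype.ext ((mul_comm _ _).trans hvv)⟩, ?_⟩
  have hpow : ∀ s : ℕ, (monomial w c : LaurentRing p k (n + m)) ^ s =
      monomial ((s : ℤ) • w) (c ^ s) := by
    intro s
    induction s with
    | zero => rw [pow_zero, pow_zero, Nat.cast_zero, zero_smul]; rfl
    | succ s ih => rw [pow_succ, ih, monomial_mul_monomial, pow_succ, Nat.cast_succ, add_smul,
        one_smul]
  have h1 : u ^ (t + 1) * LaurentRing.sigmaPow p k (n + m) f (exp E) ^ (q + 1) =
      exp H ^ (q + 1) * exp E ^ (q + 1) := by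
    rw [← ht, pow_mul, ← mul_pow, heq, mul_pow]
  have h2 : (monomial 0 (c ^ (t + 1)) : LaurentRing p k (n + m)) * monomial (-(P : ℤ) • w) 1 =
      monomial (p ^ f • (-(P : ℤ) • w)) 1 * monomial w c ^ (t + 1) := by
    rw [hpow, monomial_mul_monomial, monomial_mul_monomial, zero_add, mul_one, one_mul,
      ← natCast_zsmul, smul_smul, ← add_smul, hq, ← ht]
    congr 2
    push_cast
    ring
  change monomial 0 (c ^ (t + 1)) * exp H ^ (q + 1) *
    (monomial (-(P : ℤ) • w) 1 * exp E ^ (q + 1)) = LaurentRing.sigmaPow p k (n + m) f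
      (monomial (-(P : ℤ) • w) 1 * exp E ^ (q + 1)) * a.1 ^ (t + 1)
  rw [hau, map_mul, map_pow, LaurentRing.sigmaPow_monomial, map_one, mul_pow]
  linear_combination exp H ^ (q + 1) * exp E ^ (q + 1) * h2 -
    monomial (p ^ f • (-(P : ℤ) • w)) 1 * monomial w c ^ (t + 1) * h1

end FrobeniusGauge

end

end LogDecay

/-! ### Conclusion -/

theorem mainTheorem6 (p : ℕ) [Fact p.Prime] (k : Type u) [Field k] [CharP k p]
    [PerfectRing k p] (n m f : ℕ) (hn : 0 < n) (hf : 0 < f) (r : ℝ) (hr : r < 1)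
    (M : LogDecay.PreSigmaNablaModule.{u, v} (LogDecay.logDecayRing p k n m r) f)
    (hM : M.IsSigmaNablaModule) (hrank : M.IsRankOne) :
    ∃ (t : ℕ) (N : LogDecay.PreSigmaNablaModule.{u, u} (LogDecay.tateAlgebra p k (n + m)) f),
      N.IsSigmaNablaModule ∧
        LogDecay.PreSigmaNablaModule.IsBaseChangeOf
          (LogDecay.tateAlgebra_le_logDecayRing p k n m r) (M.tensorPowSucc t) N := by
  obtain ⟨e, a, b, he⟩ := LogDecay.PreSigmaNablaModule.exists_isFrame hf hM hrank
  have hc := he.isCompatible hM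
  have ha := he.isUnit hM
  suffices h : ∃ (t : ℕ) (g : (LogDecay.logDecayRing p k n m r).ringˣ)
      (u : (LogDecay.tateAlgebra p k (n + m)).ringˣ), u.1.1 * g.1.1 =
        LogDecay.LaurentRing.sigmaPow p k (n + m) f g.1.1 * a.1 ^ (t + 1) by
    obtain ⟨t, g, u, hu⟩ := h
    exact ⟨t, he.exists_tate_model hf _ hc t g u hu⟩
  rcases lt_or_ge r 0 with hr0 | hr0
  -- For r < 0 the unit a and its inverse already lie in the Tate algebra, so τ = 1 and no change of
  -- basis is needed.
  · obtain ⟨⟨a, a', h1, h2⟩, rfl⟩ := ha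
    refine ⟨0, 1, ⟨⟨a.1, LogDecay.mem_tateAlgebra_of_neg hr0 a.2⟩,
      ⟨a'.1, LogDecay.mem_tateAlgebra_of_neg hr0 a'.2⟩,
      Subtype.ext (congrArg Subtype.val h1 : _), Subtype.ext (congrArg Subtype.val h2 : _)⟩, ?_⟩
    change a.1 * 1 = LogDecay.LaurentRing.sigmaPow p k (n + m) f 1 * a.1 ^ (0 + 1)
    rw [map_one, mul_one, one_mul, zero_add, pow_one]
  · exact LogDecay.exists_tate_gauge hf hr0 hr ha hc
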